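/- **Setting.** Let $\mathcal D$ be a probability distribution, let $f(x,\xi)$ be a real function of $x\in\mathbb R^d$ and of a sample $\xi\sim\mathcal D$ that is differentiable in $x$, with $\nabla f$ jointly measurable, and let $F(x)=\mathbb E_{\xi\sim\mathcal D}[f(x,\xi)]$ be well defined and differentiable. For constants $\sigma,\widehat G\ge 0$ and $\beta>0$ assume: 1. $F^*:=\inf_x F(x)>-\infty$; 2. $\mathbb E_\xi[\nabla f(x,\xi)]=\nabla F(x)$ and $\mathbb E_\xi\|\nabla f(x,\xi)-\nabla F(x)\|^2\le\sigma^2$ for all $x$; 3. $\mathbb E_\xi\|\nabla f(x,\xi)-\nabla f(y,\xi)\|^2\le\beta^2\|x-y\|^2$ for all $x,y$; 4. for almost every $\xi$, $\|\nabla f(x,\xi)\|\le\widehat G$ for all $x$. **Algorithm (META-STORM-SG).** Let $a_0,b_0,\eta>0$, $p\in[\frac14,\frac12]$, $q=\frac{1-p}2$. Let $\xi_1,\xi_2,\dots$ be independent samples from $\mathcal D$, let $x_1\in\mathbb R^d$ be given, and put $d_1=\nabla f(x_1,\xi_1)$. For $t=1,2,\dots$ let $$a_{t+1}=\Big(1+\sum_{i=1}^t\tfrac{\|\nabla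 f(x_i,\xi_i)\|^2}{a_0^2}\Big)^{-2/3},\qquad b_t=\frac{\big(b_0^{1/p}+\sum_{i=1}^t\|d_i\|^2\big)^p}{a_{t+1}^q},\qquad x_{t+1}=x_t-\frac{\eta}{b_t}d_t,$$ $$d_{t+1}=\nabla f(x_{t+1},\xi_{t+1})+(1-a_{t+1})\big(d_t-\nabla f(x_t,\xi_{t+1})\big).$$ The output after $T\ge1$ steps is $x_{\rm out}=x_t$ with $t$ uniform on $\{1,\dots,T\}$ and independent of the samples. Write $\mathbf H_T=\sum_{t=1}^T\|\nabla F(x_t)\|^2$, $\Delta=F(x_1)-F^*$, $\hat p=\frac{2(1-p)}3\in[\frac13,\frac12]$. **Constants.** Let $\lambda>0$ be arbitrary, $\beta_{\max}=\max\{\beta,1\}$, $C_0=\min\{1,(a_0/\widehat G)^4\}$ ($C_0=1$ if $\widehat G=0$), and for $\ell\in[\frac14,\frac12]$ $$C_1(\ell)=3\Big(\sigma^2+6\widehat G^2+\frac{\widehat G^2(\sigma^2+24a_0^2+4\widehat G^2)}{a_0^2C_0^{2\ell-1/2}}\Big),\qquad C_2(\ell)=\begin{cases}\frac{18a_0^2}{4\ell-1}&\ell>\frac14\\6a_0^2&\ell=\frac14.\end{cases}$$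 Let $C_1=C_1(q)$, $C_2=C_2(q)$, and $$C_3=\begin{cases}\Big(\frac{\widehat G^2}{a_0^2C_0^{2q-1/2}}+1\Big)\frac{6\eta^2\beta^2}{4q-1}&q>\frac14\\\Big(\frac{\widehat G^2}{a_0^2}+1\Big)6\eta^2\beta^2&q=\frac14,\end{cases}$$ $$C_4=b_0^{\frac1p-1}+\frac2\eta\Delta+\frac{\lambda C_1(1/4)}{\eta\beta_{\max}},\quad C_5=\frac{\lambda C_2(1/4)}{\eta\beta_{\max}},\quad C_6=\frac{(C_7+C_8)^{\frac1p-1}}{1-p},$$ $$C_7=\Big(1+\frac{6\lambda\widehat G^2}{a_0^2}\Big)\eta\beta_{\max},\quad C_8=\Big(\frac1\lambda+6\lambda\Big)\eta\beta_{\max}.$$ **Theorem.** There are constants $C_9,C_{10}$ that depend only on $a_0,b_0,\eta,p,\lambda,\sigma,\widehat G,\beta,\Delta$, and a constant $K$ that depends only on $a_0,b_0,\eta,p,\lambda,\sigma,\widehat G$, such that the following holds for all such problems, all $x_1$ and all $T\ge1$ (all the expectations being of integrable random variables). (a) With $S_T=(2\sigma^2T)^{\hat p}$ and $R_T=\big(1+2S_T/a_0^{2\hat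 p}\big)^{1/3}$, $$\begin{aligned}\mathbb E\big[\mathbf H_T^{\hat p}\big]\le{}&4C_9\mathbf 1[S_T\le4C_9]+4C_{10}\mathbf 1[S_T\le4C_{10}]\\&+4\begin{cases}\Big(\frac{2C_1}{C_3}\Big)^{\frac{\hat p}{1-2p}}+\Big(\Big(\frac{2C_2}{C_3}\Big)^{\frac{\hat p}{1-2p}}+(2C_3)^{\frac{\hat p}{2p}}\Big)R_T&p\ne\frac12\\\Big(C_1+\Big(\frac{C_2}{\hat p}+\frac{C_3}{\hat p}\Big)\log\Big(1+\frac{S_T}{\min\{a_0^{2\hat p}/2,\,4b_0^{2\hat p}\}}\Big)\Big)^{\hat p}R_T&p=\frac12\end{cases}\\&+4\Big(C_4+(3C_5+C_6)\log\frac{a_0^{2/3}+2(2\sigma^2T)^{1/3}}{a_0^{2/3}}+C_6\log\frac{2C_7+2C_8}{b_0}\Big)^{\frac{\hat p}{1-p}}R_T.\end{aligned}$$ (b) If $\sigma>0$, $\beta\ge1$ and $T$ is so large that $S_T>4C_9$ and $S_T>4C_{10}$, then, with $$Q_T=\Delta^{\frac{\hat p}{1-p}}+\beta^{\frac{\hat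 p}p}\log^{\frac{\hat p}{1-p}}\beta+\beta^{\frac{\hat p}p}\log^{\frac{\hat p}{1-p}}(1+\sigma^2T),$$ $$\mathbb E\big[\mathbf H_T^{\hat p}\big]\le K\,Q_T\,(1+\sigma^2T)^{\hat p/3}\qquad\text{and}\qquad\mathbb E\big[\|\nabla F(x_{\rm out})\|^{2\hat p}\big]\le K\,Q_T\Big(\frac1{T^{\hat p}}+\frac{\sigma^{2\hat p/3}}{T^{2\hat p/3}}\Big).$$ -/

import Mathlib

open MeasureTheory ProbabilityTheory

noncomputable section

namespace MetaStormSG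

/-! ### The stochastic optimization problem -/

/-- The Euclidean space `ℝ^d`, with the `ℓ²` norm. -/
abbrev Space (d : ℕ) : Type := EuclideanSpace ℝ (Fin d)

/-- The objective `F(x) = 𝔼_{z ∼ D} [f(x, z)]`. -/
def objective {d : ℕ} {Ξ : Type*} [MeasurableSpace Ξ] (D : Measure Ξ)
    (f : Space d → Ξ → ℝ) (x : Space d) : ℝ :=
  ∫ z, f x z ∂D

/-- The stochastic gradient `∇f(x, z)`: the gradient of `f(·, z)` at `x`. -/
def stochGrad {d : ℕ} {Ξ : Type*} (f : Space d → Ξ → ℝ) (x : Space d) (z : Ξ) : Space d :=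
  gradient (fun y => f y z) x

/-- The initial gap `F(x) - F*`, where `F* = inf F`. -/
def gap {d : ℕ} {Ξ : Type*} [MeasurableSpace Ξ] (D : Measure Ξ)
    (f : Space d → Ξ → ℝ) (x : Space d) : ℝ :=
  objective D f x - ⨅ y, objective D f y

/-- The four assumptions on the problem, after the regularity that gives them a meaning.
All integrals in them are of integrable functions, because of `measurable_grad` and `bounded`. -/
structure Assumptions {d : ℕ} {Ξ : Type*} [MeasurableSpace Ξ] (D : Measure Ξ)
    (f : Space d → Ξ → ℝ) (σ G β : ℝ) : Prop where
  /-- `F` is well defined. -/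
  integrable : ∀ x, Integrable (f x) D
  /-- `f(·, z)` is differentiable, for almost every sample `z`. -/
  differentiable : ∀ᵐ z ∂D, Differentiable ℝ (fun x => f x z)
  /-- The stochastic gradient is jointly measurable. -/
  measurable_grad : Measurable (fun w : Space d × Ξ => stochGrad f w.1 w.2)
  /-- `F` is differentiable. -/
  differentiable_objective : Differentiable ℝ (objective D f)
  /-- Assumption 1: `F* = inf F > -∞`. -/
  bddBelow : BddBelow (Set.range (objective D f))
  /-- Assumption 2, first half: the stochastic gradient is unbiased. -/
  unbiased : ∀ x, ∫ z, stochGrad f x z ∂D = gradient (objective D f) x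
  /-- Assumption 2, second half: its variance is at most `σ²`. -/
  variance : ∀ x, ∫ z, ‖stochGrad f x z - gradient (objective D f) x‖ ^ 2 ∂D ≤ σ ^ 2
  /-- Assumption 3: averaged `β`-smoothness. -/
  smooth : ∀ x y, ∫ z, ‖stochGrad f x z - stochGrad f y z‖ ^ 2 ∂D ≤ β ^ 2 * ‖x - y‖ ^ 2
  /-- Assumption 4: bounded stochastic gradients. -/
  bounded : ∀ᵐ z ∂D, ∀ x, ‖stochGrad f x z‖ ≤ G

/-! ### The algorithm -/

/-- The parameters of the algorithm. -/
structure Params where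
  a₀ : ℝ
  b₀ : ℝ
  η : ℝ
  p : ℝ

/-- The admissible parameters. -/
structure Params.Valid (P : Params) : Prop where
  a₀_pos : 0 < P.a₀
  b₀_pos : 0 < P.b₀
  η_pos : 0 < P.η
  le_p : 1 / 4 ≤ P.p
  p_le : P.p ≤ 1 / 2

/-- The exponent `q`, determined by `p + 2 q = 1`. -/
def Params.q (P : Params) : ℝ := (1 - P.p) / 2

/-- The exponent `p̂ = 2 (1 - p) / 3`. -/
def Params.ph (P : Params) : ℝ := 2 * (1 - P.p) / 3

/-- What the algorithm remembers at step `t`. -/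
structure State (d : ℕ) where
  /-- the iterate `x_t` -/
  x : Space d
  /-- the direction `d_t` -/
  dir : Space d
  /-- `∑_{i ≤ t} ‖∇f(x_i, ξ_i)‖²` -/
  gradSum : ℝ
  /-- `∑_{i ≤ t} ‖d_i‖²` -/
  dirSum : ℝ

/-- The momentum parameter `a_{t+1} = (1 + ∑_{i ≤ t} ‖∇f(x_i, ξ_i)‖² / a₀²)^(-2/3)`. -/
def State.a {d : ℕ} (P : Params) (s : State d) : ℝ :=
  (1 + s.gradSum / P.a₀ ^ 2) ^ (-(2 / 3) : ℝ)

/-- The step size denominator `b_t = (b₀^(1/p) + ∑_{i ≤ t} ‖d_i‖²)^p / a_{t+1}^q`. -/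
def State.b {d : ℕ} (P : Params) (s : State d) : ℝ :=
  (P.b₀ ^ (1 / P.p) + s.dirSum) ^ P.p / s.a P ^ P.q

/-- The first step: `x_1` is given and `d_1 = ∇f(x_1, ξ_1)`. -/
def State.init {d : ℕ} {Ξ : Type*} (g : Space d → Ξ → Space d) (x₁ : Space d) (z : Ξ) :
    State d where
  x := x₁
  dir := g x₁ z
  gradSum := ‖g x₁ z‖ ^ 2
  dirSum := ‖g x₁ z‖ ^ 2

/-- One iteration, with the new sample `z = ξ_{t+1}`:
`x_{t+1} = x_t - (η / b_t) d_t` and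
`d_{t+1} = ∇f(x_{t+1}, z) + (1 - a_{t+1}) (d_t - ∇f(x_t, z))`. -/
def State.next {d : ℕ} {Ξ : Type*} (P : Params) (g : Space d → Ξ → Space d)
    (s : State d) (z : Ξ) : State d :=
  let x' : Space d := s.x - (P.η / s.b P) • s.dir
  let d' : Space d := g x' z + (1 - s.a P) • (s.dir - g s.x z)
  { x := x'
    dir := d'
    gradSum := s.gradSum + ‖g x' z‖ ^ 2
    dirSum := s.dirSum + ‖d'‖ ^ 2 }

/-- META-STORM-SG on a sequence of samples. Steps and samples are numbered from `0`:
`run P g x₁ z n` is the state at the step `t = n + 1`, and `z n` is the sample `ξ_{n+1}`. -/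
def run {d : ℕ} {Ξ : Type*} (P : Params) (g : Space d → Ξ → Space d) (x₁ : Space d)
    (z : ℕ → Ξ) : ℕ → State d
  | 0 => State.init g x₁ (z 0)
  | n + 1 => (run P g x₁ z n).next P g (z (n + 1))

/-- `‖∇F(x_{n+1})‖²` along the run of META-STORM-SG on the samples `z`. -/
def gradNormSq {d : ℕ} {Ξ : Type*} [MeasurableSpace Ξ] (P : Params) (D : Measure Ξ)
    (f : Space d → Ξ → ℝ) (x₁ : Space d) (z : ℕ → Ξ) (n : ℕ) : ℝ :=
  ‖gradient (objective D f) (run P (stochGrad f) x₁ z n).x‖ ^ 2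

/-- `H_T = ∑_{t = 1}^T ‖∇F(x_t)‖²`. -/
def H {d : ℕ} {Ξ : Type*} [MeasurableSpace Ξ] (P : Params) (D : Measure Ξ)
    (f : Space d → Ξ → ℝ) (x₁ : Space d) (z : ℕ → Ξ) (T : ℕ) : ℝ :=
  ∑ n ∈ Finset.range T, gradNormSq P D f x₁ z n

/-- The samples `ξ_1, ξ_2, …` are independent draws from `D`. -/
structure IsSampling {Ξ Ω : Type*} [MeasurableSpace Ξ] [MeasurableSpace Ω]
    (D : Measure Ξ) (μ : Measure Ω) (ξ : ℕ → Ω → Ξ) : Prop where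
  measurable : ∀ n, Measurable (ξ n)
  law : ∀ n, μ.map (ξ n) = D
  indep : iIndepFun ξ μ

/-- The index `ι` of the output: uniform on the `T` steps, independent of the samples. -/
structure IsOutputIndex {Ξ Ω : Type*} [MeasurableSpace Ξ] [MeasurableSpace Ω]
    (μ : Measure Ω) (ξ : ℕ → Ω → Ξ) (T : ℕ) (ι : Ω → ℕ) : Prop where
  measurable : Measurable ι
  uniform : ∀ n < T, μ (ι ⁻¹' {n}) = (T : ENNReal)⁻¹
  indep : IndepFun ι (fun ω n => ξ n ω) μ

/-! ### The constants of the bound -/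

/-- `C₀ = min {1, (a₀ / G)⁴}`, which is `1` for `G = 0`. -/
def C0 (P : Params) (G : ℝ) : ℝ := if G = 0 then 1 else min 1 ((P.a₀ / G) ^ 4)

/-- `C₁(ℓ)`. -/
def C1of (P : Params) (σ G ℓ : ℝ) : ℝ :=
  3 * (σ ^ 2 + 6 * G ^ 2
    + G ^ 2 * (σ ^ 2 + 24 * P.a₀ ^ 2 + 4 * G ^ 2) / (P.a₀ ^ 2 * C0 P G ^ (2 * ℓ - 1 / 2)))

/-- `C₂(ℓ)`, for `ℓ ≥ 1/4`. -/
def C2of (P : Params) (ℓ : ℝ) : ℝ :=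
  if 1 / 4 < ℓ then 18 * P.a₀ ^ 2 / (4 * ℓ - 1) else 6 * P.a₀ ^ 2

def C1 (P : Params) (σ G : ℝ) : ℝ := C1of P σ G P.q

def C2 (P : Params) : ℝ := C2of P P.q

def C3 (P : Params) (G β : ℝ) : ℝ :=
  if 1 / 4 < P.q then
    (G ^ 2 / (P.a₀ ^ 2 * C0 P G ^ (2 * P.q - 1 / 2)) + 1)
      * (6 * P.η ^ 2 * β ^ 2 / (4 * P.q - 1))
  else
    (G ^ 2 / P.a₀ ^ 2 + 1) * (6 * P.η ^ 2 * β ^ 2)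

/-- Here `Δ = F(x₁) - F*`, and `lam > 0` is a free parameter. -/
def C4 (P : Params) (σ G β Δ lam : ℝ) : ℝ :=
  P.b₀ ^ (1 / P.p - 1) + 2 / P.η * Δ + lam * C1of P σ G (1 / 4) / (P.η * max β 1)

def C5 (P : Params) (β lam : ℝ) : ℝ := lam * C2of P (1 / 4) / (P.η * max β 1)

def C7 (P : Params) (G β lam : ℝ) : ℝ :=
  (1 + 6 * lam * G ^ 2 / P.a₀ ^ 2) * (P.η * max β 1)

def C8 (P : Params) (β lam : ℝ) : ℝ := (1 / lam + 6 * lam) * (P.η * max β 1)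

def C6 (P : Params) (G β lam : ℝ) : ℝ :=
  (C7 P G β lam + C8 P β lam) ^ (1 / P.p - 1) / (1 - P.p)

/-- `(2 σ² T)^p̂`. -/
def noise (P : Params) (σ : ℝ) (T : ℕ) : ℝ := (2 * σ ^ 2 * T) ^ P.ph

/-- `(1 + 2 (2 σ² T)^p̂ / a₀^(2 p̂))^(1/3)`. -/
def growth (P : Params) (σ : ℝ) (T : ℕ) : ℝ :=
  (1 + 2 * noise P σ T / P.a₀ ^ (2 * P.ph)) ^ (1 / 3 : ℝ)

/-- The part of the bound with a case distinction on `p`. -/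
def caseTerm (P : Params) (σ G β : ℝ) (T : ℕ) : ℝ :=
  if P.p = 1 / 2 then
    (C1 P σ G + (C2 P / P.ph + C3 P G β / P.ph)
        * Real.log (1 + noise P σ T / min (P.a₀ ^ (2 * P.ph) / 2) (4 * P.b₀ ^ (2 * P.ph))))
          ^ P.ph * growth P σ T
  else
    (2 * C1 P σ G / C3 P G β) ^ (P.ph / (1 - 2 * P.p))
      + ((2 * C2 P / C3 P G β) ^ (P.ph / (1 - 2 * P.p))
          + (2 * C3 P G β) ^ (P.ph / (2 * P.p))) * growth P σ T

/-- The part of the bound with the initial gap. -/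
def gapTerm (P : Params) (σ G β Δ lam : ℝ) (T : ℕ) : ℝ :=
  (C4 P σ G β Δ lam
    + (3 * C5 P β lam + C6 P G β lam)
        * Real.log ((P.a₀ ^ (2 / 3 : ℝ) + 2 * (2 * σ ^ 2 * T) ^ (1 / 3 : ℝ))
            / P.a₀ ^ (2 / 3 : ℝ))
    + C6 P G β lam * Real.log ((2 * C7 P G β lam + 2 * C8 P β lam) / P.b₀))
      ^ (P.ph / (1 - P.p)) * growth P σ T

/-- The explicit bound on `𝔼 [H_T^p̂]`. -/
def explicitBound (P : Params) (σ G β Δ lam C9 C10 : ℝ) (T : ℕ) : ℝ :=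
  (if noise P σ T ≤ 4 * C9 then 4 * C9 else 0)
    + (if noise P σ T ≤ 4 * C10 then 4 * C10 else 0)
    + 4 * caseTerm P σ G β T
    + 4 * gapTerm P σ G β Δ lam T

/-- `Δ^(p̂/(1-p)) + β^(p̂/p) log^(p̂/(1-p)) β + β^(p̂/p) log^(p̂/(1-p)) (1 + σ² T)`. -/
def rateFactor (P : Params) (σ β Δ : ℝ) (T : ℕ) : ℝ :=
  Δ ^ (P.ph / (1 - P.p))
    + β ^ (P.ph / P.p) * Real.log β ^ (P.ph / (1 - P.p))
    + β ^ (P.ph / P.p) * Real.log (1 + σ ^ 2 * T) ^ (P.ph / (1 - P.p))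

end MetaStormSG

end

/-! Put V_t = (1 + ∑_{i≤t} ‖∇f(x_i,ξ_i)‖²/a₀²)^(1/3) and u_t = b₀^(1/p) + ∑_{i≤t} ‖d_i‖². Then
a_{t+1} = V_t⁻² and b_t = u_t^p V_t^(1-p). With ε_t = ‖d_t - ∇F(x_t)‖², three sums are played
against each other: Z = ∑ ‖d_t‖²/b_t, W = ∑ ε_t/V_t and Y = ∑ V_t‖d_t‖²/b_t².

The descent lemma and Young's inequality bound Z by Δ/η + (c/2)W + (1/(2c) + βη/2)Y
(`Assumptions.sum_step_le`). A potential built on V_t ε_t has decreasing expectation, which bounds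
𝔼W by a constant plus 12a₀² 𝔼 log V_T + 4β²η² 𝔼Y (`Assumptions.integral_sum_err_le`). The obstacle
is that V_{t+1} and ε_{t+1} depend on the same sample; it is overcome by the bounded gradients
(`mul_le_add_of_cube_sub_le`). Pathwise, κY ≤ Z + κ^(1/p-1)(log V_T + const) (`mul_sum_stepSq_le`).
For c = λ/(ηβ_max) and κ = C₇ + C₈ the total coefficient of Y is at most κ/2, so half of Z is
absorbed, and 𝔼Z and 𝔼W are bounded by affine functions of 𝔼 log V_T
(`Assumptions.integral_sum_le`).

Moreover H_T ≤ 2(∑‖d_t‖² + V_T W) and (∑‖d_t‖²)^(1-p) ≤ V_T^(1-p)(b₀^(1/p-1) + Z). Hölder's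
inequality with exponents 3 and 3/2 then bounds h = 𝔼[H_T^p̂] by 2^p̂ y^(1/3) times powers of affine
functions of log y, where y = 𝔼[V_T^(3p̂)] ≤ 1 + (S_T + 2h)/a₀^(2p̂)
(`Assumptions.integral_H_rpow_le`).

This recursion has two regimes. If S_T < 2h, then y is at most affine in h, the right side grows
slower than h, and h is at most a constant, which serves as C₉. If 2h ≤ S_T, then y^(1/3) ≤ R_T. The
contribution of W carries the exponent p̂ ≤ 1/2 < 2/3 and is of lower order, and the slope 2C₅ +
κ^(1/p-1) from Z is at most 3C₅ + C₆; so four times the gap term suffices once S_T exceeds a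
threshold, which serves as C₁₀. Below 4C₁₀ the bound h ≤ S_T/2 is enough. Hence the term with the
case distinction on p only has to be nonnegative. Above the threshold the logarithm also dominates Δ
and the other constants of the gap term, so K can be free of β and Δ. -/

namespace MetaStormSG

/-! ### Essentially bounded random variables -/

/-- A measurable real function that is bounded almost everywhere. -/
def EssBdd {Ω : Type*} [MeasurableSpace Ω] (μ : Measure Ω) (φ : Ω → ℝ) : Prop :=
  Measurable φ ∧ ∃ C, ∀ᵐ ω ∂μ, |φ ω| ≤ C

namespace EssBdd

variable {Ω : Type*} [MeasurableSpace Ω] {μ : Measure Ω} {φ ψ : Ω → ℝ}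

theorem integrable [IsFiniteMeasure μ] (h : EssBdd μ φ) : Integrable φ μ := by
  obtain ⟨hm, C, hC⟩ := h
  exact Integrable.of_bound hm.aestronglyMeasurable C (by simpa using hC)

theorem memLp [IsFiniteMeasure μ] (h : EssBdd μ φ) (r : ENNReal) : MemLp φ r μ := by
  obtain ⟨hm, C, hC⟩ := h
  exact MemLp.of_bound hm.aestronglyMeasurable C (by simpa using hC)

theorem const (c : ℝ) : EssBdd μ (fun _ => c) :=
  ⟨measurable_const, |c|, Filter.Eventually.of_forall fun _ => le_rfl⟩

theorem add (h : EssBdd μ φ) (h' : EssBdd μ ψ) : EssBdd μ (fun ω => φ ω + ψ ω) := by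
  obtain ⟨hm, C, hC⟩ := h
  obtain ⟨hm', C', hC'⟩ := h'
  refine ⟨hm.add hm', C + C', ?_⟩
  filter_upwards [hC, hC'] with ω h1 h2
  exact (abs_add_le _ _).trans (add_le_add h1 h2)

theorem mul (h : EssBdd μ φ) (h' : EssBdd μ ψ) : EssBdd μ (fun ω => φ ω * ψ ω) := by
  obtain ⟨hm, C, hC⟩ := h
  obtain ⟨hm', C', hC'⟩ := h'
  refine ⟨hm.mul hm', C * C', ?_⟩
  filter_upwards [hC, hC'] with ω h1 h2
  rw [abs_mul]
  exact mul_le_mul h1 h2 (abs_nonneg _) ((abs_nonneg _).trans h1)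

theorem const_mul (c : ℝ) (h : EssBdd μ φ) : EssBdd μ (fun ω => c * φ ω) := (const c).mul h

theorem sub (h : EssBdd μ φ) (h' : EssBdd μ ψ) : EssBdd μ (fun ω => φ ω - ψ ω) := by
  simpa [sub_eq_add_neg] using h.add (h'.const_mul (-1))

theorem sum {ι : Type*} (s : Finset ι) {φ : ι → Ω → ℝ} (h : ∀ i, EssBdd μ (φ i)) :
    EssBdd μ (fun ω => ∑ i ∈ s, φ i ω) := by
  classical
  induction s using Finset.induction_on with
  | empty => simpa using const (μ := μ) 0
  | insert i s his ih => simpa [Finset.sum_insert his] using (h i).add ih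

theorem rpow (h : EssBdd μ φ) {r : ℝ} (hr : 0 ≤ r) : EssBdd μ (fun ω => φ ω ^ r) := by
  obtain ⟨hm, C, hC⟩ := h
  refine ⟨hm.pow_const r, C ^ r, ?_⟩
  filter_upwards [hC] with ω h1
  exact (Real.abs_rpow_le_abs_rpow _ _).trans (Real.rpow_le_rpow (abs_nonneg _) h1 hr)

theorem pow (h : EssBdd μ φ) (k : ℕ) : EssBdd μ (fun ω => φ ω ^ k) := by
  simpa using h.rpow (r := k) (by positivity)

theorem of_abs_le (hφ : Measurable φ) (h : EssBdd μ ψ) (hle : ∀ᵐ ω ∂μ, |φ ω| ≤ ψ ω) :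
    EssBdd μ φ := by
  obtain ⟨-, C, hC⟩ := h
  refine ⟨hφ, C, ?_⟩
  filter_upwards [hC, hle] with ω h1 h2
  exact h2.trans ((le_abs_self _).trans h1)

end EssBdd

/-- Jensen's inequality for a power with exponent in `[0, 1]`. -/
theorem integral_rpow_le_rpow_integral {Ω : Type*} [MeasurableSpace Ω] {μ : Measure Ω}
    [IsProbabilityMeasure μ] {φ : Ω → ℝ} {r : ℝ} (hr : 0 ≤ r) (hr1 : r ≤ 1)
    (hφ : EssBdd μ φ) (h0 : ∀ᵐ ω ∂μ, 0 ≤ φ ω) :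
    ∫ ω, φ ω ^ r ∂μ ≤ (∫ ω, φ ω ∂μ) ^ r :=
  (Real.concaveOn_rpow hr hr1).le_map_integral
    (fun x _ => (Real.continuousAt_rpow_const x r (Or.inr hr)).continuousWithinAt) isClosed_Ici h0
    hφ.integrable (hφ.rpow hr).integrable

/-- `𝔼 [log φ] ≤ log 𝔼 [φ]`. -/
theorem integral_log_le_log_integral {Ω : Type*} [MeasurableSpace Ω] {μ : Measure Ω}
    [IsProbabilityMeasure μ] {φ : Ω → ℝ} (hφ : EssBdd μ φ) (h1 : ∀ ω, 1 ≤ φ ω) :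
    ∫ ω, Real.log (φ ω) ∂μ ≤ Real.log (∫ ω, φ ω ∂μ) := by
  have hlog : EssBdd μ (fun ω => Real.log (φ ω)) := by
    refine EssBdd.of_abs_le (Real.measurable_log.comp hφ.1) hφ (Filter.Eventually.of_forall ?_)
    intro ω
    rw [abs_of_nonneg (Real.log_nonneg (h1 ω))]
    linarith [Real.log_le_sub_one_of_pos (show 0 < φ ω by linarith [h1 ω])]
  have hy : 1 ≤ ∫ ω, φ ω ∂μ := by
    have := integral_mono (EssBdd.const (μ := μ) 1).integrable hφ.integrable h1
    simpa using this
  have hy0 : 0 < ∫ ω, φ ω ∂μ := by linarith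
  set y := ∫ ω, φ ω ∂μ with hydef
  -- The tangent line of log at the mean y lies above log; integrating it gives the claim.
  have key : ∀ ω, Real.log (φ ω) ≤ (1 / y) * φ ω + (Real.log y - 1) := by
    intro ω
    have hp : 0 < φ ω := by linarith [h1 ω]
    have := Real.log_le_sub_one_of_pos (div_pos hp hy0)
    rw [Real.log_div hp.ne' hy0.ne'] at this
    have e : (1 / y) * φ ω = φ ω / y := by ring
    linarith
  have h := integral_mono hlog.integrable
    ((hφ.const_mul (1 / y)).add (EssBdd.const (Real.log y - 1))).integrable key
  rw [integral_add (hφ.const_mul (1 / y)).integrable (EssBdd.const _).integrable,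
    integral_const_mul, ← hydef] at h
  have e : 1 / y * y = 1 := by field_simp
  simp only [integral_const, probReal_univ, one_smul] at h
  linarith

/-- Hölder's inequality with exponents `3` and `3/2`. -/
theorem integral_mul_rpow_le {Ω : Type*} [MeasurableSpace Ω] {μ : Measure Ω}
    [IsProbabilityMeasure μ] {φ ψ : Ω → ℝ} (hφ : EssBdd μ φ) (hψ : EssBdd μ ψ)
    (hφ0 : ∀ᵐ ω ∂μ, 0 ≤ φ ω) (hψ0 : ∀ᵐ ω ∂μ, 0 ≤ ψ ω) :
    ∫ ω, φ ω ^ (1 / 3 : ℝ) * ψ ω ^ (2 / 3 : ℝ) ∂μ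
      ≤ (∫ ω, φ ω ∂μ) ^ (1 / 3 : ℝ) * (∫ ω, ψ ω ∂μ) ^ (2 / 3 : ℝ) := by
  have hpq : (3 : ℝ).HolderConjugate (3 / 2) := by
    rw [Real.holderConjugate_iff]; norm_num
  have h := integral_mul_le_Lp_mul_Lq_of_nonneg (μ := μ) hpq
    (f := fun ω => φ ω ^ (1 / 3 : ℝ)) (g := fun ω => ψ ω ^ (2 / 3 : ℝ))
    (by filter_upwards [hφ0] with ω h; exact Real.rpow_nonneg h _)
    (by filter_upwards [hψ0] with ω h; exact Real.rpow_nonneg h _)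
    ((hφ.rpow (by norm_num)).memLp _) ((hψ.rpow (by norm_num)).memLp _)
  have e1 : ∫ ω, (φ ω ^ (1 / 3 : ℝ)) ^ (3 : ℝ) ∂μ = ∫ ω, φ ω ∂μ := by
    refine integral_congr_ae ?_
    filter_upwards [hφ0] with ω h
    rw [← Real.rpow_mul h]; norm_num
  have e2 : ∫ ω, (ψ ω ^ (2 / 3 : ℝ)) ^ (3 / 2 : ℝ) ∂μ = ∫ ω, ψ ω ∂μ := by
    refine integral_congr_ae ?_
    filter_upwards [hψ0] with ω h
    rw [← Real.rpow_mul h]; norm_num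
  rw [e1, e2] at h
  norm_num at h ⊢
  exact h

/-- The second moment about a shifted mean. -/
theorem integral_norm_add_sub_integral_sq_le {E Ξ : Type*} [NormedAddCommGroup E]
    [InnerProductSpace ℝ E] [CompleteSpace E] [MeasurableSpace Ξ] {D : Measure Ξ}
    [IsProbabilityMeasure D] {U : Ξ → E} (hU : MemLp U 2 D) (c : E) :
    ∫ z, ‖c + (U z - ∫ z', U z' ∂D)‖ ^ 2 ∂D ≤ ‖c‖ ^ 2 + ∫ z, ‖U z‖ ^ 2 ∂D := by
  have hUi : Integrable U D := hU.integrable (by norm_num)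
  have hU2 : Integrable (fun z => ‖U z‖ ^ 2) D := hU.integrable_norm_pow (by norm_num)
  set e := ∫ z', U z' ∂D with he
  have key : ∀ z, ‖c + (U z - e)‖ ^ 2
      = ‖U z‖ ^ 2 + (2 * inner ℝ (c - e) (U z) + ‖c - e‖ ^ 2) := by
    intro z
    have : c + (U z - e) = U z + (c - e) := by abel
    rw [this, norm_add_sq_real, real_inner_comm]
    ring
  have hin : Integrable (fun z => inner ℝ (c - e) (U z)) D := hUi.const_inner _
  have h2 : Integrable (fun z => 2 * inner ℝ (c - e) (U z) + ‖c - e‖ ^ 2) D :=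
    (hin.const_mul 2).add (integrable_const _)
  simp_rw [key]
  rw [integral_add hU2 h2, integral_add (hin.const_mul 2) (integrable_const _),
    integral_const_mul, integral_inner hUi, ← he]
  simp only [integral_const, probReal_univ, one_smul]
  have : 2 * inner ℝ (c - e) e + ‖c - e‖ ^ 2 = ‖c‖ ^ 2 - ‖e‖ ^ 2 := by
    rw [inner_sub_left, norm_sub_sq_real, real_inner_self_eq_norm_sq]; ring
  rw [this]
  nlinarith [sq_nonneg ‖e‖]

/-! ### Consequences of the assumptions -/

/-- The descent lemma for a function with a Lipschitz gradient. -/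
theorem descent_of_lipschitz_gradient {E : Type*} [NormedAddCommGroup E]
    [InnerProductSpace ℝ E] [CompleteSpace E] {F : E → ℝ} (hF : Differentiable ℝ F) {β : ℝ}
    (hL : ∀ x y, ‖gradient F x - gradient F y‖ ≤ β * ‖x - y‖) (x v : E) :
    F (x + v) ≤ F x + inner ℝ (gradient F x) v + β / 2 * ‖v‖ ^ 2 := by
  -- The defect of the quadratic upper bound along the segment. Its derivative is nonpositive by the
  -- Lipschitz bound, and φ 1 ≤ φ 0 is the claim.
  let φ : ℝ → ℝ := fun t =>
    F (x + t • v) - t * inner ℝ (gradient F x) v - β / 2 * t ^ 2 * ‖v‖ ^ 2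
  have hd : ∀ t : ℝ, HasDerivAt φ
      (inner ℝ (gradient F (x + t • v) - gradient F x) v - β * t * ‖v‖ ^ 2) t := by
    intro t
    have h1 : HasDerivAt (fun t : ℝ => x + t • v) v t := by
      simpa using ((hasDerivAt_id t).smul_const v).const_add x
    have h2 : HasDerivAt (fun t : ℝ => F (x + t • v)) (inner ℝ (gradient F (x + t • v)) v) t := by
      have := (hF (x + t • v)).hasGradientAt.hasFDerivAt.comp_hasDerivAt t h1
      rwa [InnerProductSpace.toDual_apply_apply] at this
    have h3 := (h2.sub ((hasDerivAt_id t).mul_const (inner ℝ (gradient F x) v))).sub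
      ((((hasDerivAt_id t).pow 2).const_mul (β / 2)).mul_const (‖v‖ ^ 2))
    refine HasDerivAt.congr_deriv (f := φ) h3 ?_
    rw [inner_sub_left]
    simp only [id, Nat.cast_ofNat, Nat.add_one_sub_one, pow_one]
    ring
  have hanti : AntitoneOn φ (Set.Icc 0 1) := by
    refine antitoneOn_of_deriv_nonpos (convex_Icc 0 1)
      (fun t _ => (hd t).continuousAt.continuousWithinAt)
      (fun t _ => (hd t).differentiableAt.differentiableWithinAt) ?_
    intro t ht
    rw [interior_Icc] at ht
    rw [(hd t).deriv]
    have h1 : inner ℝ (gradient F (x + t • v) - gradient F x) v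
        ≤ ‖gradient F (x + t • v) - gradient F x‖ * ‖v‖ := real_inner_le_norm _ _
    have h2 := hL (x + t • v) x
    rw [add_sub_cancel_left, norm_smul, Real.norm_of_nonneg ht.1.le] at h2
    nlinarith [norm_nonneg v]
  have := hanti (Set.left_mem_Icc.2 zero_le_one) (Set.right_mem_Icc.2 zero_le_one) zero_le_one
  simp only [φ, one_smul, zero_smul, add_zero] at this
  linarith

section

variable {d : ℕ} {Ξ : Type*} [MeasurableSpace Ξ] {D : Measure Ξ}
  {f : Space d → Ξ → ℝ} {σ G β : ℝ}

namespace Assumptions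

theorem measurable_stochGrad (h : Assumptions D f σ G β) (x : Space d) :
    Measurable (stochGrad f x) :=
  h.measurable_grad.comp (measurable_const.prodMk measurable_id)

theorem gap_nonneg (h : Assumptions D f σ G β) (x : Space d) : 0 ≤ gap D f x :=
  sub_nonneg.2 (ciInf_le h.bddBelow x)

variable [IsProbabilityMeasure D]

theorem memLp_stochGrad (h : Assumptions D f σ G β) (x : Space d) (r : ENNReal) :
    MemLp (stochGrad f x) r D :=
  MemLp.of_bound (h.measurable_stochGrad x).aestronglyMeasurable G
    (h.bounded.mono fun _ hz => hz x)

theorem integrable_stochGrad (h : Assumptions D f σ G β) (x : Space d) :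
    Integrable (stochGrad f x) D :=
  (h.memLp_stochGrad x 1).integrable le_rfl

theorem norm_gradient_le (h : Assumptions D f σ G β) (x : Space d) :
    ‖gradient (objective D f) x‖ ≤ G := by
  rw [← h.unbiased x]
  simpa using norm_integral_le_of_norm_le_const (h.bounded.mono fun _ hz => hz x)

/-- The mean of a random vector has squared norm at most its second moment, so averaged smoothness
of the samples passes to `F`. The descent lemma needs it. -/
theorem norm_gradient_sub_le (h : Assumptions D f σ G β) (hβ : 0 ≤ β) (x y : Space d) :
    ‖gradient (objective D f) x - gradient (objective D f) y‖ ≤ β * ‖x - y‖ := by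
  have hU : MemLp (fun z => stochGrad f x z - stochGrad f y z) 2 D :=
    (h.memLp_stochGrad x 2).sub (h.memLp_stochGrad y 2)
  have hint : ∫ z, (stochGrad f x z - stochGrad f y z) ∂D
      = gradient (objective D f) x - gradient (objective D f) y := by
    rw [integral_sub (h.integrable_stochGrad x) (h.integrable_stochGrad y), h.unbiased,
      h.unbiased]
  have hU2 : Integrable (fun z => ‖stochGrad f x z - stochGrad f y z‖ ^ 2) D :=
    hU.integrable_norm_pow (by norm_num)
  have h1 : ‖gradient (objective D f) x - gradient (objective D f) y‖ ^ 2
      ≤ ∫ z, ‖stochGrad f x z - stochGrad f y z‖ ^ 2 ∂D := by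
    rw [← hint]
    set e := ∫ z, (stochGrad f x z - stochGrad f y z) ∂D with he
    have hUi := hU.integrable (by norm_num)
    have h3 : ∫ z, (2 * inner ℝ e (stochGrad f x z - stochGrad f y z) - ‖e‖ ^ 2) ∂D
        ≤ ∫ z, ‖stochGrad f x z - stochGrad f y z‖ ^ 2 ∂D := by
      refine integral_mono (((hUi.const_inner e).const_mul 2).sub (integrable_const _)) hU2 ?_
      intro z
      have := sq_nonneg ‖(stochGrad f x z - stochGrad f y z) - e‖
      rw [norm_sub_sq_real, real_inner_comm] at this
      simp only
      linarith
    rw [integral_sub ((hUi.const_inner e).const_mul 2) (integrable_const _),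
      integral_const_mul, integral_inner hUi, ← he, real_inner_self_eq_norm_sq] at h3
    simp only [integral_const, probReal_univ, one_smul] at h3
    linarith
  have h2 := h1.trans (h.smooth x y)
  rw [← mul_pow] at h2
  exact (sq_le_sq₀ (norm_nonneg _) (mul_nonneg hβ (norm_nonneg _))).1 h2

theorem continuous_gradient (h : Assumptions D f σ G β) (hβ : 0 ≤ β) :
    Continuous (gradient (objective D f)) := by
  have : LipschitzWith ⟨β, hβ⟩ (gradient (objective D f)) :=
    LipschitzWith.of_dist_le_mul fun x y => by
      rw [dist_eq_norm, dist_eq_norm]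
      exact h.norm_gradient_sub_le hβ x y
  exact this.continuous

/-- The error of the momentum estimator after one step. -/
theorem integral_estimator_error_le (h : Assumptions D f σ G β) (x x' v : Space d) {a : ℝ} :
    ∫ z, ‖(stochGrad f x' z + (1 - a) • (v - stochGrad f x z))
        - gradient (objective D f) x'‖ ^ 2 ∂D
      ≤ (1 - a) ^ 2 * ‖v - gradient (objective D f) x‖ ^ 2
        + (2 * (1 - a) ^ 2 * (β ^ 2 * ‖x' - x‖ ^ 2)
          + 2 * a ^ 2 * ∫ z, ‖stochGrad f x' z‖ ^ 2 ∂D) := by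
  have hx := h.memLp_stochGrad x 2
  have hx' := h.memLp_stochGrad x' 2
  -- The new error is (1-a) times the old one plus the centred part of this vector; the cross term
  -- integrates to zero.
  have hU : MemLp (fun z => stochGrad f x' z - (1 - a) • stochGrad f x z) 2 D :=
    hx'.sub (hx.const_smul (1 - a))
  have hint : ∫ z, (stochGrad f x' z - (1 - a) • stochGrad f x z) ∂D
      = gradient (objective D f) x' - (1 - a) • gradient (objective D f) x := by
    rw [integral_sub (g := fun z => (1 - a) • stochGrad f x z) (h.integrable_stochGrad x')
      ((h.integrable_stochGrad x).smul (1 - a)), integral_smul, h.unbiased, h.unbiased]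
  have h1 := integral_norm_add_sub_integral_sq_le hU
    ((1 - a) • (v - gradient (objective D f) x))
  rw [hint, norm_smul, mul_pow, Real.norm_eq_abs, sq_abs] at h1
  have e1 : ∀ z, (1 - a) • (v - gradient (objective D f) x)
      + (stochGrad f x' z - (1 - a) • stochGrad f x z
        - (gradient (objective D f) x' - (1 - a) • gradient (objective D f) x))
      = (stochGrad f x' z + (1 - a) • (v - stochGrad f x z))
        - gradient (objective D f) x' := by
    intro z; simp only [smul_sub]; abel
  simp_rw [e1] at h1
  refine h1.trans (add_le_add_right ?_ _)
  have hd2 : Integrable (fun z => ‖stochGrad f x' z - stochGrad f x z‖ ^ 2) D :=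
    (hx'.sub hx).integrable_norm_pow (by norm_num)
  have hg2 : Integrable (fun z => ‖stochGrad f x' z‖ ^ 2) D :=
    hx'.integrable_norm_pow (by norm_num)
  have h2 : ∫ z, ‖stochGrad f x' z - (1 - a) • stochGrad f x z‖ ^ 2 ∂D
      ≤ ∫ z, (2 * (1 - a) ^ 2 * ‖stochGrad f x' z - stochGrad f x z‖ ^ 2
        + 2 * a ^ 2 * ‖stochGrad f x' z‖ ^ 2) ∂D := by
    refine integral_mono (hU.integrable_norm_pow (by norm_num))
      ((hd2.const_mul _).add (hg2.const_mul _)) ?_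
    intro z
    -- The second part keeps the raw gradient at the new point and not its noise: its square is
    -- exactly what the next step adds to `gradSum`, so it can be summed later.
    have e : stochGrad f x' z - (1 - a) • stochGrad f x z
        = (1 - a) • (stochGrad f x' z - stochGrad f x z) + a • stochGrad f x' z := by
      simp only [smul_sub, sub_smul, one_smul]; abel
    simp only
    rw [e]
    have hn := parallelogram_law_with_norm ℝ
      ((1 - a) • (stochGrad f x' z - stochGrad f x z)) (a • stochGrad f x' z)
    rw [norm_smul, norm_smul] at hn
    have s1 := sq_abs (1 - a)
    have s2 := sq_abs a
    simp only [Real.norm_eq_abs] at hn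
    have h3 := mul_self_nonneg ‖(1 - a) • (stochGrad f x' z - stochGrad f x z)
      - a • stochGrad f x' z‖
    nlinarith [mul_pow |1 - a| ‖stochGrad f x' z - stochGrad f x z‖ 2,
      mul_pow |a| ‖stochGrad f x' z‖ 2]
  rw [integral_add (hd2.const_mul _) (hg2.const_mul _), integral_const_mul,
    integral_const_mul] at h2
  have h3 := h.smooth x' x
  have h4 : 0 ≤ 2 * (1 - a) ^ 2 := by positivity
  nlinarith [mul_le_mul_of_nonneg_left h3 h4]

end Assumptions

end

/-! ### Measurability of the run and independence of the next sample -/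

instance State.instMeasurableSpace (d : ℕ) : MeasurableSpace (State d) :=
  MeasurableSpace.comap (fun s => (s.x, s.dir, s.gradSum, s.dirSum)) inferInstance

section

variable {d : ℕ}

theorem State.measurable_components :
    Measurable (fun s : State d => (s.x, s.dir, s.gradSum, s.dirSum)) :=
  comap_measurable _

theorem State.measurable_x : Measurable (State.x : State d → Space d) :=
  State.measurable_components.fst

theorem State.measurable_dir : Measurable (State.dir : State d → Space d) :=
  State.measurable_components.snd.fst

theorem State.measurable_gradSum : Measurable (State.gradSum : State d → ℝ) :=
  State.measurable_components.snd.snd.fst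

theorem State.measurable_dirSum : Measurable (State.dirSum : State d → ℝ) :=
  State.measurable_components.snd.snd.snd

theorem State.measurable_of_components {α : Type*} [MeasurableSpace α] {φ : α → State d}
    (hx : Measurable fun a => (φ a).x) (hd : Measurable fun a => (φ a).dir)
    (hg : Measurable fun a => (φ a).gradSum) (hs : Measurable fun a => (φ a).dirSum) :
    Measurable φ := by
  have h := hx.prodMk (hd.prodMk (hg.prodMk hs))
  rintro s ⟨t, ht, rfl⟩
  exact h ht

theorem State.measurable_a (P : Params) : Measurable (State.a P : State d → ℝ) :=
  (measurable_const.add (State.measurable_gradSum.div_const _)).pow_const _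

theorem State.measurable_b (P : Params) : Measurable (State.b P : State d → ℝ) :=
  ((measurable_const.add State.measurable_dirSum).pow_const _).div
    ((State.measurable_a P).pow_const _)

variable {Ξ : Type*} {g : Space d → Ξ → Space d}

theorem run_congr (P : Params) (x₁ : Space d) {z z' : ℕ → Ξ} {n : ℕ}
    (h : ∀ i ≤ n, z i = z' i) : run P g x₁ z n = run P g x₁ z' n := by
  induction n with
  | zero => simp only [run, h 0 le_rfl]
  | succ n ih => simp only [run, h (n + 1) le_rfl, ih fun i hi => h i (hi.trans n.le_succ)]

variable [MeasurableSpace Ξ]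

theorem State.measurable_init (hg : Measurable fun w : Space d × Ξ => g w.1 w.2) (x₁ : Space d) :
    Measurable (State.init g x₁) := by
  have h : Measurable (g x₁) := hg.comp (measurable_const.prodMk measurable_id)
  exact State.measurable_of_components measurable_const h (h.norm.pow_const 2)
    (h.norm.pow_const 2)

/-- The next iterate, which does not need a new sample. -/
noncomputable def State.nextX (P : Params) (s : State d) : Space d := s.x - (P.η / s.b P) • s.dir

theorem State.measurable_nextX (P : Params) : Measurable (State.nextX P : State d → Space d) :=
  State.measurable_x.sub ((measurable_const.div (State.measurable_b P)).smul State.measurable_dir)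

theorem State.measurable_next (P : Params) (hg : Measurable fun w : Space d × Ξ => g w.1 w.2) :
    Measurable (fun w : State d × Ξ => w.1.next P g w.2) := by
  have hx : Measurable fun w : State d × Ξ => w.1.nextX P :=
    (State.measurable_nextX P).comp measurable_fst
  have h1 : Measurable fun w : State d × Ξ => g (w.1.nextX P) w.2 :=
    hg.comp (hx.prodMk measurable_snd)
  have h0 : Measurable fun w : State d × Ξ => g w.1.x w.2 :=
    hg.comp ((State.measurable_x.comp measurable_fst).prodMk measurable_snd)
  have ha : Measurable fun w : State d × Ξ => 1 - w.1.a P :=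
    measurable_const.sub ((State.measurable_a P).comp measurable_fst)
  have hd : Measurable fun w : State d × Ξ =>
      g (w.1.nextX P) w.2 + (1 - w.1.a P) • (w.1.dir - g w.1.x w.2) :=
    h1.add (ha.smul ((State.measurable_dir.comp measurable_fst).sub h0))
  exact State.measurable_of_components hx hd
    ((State.measurable_gradSum.comp measurable_fst).add (h1.norm.pow_const 2))
    ((State.measurable_dirSum.comp measurable_fst).add (hd.norm.pow_const 2))

theorem measurable_run (P : Params) (hg : Measurable fun w : Space d × Ξ => g w.1 w.2)
    (x₁ : Space d) (n : ℕ) : Measurable (fun z : ℕ → Ξ => run P g x₁ z n) := by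
  induction n with
  | zero => exact (State.measurable_init hg x₁).comp (measurable_pi_apply 0)
  | succ n ih => exact (State.measurable_next P hg).comp (ih.prodMk (measurable_pi_apply (n + 1)))

variable {Ω : Type*} [MeasurableSpace Ω] {μ : Measure Ω} {D : Measure Ξ}
  {ξ : ℕ → Ω → Ξ}

theorem IsSampling.measurable_run (h : IsSampling D μ ξ) (P : Params)
    (hg : Measurable fun w : Space d × Ξ => g w.1 w.2) (x₁ : Space d) (n : ℕ) :
    Measurable (fun ω => run P g x₁ (fun k => ξ k ω) n) :=
  (MetaStormSG.measurable_run P hg x₁ n).comp (measurable_pi_lambda _ h.measurable)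

/-- The state at index `n` is a measurable function of the samples with indices up to `n` only, and
these are jointly independent of the next sample. -/
theorem IsSampling.indepFun_run (h : IsSampling D μ ξ) (P : Params)
    (hg : Measurable fun w : Space d × Ξ => g w.1 w.2) (x₁ : Space d) (n : ℕ) :
    IndepFun (fun ω => run P g x₁ (fun k => ξ k ω) n) (ξ (n + 1)) μ := by
  have hi := h.indep.indepFun_finset (Finset.range (n + 1)) {n + 1} (by simp) h.measurable
  -- Extends a finite tuple to a sequence, so that `run` applies. The filler beyond index `n` is
  -- irrelevant by `run_congr`; repeating entry 0 avoids assuming that `Ξ` is inhabited.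
  let ext : (Finset.range (n + 1) → Ξ) → ℕ → Ξ := fun v k =>
    if hk : k < n + 1 then v ⟨k, Finset.mem_range.2 hk⟩
    else v ⟨0, Finset.mem_range.2 n.succ_pos⟩
  have hext : Measurable ext := by
    refine measurable_pi_lambda _ fun k => ?_
    by_cases hk : k < n + 1 <;> simp only [ext, hk, dite_true, dite_false] <;>
      exact measurable_pi_apply _
  have hc := hi.comp ((MetaStormSG.measurable_run P hg x₁ n).comp hext)
    (measurable_pi_apply (⟨n + 1, Finset.mem_singleton_self _⟩ : ({n + 1} : Finset ℕ)))
  have e : (fun ω => run P g x₁ (fun k => ξ k ω) n)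
      = ((fun z => run P g x₁ z n) ∘ ext) ∘ fun ω (i : Finset.range (n + 1)) => ξ i ω := by
    funext ω
    refine run_congr P x₁ fun i hi => ?_
    simp only [ext, Nat.lt_succ_of_le hi, dite_true]
  rw [e]
  exact hc

theorem IsSampling.map_run_prod [IsProbabilityMeasure μ] (h : IsSampling D μ ξ) (P : Params)
    (hg : Measurable fun w : Space d × Ξ => g w.1 w.2) (x₁ : Space d) (n : ℕ) :
    μ.map (fun ω => (run P g x₁ (fun k => ξ k ω) n, ξ (n + 1) ω))
      = (μ.map fun ω => run P g x₁ (fun k => ξ k ω) n).prod D := by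
  rw [← h.law (n + 1)]
  exact (h.indepFun_run P hg x₁ n).map_prod_eq_prod_map_map
    (h.measurable_run P hg x₁ n).aemeasurable (h.measurable (n + 1)).aemeasurable

/-- An inequality of expectations that holds for every state and an independent sample holds along
the run. -/
theorem IsSampling.integral_le_of_forall_state [IsProbabilityMeasure μ] [SFinite D]
    (h : IsSampling D μ ξ)
    (P : Params) (hg : Measurable fun w : Space d × Ξ => g w.1 w.2) (x₁ : Space d) (n : ℕ)
    {φ ψ : State d × Ξ → ℝ} (hφ : Measurable φ) (hψ : Measurable ψ)
    (hφi : Integrable (fun ω => φ (run P g x₁ (fun k => ξ k ω) n, ξ (n + 1) ω)) μ)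
    (hψi : Integrable (fun ω => ψ (run P g x₁ (fun k => ξ k ω) n, ξ (n + 1) ω)) μ)
    (hle : ∀ ω, ∫ z, φ (run P g x₁ (fun k => ξ k ω) n, z) ∂D
      ≤ ∫ z, ψ (run P g x₁ (fun k => ξ k ω) n, z) ∂D) :
    ∫ ω, φ (run P g x₁ (fun k => ξ k ω) n, ξ (n + 1) ω) ∂μ
      ≤ ∫ ω, ψ (run P g x₁ (fun k => ξ k ω) n, ξ (n + 1) ω) ∂μ := by
  have hs := h.measurable_run P hg x₁ n
  have hpair := hs.prodMk (h.measurable (n + 1))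
  have hφp := (integrable_map_measure (μ := μ) hφ.aestronglyMeasurable hpair.aemeasurable).2 hφi
  have hψp := (integrable_map_measure (μ := μ) hψ.aestronglyMeasurable hpair.aemeasurable).2 hψi
  -- Fubini for the product law of state and new sample takes the place of conditional expectations.
  have key : ∀ {χ : State d × Ξ → ℝ}, Measurable χ → Integrable χ
      (μ.map fun ω => (run P g x₁ (fun k => ξ k ω) n, ξ (n + 1) ω)) →
      Integrable (fun ω => ∫ z, χ (run P g x₁ (fun k => ξ k ω) n, z) ∂D) μ ∧
      ∫ ω, χ (run P g x₁ (fun k => ξ k ω) n, ξ (n + 1) ω) ∂μ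
        = ∫ ω, ∫ z, χ (run P g x₁ (fun k => ξ k ω) n, z) ∂D ∂μ := by
    intro χ hχ hχi
    have e := (integral_map hpair.aemeasurable hχ.aestronglyMeasurable (μ := μ)).symm
    rw [h.map_run_prod P hg x₁ n] at hχi e
    have hm : AEStronglyMeasurable (fun s => ∫ z, χ (s, z) ∂D)
        (μ.map fun ω => run P g x₁ (fun k => ξ k ω) n) :=
      hχ.stronglyMeasurable.integral_prod_right'.aestronglyMeasurable
    refine ⟨hχi.integral_prod_left.comp_measurable hs, ?_⟩
    rw [e, integral_prod _ hχi, integral_map hs.aemeasurable hm]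
  rw [(key hφ hφp).2, (key hψ hψp).2]
  exact integral_mono (key hφ hφp).1 (key hψ hψp).1 hle

end

/-! ### Scalar inequalities -/

/-- Replaces the weight `v'`, which depends on the new sample, by the previous weight `v`. Since the
cube grows by at most δ, the increment v' - v is at most δ/v'², hence at most 1/(2v') once v' ≥ 2δ;
the potential can pay for that. While v' < 2δ everything is bounded, and the loss is charged to the
telescoping quantity 1/v³. -/
theorem mul_le_add_of_cube_sub_le {v v' w δ G : ℝ} (hv : 1 ≤ v) (hvv : v ≤ v')
    (hδ : v' ^ 3 - v ^ 3 ≤ δ) (hw : 0 ≤ w) (hwv : w ≤ 9 * G ^ 2 * v ^ 4) :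
    v' * w ≤ v * w + w / (2 * v')
      + 9 * G ^ 2 * (2 * δ) ^ 10 * (1 / v ^ 3 - 1 / v' ^ 3) := by
  have hv' : 1 ≤ v' := hv.trans hvv
  have h0 : 0 < v := by linarith
  have h0' : 0 < v' := by linarith
  have hmono : 0 ≤ 1 / v ^ 3 - 1 / v' ^ 3 :=
    sub_nonneg.2 (one_div_le_one_div_of_le (by positivity) (by gcongr))
  have hfac : v' ^ 3 - v ^ 3 = (v' - v) * (v' ^ 2 + v' * v + v ^ 2) := by ring
  have hd : 0 ≤ v' - v := sub_nonneg.2 hvv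
  rcases le_or_gt (2 * δ) v' with hc | hc
  · have h1 : (v' - v) * v' ^ 2 ≤ δ := by
      refine le_trans ?_ hδ
      rw [hfac]
      exact mul_le_mul_of_nonneg_left (by nlinarith [mul_pos h0' h0, sq_nonneg v]) hd
    have h2 : (v' - v) * (2 * v') ≤ 1 := by
      by_contra hcon
      push Not at hcon
      nlinarith [mul_lt_mul_of_pos_right hcon h0']
    have h3 : (v' - v) * w ≤ w / (2 * v') := by
      rw [le_div_iff₀ (by positivity)]
      nlinarith [mul_le_mul_of_nonneg_right h2 hw]
    have : 0 ≤ 9 * G ^ 2 * (2 * δ) ^ 10 * (1 / v ^ 3 - 1 / v' ^ 3) := by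
      have : 0 ≤ (2 * δ) ^ 10 := by positivity
      positivity
    linarith
  · have h1 : v' - v ≤ v' ^ 3 - v ^ 3 := by
      rw [hfac]
      exact le_mul_of_one_le_right hd (by nlinarith [mul_pos h0' h0, sq_nonneg v])
    have h2 : v' ^ 3 - v ^ 3 = (v ^ 3 * v' ^ 3) * (1 / v ^ 3 - 1 / v' ^ 3) := by
      field_simp
    -- The exponent 10 is 3 + 3 from the difference of inverse cubes and 4 from the a priori bound
    -- on `w`.
    have h3 : (v ^ 3 * v' ^ 3) * v ^ 4 ≤ (2 * δ) ^ 10 := by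
      have e : (2 * δ) ^ 10 = ((2 * δ) ^ 3 * (2 * δ) ^ 3) * (2 * δ) ^ 4 := by ring
      rw [e]
      have h6 := hvv.trans hc.le
      have h7 := hc.le
      have h8 : 0 ≤ 2 * δ := h0.le.trans h6
      gcongr
    have h4 : (v' - v) * w ≤ (v' ^ 3 - v ^ 3) * (9 * G ^ 2 * v ^ 4) :=
      mul_le_mul h1 hwv hw (hd.trans h1)
    have h5 : (v' ^ 3 - v ^ 3) * (9 * G ^ 2 * v ^ 4)
        ≤ 9 * G ^ 2 * (2 * δ) ^ 10 * (1 / v ^ 3 - 1 / v' ^ 3) := by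
      rw [h2]
      calc _ = (9 * G ^ 2 * (1 / v ^ 3 - 1 / v' ^ 3)) * ((v ^ 3 * v' ^ 3) * v ^ 4) := by ring
        _ ≤ (9 * G ^ 2 * (1 / v ^ 3 - 1 / v' ^ 3)) * (2 * δ) ^ 10 := by gcongr
        _ = _ := by ring
    have : 0 ≤ w / (2 * v') := by positivity
    linarith

theorem sub_div_le_log_sub_log {x y : ℝ} (hx : 0 < x) (hxy : x ≤ y) :
    (y - x) / y ≤ Real.log y - Real.log x := by
  have hy : 0 < y := hx.trans_le hxy
  have h := Real.log_le_sub_one_of_pos (div_pos hx hy)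
  rw [Real.log_div hx.ne' hy.ne'] at h
  have e : (y - x) / y = 1 - x / y := by field_simp
  linarith

/-- An increment divided by the new value is at most a difference of logarithms; dividing by the old
value instead costs only a telescoping correction, because the increments are bounded. -/
theorem mul_sub_div_le_log_add {x y k B : ℝ} (hx : 0 < x) (hxy : x ≤ y) (hk : 0 ≤ k)
    (hB : k * (y - x) ≤ B) :
    k * (y - x) / x ≤ k * (Real.log y - Real.log x) + B * (1 / x - 1 / y) := by
  have hy : 0 < y := hx.trans_le hxy
  have h1 := mul_le_mul_of_nonneg_left (sub_div_le_log_sub_log hx hxy) hk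
  have hm : 0 ≤ 1 / x - 1 / y := sub_nonneg.2 (one_div_le_one_div_of_le hx hxy)
  have h2 := mul_le_mul_of_nonneg_right hB hm
  have e : k * (y - x) / x = k * ((y - x) / y) + k * (y - x) * (1 / x - 1 / y) := by
    field_simp; ring
  linarith

theorem div_le_mul_div_mul {x A v w : ℝ} (hx : 0 ≤ x) (hA : 0 < A) (hv : 0 < v) (hvw : v ≤ w) :
    x / A ≤ w * (x / (A * v)) := by
  calc x / A = v * (x / (A * v)) := by field_simp
    _ ≤ _ := by gcongr

theorem rpow_one_sub_sub_le {p u u' : ℝ} (hp : 0 ≤ p) (hu : 0 < u) (huu : u ≤ u') :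
    u' ^ (1 - p) - u ^ (1 - p) ≤ (u' - u) / u' ^ p := by
  have hu' : 0 < u' := hu.trans_le huu
  have hpp : 0 < u' ^ p := Real.rpow_pos_of_pos hu' p
  have hpq : 0 < u ^ p := Real.rpow_pos_of_pos hu p
  rw [Real.rpow_sub hu', Real.rpow_sub hu, Real.rpow_one, Real.rpow_one, sub_div]
  have : u / u' ^ p ≤ u / u ^ p :=
    div_le_div_of_nonneg_left hu.le hpq (Real.rpow_le_rpow hu.le huu hp)
  linarith

/-- The increment of a truncated logarithm dominates the terms with a small denominator. -/
theorem mul_div_sq_le_add_log {p κ u u' v θ : ℝ} (hp : 0 < p) (hp2 : p ≤ 1 / 2) (hκ : 0 < κ)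
    (hu : 0 < u) (huu : u ≤ u') (hv : 1 ≤ v) (hθ : κ ^ (1 / p) * v ≤ θ) :
    κ * (v * (u' - u) / (u' ^ p * v ^ (1 - p)) ^ 2)
      ≤ (u' - u) / (u' ^ p * v ^ (1 - p))
        + κ ^ (1 / p - 1) * (Real.log (min u' θ) - Real.log (min u θ)) := by
  have hu' : 0 < u' := hu.trans_le huu
  have hv0 : 0 < v := by linarith
  have hup : 0 < u' ^ p := Real.rpow_pos_of_pos hu' p
  have hvp : 0 < v ^ (1 - p) := Real.rpow_pos_of_pos hv0 _
  have hκp : 0 < κ ^ (1 / p) := Real.rpow_pos_of_pos hκ _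
  have hθ0 : 0 < θ := (mul_pos hκp hv0).trans_le hθ
  have hd : 0 ≤ u' - u := sub_nonneg.2 huu
  set b := u' ^ p * v ^ (1 - p) with hb
  have hb0 : 0 < b := mul_pos hup hvp
  have hlog : 0 ≤ Real.log (min u' θ) - Real.log (min u θ) :=
    sub_nonneg.2 (Real.log_le_log (lt_min hu hθ0) (min_le_min_right θ huu))
  -- Either the denominator `b` is large enough to beat κv outright, or u' lies below κ^(1/p) v ≤ θ,
  -- where the truncation is inactive and the logarithm of `u` pays.
  rcases le_or_gt (κ * v) b with hc | hc
  · have : κ * (v * (u' - u) / b ^ 2) ≤ (u' - u) / b := by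
      have e : κ * (v * (u' - u) / b ^ 2) = (κ * v) * ((u' - u) / b ^ 2) := by ring
      rw [e]
      calc (κ * v) * ((u' - u) / b ^ 2) ≤ b * ((u' - u) / b ^ 2) := by gcongr
        _ = (u' - u) / b := by field_simp
    have : 0 ≤ κ ^ (1 / p - 1) * (Real.log (min u' θ) - Real.log (min u θ)) := by positivity
    linarith
  · have hvs : v = v ^ p * v ^ (1 - p) := by
      rw [← Real.rpow_add hv0]; simp
    have h1 : u' ^ p < κ * v ^ p := by
      have : u' ^ p * v ^ (1 - p) < (κ * v ^ p) * v ^ (1 - p) := by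
        rw [mul_assoc, ← hvs]; exact hc
      exact lt_of_mul_lt_mul_right this hvp.le
    have h2 : u' ≤ κ ^ (1 / p) * v := by
      have := Real.rpow_le_rpow hup.le h1.le (show 0 ≤ 1 / p by positivity)
      rw [← Real.rpow_mul hu'.le, Real.mul_rpow hκ.le (by positivity), ← Real.rpow_mul hv0.le] at this
      have e : p * (1 / p) = 1 := by field_simp
      rwa [e, Real.rpow_one, Real.rpow_one] at this
    have h3 : min u' θ = u' := min_eq_left (h2.trans hθ)
    have h4 : min u θ = u := min_eq_left (huu.trans (h2.trans hθ))
    rw [h3, h4]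
    have h5 := sub_div_le_log_sub_log hu huu
    have hκs : 0 < κ ^ (1 / p - 1) := Real.rpow_pos_of_pos hκ _
    have h6 : κ * v * u' ≤ κ ^ (1 / p - 1) * b ^ 2 := by
      -- The place where p ≤ 1/2 is needed: 1 - 2p must be a nonnegative exponent.
      have h7 : u' ^ (1 - 2 * p) ≤ κ ^ (1 / p - 2) * v ^ (1 - 2 * p) := by
        have := Real.rpow_le_rpow hu'.le h2 (show 0 ≤ 1 - 2 * p by linarith)
        rw [Real.mul_rpow hκp.le hv0.le, ← Real.rpow_mul hκ.le] at this
        have e : 1 / p * (1 - 2 * p) = 1 / p - 2 := by field_simp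
        rwa [e] at this
      have e1 : u' = u' ^ (1 - 2 * p) * (u' ^ p) ^ 2 := by
        rw [← Real.rpow_natCast (u' ^ p), ← Real.rpow_mul hu'.le, ← Real.rpow_add hu']
        norm_num
        ring_nf
        simp
      have e2 : κ * κ ^ (1 / p - 2) = κ ^ (1 / p - 1) := by
        nth_rewrite 1 [← Real.rpow_one κ]
        rw [← Real.rpow_add hκ]; ring_nf
      have e3 : v * v ^ (1 - 2 * p) = (v ^ (1 - p)) ^ 2 := by
        rw [← Real.rpow_natCast (v ^ (1 - p)), ← Real.rpow_mul hv0.le]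
        nth_rewrite 1 [← Real.rpow_one v]
        rw [← Real.rpow_add hv0]
        norm_num
        ring_nf
      calc κ * v * u' = κ * v * (u' ^ (1 - 2 * p) * (u' ^ p) ^ 2) := by rw [← e1]
        _ ≤ κ * v * ((κ ^ (1 / p - 2) * v ^ (1 - 2 * p)) * (u' ^ p) ^ 2) := by gcongr
        _ = (κ * κ ^ (1 / p - 2)) * (v * v ^ (1 - 2 * p)) * (u' ^ p) ^ 2 := by ring
        _ = κ ^ (1 / p - 1) * b ^ 2 := by rw [e2, e3, hb]; ring
    have h8 : κ * (v * (u' - u) / b ^ 2) ≤ κ ^ (1 / p - 1) * ((u' - u) / u') := by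
      rw [mul_div_assoc', mul_div_assoc', div_le_div_iff₀ (by positivity) hu']
      nlinarith [mul_le_mul_of_nonneg_right h6 hd]
    have h9 : 0 ≤ (u' - u) / b := by positivity
    nlinarith [mul_le_mul_of_nonneg_left h5 hκs.le]

/-! ### Inequalities along a run -/

section

variable {d : ℕ} {Ξ : Type*} {P : Params}

/-- `(1 + ∑_{i ≤ t} ‖∇f(x_i, ξ_i)‖² / a₀²)^(1/3)`, so that `a_{t+1} = V⁻²`. -/
noncomputable def State.V (P : Params) (s : State d) : ℝ :=
  (1 + s.gradSum / P.a₀ ^ 2) ^ (1 / 3 : ℝ)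

/-- `b₀^(1/p) + ∑_{i ≤ t} ‖d_i‖²`. -/
noncomputable def State.u (P : Params) (s : State d) : ℝ := P.b₀ ^ (1 / P.p) + s.dirSum

theorem State.one_le_V {s : State d} (hs : 0 ≤ s.gradSum) : 1 ≤ s.V P :=
  Real.one_le_rpow (by have := div_nonneg hs (sq_nonneg P.a₀); linarith) (by norm_num)

theorem State.V_pow_three {s : State d} (hs : 0 ≤ s.gradSum) :
    s.V P ^ 3 = 1 + s.gradSum / P.a₀ ^ 2 := by
  have : 0 ≤ 1 + s.gradSum / P.a₀ ^ 2 := by positivity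
  rw [State.V, ← Real.rpow_natCast, ← Real.rpow_mul this]
  norm_num

theorem State.a_eq {s : State d} (hs : 0 ≤ s.gradSum) : s.a P = (s.V P ^ 2)⁻¹ := by
  have : 0 ≤ 1 + s.gradSum / P.a₀ ^ 2 := by positivity
  rw [State.a, State.V, ← Real.rpow_natCast (_ ^ (1 / 3 : ℝ)), ← Real.rpow_mul this,
    ← Real.rpow_neg this]
  norm_num

theorem State.b_eq {s : State d} (hs : 0 ≤ s.gradSum) :
    s.b P = s.u P ^ P.p * s.V P ^ (1 - P.p) := by
  have hV : 0 < s.V P := zero_lt_one.trans_le (State.one_le_V hs)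
  have e : s.a P = s.V P ^ (-2 : ℝ) := by
    rw [State.a_eq hs, Real.rpow_neg hV.le]; norm_num
  rw [State.b, e, ← Real.rpow_mul hV.le, State.u, Params.q, div_eq_mul_inv,
    ← Real.rpow_neg hV.le]
  ring_nf

theorem State.b₀_rpow_le_u {s : State d} (hs : 0 ≤ s.dirSum) : P.b₀ ^ (1 / P.p) ≤ s.u P := by
  rw [State.u]; linarith

theorem Params.Valid.p_pos (hP : P.Valid) : 0 < P.p := by linarith [hP.le_p]

theorem State.b₀_le_b (hP : P.Valid) {s : State d} (hg : 0 ≤ s.gradSum) (hs : 0 ≤ s.dirSum) :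
    P.b₀ ≤ s.b P := by
  have hp := hP.p_pos
  have h1 : P.b₀ ≤ s.u P ^ P.p := by
    have := Real.rpow_le_rpow (Real.rpow_nonneg hP.b₀_pos.le _)
      (State.b₀_rpow_le_u (P := P) hs) hp.le
    rw [← Real.rpow_mul hP.b₀_pos.le] at this
    have e : 1 / P.p * P.p = 1 := by field_simp
    rwa [e, Real.rpow_one] at this
  rw [State.b_eq hg]
  have h2 : 1 ≤ s.V P ^ (1 - P.p) :=
    Real.one_le_rpow (State.one_le_V hg) (by linarith [hP.p_le])
  nlinarith [hP.b₀_pos]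

variable {g : Space d → Ξ → Space d} {x₁ : Space d} {z : ℕ → Ξ}

theorem run_gradSum_nonneg (n : ℕ) : 0 ≤ (run P g x₁ z n).gradSum := by
  induction n with
  | zero => simp only [run, State.init]; positivity
  | succ n ih => simp only [run, State.next]; positivity

theorem run_dirSum_eq (n : ℕ) :
    (run P g x₁ z n).dirSum = ∑ i ∈ Finset.range (n + 1), ‖(run P g x₁ z i).dir‖ ^ 2 := by
  induction n with
  | zero => simp [run, State.init]
  | succ n ih => rw [Finset.sum_range_succ, ← ih]; rfl

theorem run_dirSum_nonneg (n : ℕ) : 0 ≤ (run P g x₁ z n).dirSum := by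
  rw [run_dirSum_eq]; positivity

theorem run_gradSum_eq (n : ℕ) :
    (run P g x₁ z n).gradSum
      = ∑ i ∈ Finset.range (n + 1), ‖g (run P g x₁ z i).x (z i)‖ ^ 2 := by
  induction n with
  | zero => simp [run, State.init]
  | succ n ih => rw [Finset.sum_range_succ, ← ih]; rfl

theorem run_V_mono : Monotone fun n => (run P g x₁ z n).V P := by
  refine monotone_nat_of_le_succ fun n => ?_
  have := run_gradSum_nonneg (P := P) (g := g) (x₁ := x₁) (z := z) n
  refine Real.rpow_le_rpow (by positivity) ?_ (by norm_num)
  have : (run P g x₁ z n).gradSum ≤ (run P g x₁ z (n + 1)).gradSum :=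
    le_add_of_nonneg_right (sq_nonneg _)
  gcongr

theorem run_V_pow_three_sub (n : ℕ) :
    (run P g x₁ z (n + 1)).V P ^ 3 - (run P g x₁ z n).V P ^ 3
      = ‖g (run P g x₁ z (n + 1)).x (z (n + 1))‖ ^ 2 / P.a₀ ^ 2 := by
  rw [State.V_pow_three (run_gradSum_nonneg _), State.V_pow_three (run_gradSum_nonneg _)]
  have : (run P g x₁ z (n + 1)).gradSum
      = (run P g x₁ z n).gradSum + ‖g (run P g x₁ z (n + 1)).x (z (n + 1))‖ ^ 2 := rfl
  rw [this]; ring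

theorem one_le_run_V (n : ℕ) : 1 ≤ (run P g x₁ z n).V P := State.one_le_V (run_gradSum_nonneg n)

/-- The recursion gives ‖d_{t+1}‖ ≤ G + (1-a)(‖d_t‖ + G), and the level 2G/a = 2GV² is preserved by
it. The second half bounds the new direction by the previous `V`, which the comparison of
consecutive weights requires. -/
theorem norm_run_dir_succ_le {G : ℝ} (hz : ∀ n x, ‖g x (z n)‖ ≤ G) (n : ℕ) :
    ‖(run P g x₁ z n).dir‖ ≤ 2 * G * (run P g x₁ z n).V P ^ 2 ∧
      ‖(run P g x₁ z (n + 1)).dir‖ ≤ 2 * G * (run P g x₁ z n).V P ^ 2 := by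
  have hG : 0 ≤ G := (norm_nonneg _).trans (hz 0 x₁)
  have step : ∀ n, ‖(run P g x₁ z n).dir‖ ≤ 2 * G * (run P g x₁ z n).V P ^ 2 →
      ‖(run P g x₁ z (n + 1)).dir‖ ≤ 2 * G * (run P g x₁ z n).V P ^ 2 := by
    intro n ih
    set s := run P g x₁ z n with hs
    have hV : 1 ≤ s.V P := one_le_run_V n
    have ha : s.a P = (s.V P ^ 2)⁻¹ := State.a_eq (run_gradSum_nonneg n)
    have hV2 : 1 ≤ s.V P ^ 2 := one_le_pow₀ hV
    have ha1 : s.a P ≤ 1 := by rw [ha]; exact inv_le_one_of_one_le₀ hV2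
    have hav : s.a P * s.V P ^ 2 = 1 := by rw [ha]; field_simp
    have ha0 : 0 ≤ s.a P := by rw [ha]; positivity
    have hdir : (run P g x₁ z (n + 1)).dir
        = g (run P g x₁ z (n + 1)).x (z (n + 1)) + (1 - s.a P) • (s.dir - g s.x (z (n + 1))) := rfl
    rw [hdir]
    calc _ ≤ ‖g (run P g x₁ z (n + 1)).x (z (n + 1))‖
          + ‖(1 - s.a P) • (s.dir - g s.x (z (n + 1)))‖ := norm_add_le _ _
      _ ≤ G + (1 - s.a P) * (2 * G * s.V P ^ 2 + G) := by
          rw [norm_smul, Real.norm_of_nonneg (by linarith)]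
          exact add_le_add (hz _ _) (mul_le_mul_of_nonneg_left
            ((norm_sub_le _ _).trans (add_le_add ih (hz _ _))) (by linarith))
      _ ≤ 2 * G * s.V P ^ 2 := by nlinarith
  have main : ∀ n, ‖(run P g x₁ z n).dir‖ ≤ 2 * G * (run P g x₁ z n).V P ^ 2 := by
    intro n
    induction n with
    | zero =>
      have hV2 : 1 ≤ (run P g x₁ z 0).V P ^ 2 := one_le_pow₀ (one_le_run_V 0)
      have : ‖(run P g x₁ z 0).dir‖ ≤ G := hz 0 x₁
      nlinarith
    | succ n ih =>
      refine (step n ih).trans ?_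
      have := run_V_mono (P := P) (g := g) (x₁ := x₁) (z := z) n.le_succ
      have h0 := one_le_run_V (P := P) (g := g) (x₁ := x₁) (z := z) n
      simp only at this
      gcongr
  exact ⟨main n, step n (main n)⟩

theorem run_V_le {G : ℝ} (hz : ∀ n x, ‖g x (z n)‖ ≤ G) (n : ℕ) :
    (run P g x₁ z n).V P ≤ 1 + (n + 1) * G ^ 2 / P.a₀ ^ 2 := by
  have hs := run_gradSum_nonneg (P := P) (g := g) (x₁ := x₁) (z := z) n
  have hV := one_le_run_V (P := P) (g := g) (x₁ := x₁) (z := z) n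
  have h1 : (run P g x₁ z n).V P ≤ (run P g x₁ z n).V P ^ 3 := le_self_pow₀ hV (by norm_num)
  refine h1.trans ?_
  rw [State.V_pow_three hs, run_gradSum_eq]
  have : ∑ i ∈ Finset.range (n + 1), ‖g (run P g x₁ z i).x (z i)‖ ^ 2 ≤ (n + 1) * G ^ 2 := by
    have := Finset.sum_le_card_nsmul (Finset.range (n + 1))
      (fun i => ‖g (run P g x₁ z i).x (z i)‖ ^ 2) (G ^ 2)
      (fun i _ => pow_le_pow_left₀ (norm_nonneg _) (hz _ _) 2)
    simpa using this
  gcongr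

/-- `‖d_t‖² / b_t`. -/
noncomputable def State.step (P : Params) (s : State d) : ℝ := ‖s.dir‖ ^ 2 / s.b P

/-- `V ‖d_t‖² / b_t²`. -/
noncomputable def State.stepSq (P : Params) (s : State d) : ℝ :=
  s.V P * ‖s.dir‖ ^ 2 / s.b P ^ 2

theorem run_u_eq (n : ℕ) :
    (run P g x₁ z n).u P
      = P.b₀ ^ (1 / P.p) + ∑ i ∈ Finset.range (n + 1), ‖(run P g x₁ z i).dir‖ ^ 2 := by
  rw [State.u, run_dirSum_eq]

/-- The second-order terms are dominated by the first-order terms, up to a logarithm. -/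
theorem mul_sum_stepSq_le (hP : P.Valid) {κ : ℝ} (hκ : 0 < κ) (N : ℕ) :
    κ * ∑ n ∈ Finset.range (N + 1), (run P g x₁ z n).stepSq P
      ≤ ∑ n ∈ Finset.range (N + 1), (run P g x₁ z n).step P
        + κ ^ (1 / P.p - 1) * (Real.log ((run P g x₁ z N).V P) + |Real.log (κ / P.b₀)| / P.p) := by
  have hp := hP.p_pos
  -- `V` is monotone, so this one truncation level serves all steps, and the telescoped logarithms
  -- end at log θ. Without truncation they would end at the logarithm of ∑‖d_t‖².
  set θ := κ ^ (1 / P.p) * (run P g x₁ z N).V P with hθ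
  set U : ℕ → ℝ := fun n =>
    P.b₀ ^ (1 / P.p) + ∑ i ∈ Finset.range n, ‖(run P g x₁ z i).dir‖ ^ 2 with hU
  have hU0 : 0 < P.b₀ ^ (1 / P.p) := Real.rpow_pos_of_pos hP.b₀_pos _
  have hUpos : ∀ n, 0 < U n := fun n => by simp only [hU]; positivity
  have hVN := one_le_run_V (P := P) (g := g) (x₁ := x₁) (z := z) N
  have hκp : 0 < κ ^ (1 / P.p) := Real.rpow_pos_of_pos hκ _
  have hθ0 : 0 < θ := by positivity
  have hstep : ∀ n ∈ Finset.range (N + 1), κ * (run P g x₁ z n).stepSq P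
      ≤ (run P g x₁ z n).step P + κ ^ (1 / P.p - 1)
        * (Real.log (min (U (n + 1)) θ) - Real.log (min (U n) θ)) := by
    intro n hn
    have hnN : n ≤ N := Nat.lt_succ_iff.1 (Finset.mem_range.1 hn)
    have hd : U (n + 1) - U n = ‖(run P g x₁ z n).dir‖ ^ 2 := by
      simp only [hU, Finset.sum_range_succ]; ring
    have hb : (run P g x₁ z n).b P = U (n + 1) ^ P.p * (run P g x₁ z n).V P ^ (1 - P.p) := by
      rw [State.b_eq (run_gradSum_nonneg n), run_u_eq]
    have := mul_div_sq_le_add_log (p := P.p) (u := U n) (u' := U (n + 1))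
      (v := (run P g x₁ z n).V P) (θ := θ) hp hP.p_le hκ (hUpos n)
      (by have := sq_nonneg ‖(run P g x₁ z n).dir‖; linarith) (one_le_run_V n)
      (by rw [hθ]; have := run_V_mono (P := P) (g := g) (x₁ := x₁) (z := z) hnN
          simp only at this; gcongr)
    rw [← hb, hd] at this
    exact this
  have hsum := Finset.sum_le_sum hstep
  rw [← Finset.mul_sum, Finset.sum_add_distrib, ← Finset.mul_sum,
    Finset.sum_range_sub fun n => Real.log (min (U n) θ)] at hsum
  refine hsum.trans ?_
  have hκs : 0 < κ ^ (1 / P.p - 1) := Real.rpow_pos_of_pos hκ _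
  have hU00 : U 0 = P.b₀ ^ (1 / P.p) := by simp [hU]
  have hlV : 0 ≤ Real.log ((run P g x₁ z N).V P) := Real.log_nonneg hVN
  have hle : Real.log (min (U (N + 1)) θ) - Real.log (min (U 0) θ)
      ≤ Real.log ((run P g x₁ z N).V P) + |Real.log (κ / P.b₀)| / P.p := by
    have h1 : Real.log (min (U (N + 1)) θ) ≤ Real.log θ :=
      Real.log_le_log (lt_min (hUpos _) hθ0) (min_le_right _ _)
    have h2 : Real.log θ = Real.log κ / P.p + Real.log ((run P g x₁ z N).V P) := by
      rw [hθ, Real.log_mul hκp.ne' (by positivity), Real.log_rpow hκ]; ring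
    have habs : 0 ≤ |Real.log (κ / P.b₀)| / P.p := by positivity
    -- If the initial value already exceeds θ, the telescoped difference is at most 0; the absolute
    -- value in the claim covers this case.
    rcases le_total (U 0) θ with hc | hc
    · rw [min_eq_left hc, hU00, Real.log_rpow hP.b₀_pos]
      have h3 : Real.log κ / P.p - 1 / P.p * Real.log P.b₀ ≤ |Real.log (κ / P.b₀)| / P.p := by
        rw [Real.log_div hκ.ne' hP.b₀_pos.ne']
        have e : Real.log κ / P.p - 1 / P.p * Real.log P.b₀
            = (Real.log κ - Real.log P.b₀) / P.p := by ring
        rw [e]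
        gcongr
        exact le_abs_self _
      linarith
    · rw [min_eq_right hc]
      linarith
  gcongr

/-- An increment of u^(1-p) is at most ‖d_t‖²/u_t^p, which is V_t^(1-p)‖d_t‖²/b_t; then V_t is
replaced by its final value and the sum telescopes. -/
theorem dirSum_rpow_le (hP : P.Valid) (N : ℕ) :
    (run P g x₁ z N).dirSum ^ (1 - P.p)
      ≤ (run P g x₁ z N).V P ^ (1 - P.p)
        * (P.b₀ ^ (1 / P.p - 1) + ∑ n ∈ Finset.range (N + 1), (run P g x₁ z n).step P) := by
  have hp := hP.p_pos
  have hp1 : 0 ≤ 1 - P.p := by linarith [hP.p_le]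
  set U : ℕ → ℝ := fun n =>
    P.b₀ ^ (1 / P.p) + ∑ i ∈ Finset.range n, ‖(run P g x₁ z i).dir‖ ^ 2 with hU
  have hU0 : 0 < P.b₀ ^ (1 / P.p) := Real.rpow_pos_of_pos hP.b₀_pos _
  have hUpos : ∀ n, 0 < U n := fun n => by simp only [hU]; positivity
  have hVN := one_le_run_V (P := P) (g := g) (x₁ := x₁) (z := z) N
  have hstep : ∀ n ∈ Finset.range (N + 1), U (n + 1) ^ (1 - P.p) - U n ^ (1 - P.p)
      ≤ (run P g x₁ z N).V P ^ (1 - P.p) * (run P g x₁ z n).step P := by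
    intro n hn
    have hnN : n ≤ N := Nat.lt_succ_iff.1 (Finset.mem_range.1 hn)
    have hd : U (n + 1) - U n = ‖(run P g x₁ z n).dir‖ ^ 2 := by
      simp only [hU, Finset.sum_range_succ]; ring
    have hb : (run P g x₁ z n).b P = U (n + 1) ^ P.p * (run P g x₁ z n).V P ^ (1 - P.p) := by
      rw [State.b_eq (run_gradSum_nonneg n), run_u_eq]
    have hV := one_le_run_V (P := P) (g := g) (x₁ := x₁) (z := z) n
    have h1 := rpow_one_sub_sub_le (u := U n) (u' := U (n + 1)) hp.le (hUpos n)
      (by have := sq_nonneg ‖(run P g x₁ z n).dir‖; linarith)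
    refine h1.trans ?_
    rw [hd, State.step, hb]
    have hup : 0 < U (n + 1) ^ P.p := Real.rpow_pos_of_pos (hUpos _) _
    have hvp : 0 < (run P g x₁ z n).V P ^ (1 - P.p) := Real.rpow_pos_of_pos (by linarith) _
    have hmono := run_V_mono (P := P) (g := g) (x₁ := x₁) (z := z) hnN
    have h2 : (run P g x₁ z n).V P ^ (1 - P.p) ≤ (run P g x₁ z N).V P ^ (1 - P.p) :=
      Real.rpow_le_rpow (by linarith) hmono hp1
    exact div_le_mul_div_mul (sq_nonneg _) hup hvp h2
  have hsum := Finset.sum_le_sum hstep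
  rw [Finset.sum_range_sub fun n => U n ^ (1 - P.p), ← Finset.mul_sum] at hsum
  have hU00 : U 0 ^ (1 - P.p) = P.b₀ ^ (1 / P.p - 1) := by
    have : U 0 = P.b₀ ^ (1 / P.p) := by simp [hU]
    rw [this, ← Real.rpow_mul hP.b₀_pos.le]
    congr 1
    field_simp
  have h3 : (run P g x₁ z N).dirSum ^ (1 - P.p) ≤ U (N + 1) ^ (1 - P.p) := by
    refine Real.rpow_le_rpow (run_dirSum_nonneg N) ?_ hp1
    rw [run_dirSum_eq]
    simp only [hU]
    linarith
  have h4 : 1 ≤ (run P g x₁ z N).V P ^ (1 - P.p) := Real.one_le_rpow hVN hp1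
  have h5 : 0 < P.b₀ ^ (1 / P.p - 1) := Real.rpow_pos_of_pos hP.b₀_pos _
  rw [hU00] at hsum
  nlinarith

end

/-! ### Descent inequality and the potential for the estimator error -/

section

variable {d : ℕ} {Ξ : Type*} [MeasurableSpace Ξ] {D : Measure Ξ} [IsProbabilityMeasure D]
  {f : Space d → Ξ → ℝ} {σ G β : ℝ} {P : Params}

/-- `‖d_t - ∇F(x_t)‖²`. -/
noncomputable def State.err (D : Measure Ξ) (f : Space d → Ξ → ℝ) (s : State d) : ℝ :=
  ‖s.dir - gradient (objective D f) s.x‖ ^ 2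

/-- One step of gradient descent along an inexact direction. -/
theorem Assumptions.step_le (h : Assumptions D f σ G β) (hβ : 0 ≤ β) (hP : P.Valid) {c : ℝ}
    (hc : 0 < c) {s : State d} (hg : 0 ≤ s.gradSum) (hs : 0 ≤ s.dirSum) :
    s.step P ≤ (objective D f s.x - objective D f (s.nextX P)) / P.η
      + c / 2 * (s.err D f / s.V P) + (1 / (2 * c) + β * P.η / 2) * s.stepSq P := by
  have hb : 0 < s.b P := hP.b₀_pos.trans_le (State.b₀_le_b hP hg hs)
  have hV : 1 ≤ s.V P := State.one_le_V hg
  have hV0 : 0 < s.V P := by linarith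
  have hη := hP.η_pos
  set r := P.η / s.b P with hr
  have hr0 : 0 < r := div_pos hη hb
  have hx : s.nextX P = s.x + (-r) • s.dir := by
    rw [State.nextX, neg_smul, sub_eq_add_neg]
  have hdesc := descent_of_lipschitz_gradient h.differentiable_objective
    (h.norm_gradient_sub_le hβ) s.x ((-r) • s.dir)
  rw [← hx, inner_smul_right, norm_smul, mul_pow, Real.norm_eq_abs, sq_abs, neg_sq] at hdesc
  have hin : ‖s.dir‖ ^ 2 - ‖s.dir - gradient (objective D f) s.x‖ * ‖s.dir‖
      ≤ inner ℝ (gradient (objective D f) s.x) s.dir := by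
    have h1 := real_inner_le_norm (s.dir - gradient (objective D f) s.x) s.dir
    rw [inner_sub_left, real_inner_self_eq_norm_sq] at h1
    linarith
  set e := ‖s.dir - gradient (objective D f) s.x‖ with he
  set m := ‖s.dir‖ with hm
  have h1 : r * m ^ 2 ≤ objective D f s.x - objective D f (s.nextX P) + r * (e * m)
      + β / 2 * (r ^ 2 * m ^ 2) := by nlinarith
  have h2 : m ^ 2 / s.b P ≤ (objective D f s.x - objective D f (s.nextX P)) / P.η
      + e * (m / s.b P) + β * P.η / 2 * (m ^ 2 / s.b P ^ 2) := by
    have := div_le_div_of_nonneg_right h1 hη.le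
    have e1 : r * m ^ 2 / P.η = m ^ 2 / s.b P := by rw [hr]; field_simp
    have e2 : (objective D f s.x - objective D f (s.nextX P) + r * (e * m)
        + β / 2 * (r ^ 2 * m ^ 2)) / P.η
        = (objective D f s.x - objective D f (s.nextX P)) / P.η
          + e * (m / s.b P) + β * P.η / 2 * (m ^ 2 / s.b P ^ 2) := by
      rw [hr]; field_simp
    rwa [e1, e2] at this
  -- Young's inequality with weight `V`, so that the error enters as ε/V, the quantity that the
  -- potential controls.
  have h3 : e * (m / s.b P) ≤ c / 2 * (e ^ 2 / s.V P)
      + 1 / (2 * c) * (s.V P * m ^ 2 / s.b P ^ 2) := by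
    have : 0 ≤ (c * e - s.V P * (m / s.b P)) ^ 2 / (2 * c * s.V P) := by positivity
    have e3 : (c * e - s.V P * (m / s.b P)) ^ 2 / (2 * c * s.V P)
        = c / 2 * (e ^ 2 / s.V P) + 1 / (2 * c) * (s.V P * m ^ 2 / s.b P ^ 2)
          - e * (m / s.b P) := by
      field_simp; ring
    linarith
  have h4 : β * P.η / 2 * (m ^ 2 / s.b P ^ 2)
      ≤ β * P.η / 2 * (s.V P * m ^ 2 / s.b P ^ 2) := by
    gcongr
    exact le_mul_of_one_le_left (sq_nonneg m) hV
  rw [State.step, State.stepSq, State.err, ← hm, ← he]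
  linarith

/-- The first-order terms are controlled by the gap, the errors, and the second-order terms. -/
theorem Assumptions.sum_step_le (h : Assumptions D f σ G β) (hβ : 0 ≤ β) (hP : P.Valid) {c : ℝ}
    (hc : 0 < c) (x₁ : Space d) (z : ℕ → Ξ) (N : ℕ) :
    ∑ n ∈ Finset.range N, (run P (stochGrad f) x₁ z n).step P
      ≤ gap D f x₁ / P.η
        + c / 2 * ∑ n ∈ Finset.range N,
          (run P (stochGrad f) x₁ z n).err D f / (run P (stochGrad f) x₁ z n).V P
        + (1 / (2 * c) + β * P.η / 2)
          * ∑ n ∈ Finset.range N, (run P (stochGrad f) x₁ z n).stepSq P := by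
  have hx0 : (run P (stochGrad f) x₁ z 0).x = x₁ := rfl
  have key := Finset.sum_le_sum fun n (_ : n ∈ Finset.range N) =>
    h.step_le hβ hP hc (run_gradSum_nonneg (P := P) (g := stochGrad f) (x₁ := x₁) (z := z) n)
      (run_dirSum_nonneg n)
  rw [Finset.sum_add_distrib, Finset.sum_add_distrib, ← Finset.mul_sum, ← Finset.mul_sum,
    ← Finset.sum_div] at key
  have htel : ∑ n ∈ Finset.range N, (objective D f (run P (stochGrad f) x₁ z n).x
      - objective D f ((run P (stochGrad f) x₁ z n).nextX P))
      = objective D f x₁ - objective D f (run P (stochGrad f) x₁ z N).x := by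
    rw [← hx0]
    exact Finset.sum_range_sub' (fun n => objective D f (run P (stochGrad f) x₁ z n).x) N
  rw [htel] at key
  have hgap : (objective D f x₁ - objective D f (run P (stochGrad f) x₁ z N).x) / P.η
      ≤ gap D f x₁ / P.η := by
    have := ciInf_le h.bddBelow (run P (stochGrad f) x₁ z N).x
    have hη := hP.η_pos
    rw [gap]
    gcongr
  linarith

/-- The constant in the potential. -/
noncomputable def jumpConst (P : Params) (G : ℝ) : ℝ :=
  9 * G ^ 2 * (2 * (G ^ 2 / P.a₀ ^ 2)) ^ 10 + 2 * G ^ 2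

theorem jumpConst_nonneg (P : Params) (G : ℝ) : 0 ≤ jumpConst P G := by
  rw [jumpConst]; positivity

/-- A potential whose expectation decreases along the run. -/
noncomputable def potential (P : Params) (D : Measure Ξ) (f : Space d → Ξ → ℝ) (G β : ℝ)
    (s : ℕ → State d) (n : ℕ) : ℝ :=
  (s n).V P * (s n).err D f - 1 / 2 * ((s n).err D f / (s n).V P)
    + 1 / 2 * ∑ i ∈ Finset.range n, (s i).err D f / (s i).V P
    + jumpConst P G * (1 / (s n).V P ^ 3) - 6 * P.a₀ ^ 2 * Real.log ((s n).V P)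
    - 2 * β ^ 2 * P.η ^ 2 * ∑ i ∈ Finset.range n, (s i).stepSq P

theorem Assumptions.err_succ_le (h : Assumptions D f σ G β) {x₁ : Space d} {z : ℕ → Ξ}
    (hz : ∀ n x, ‖stochGrad f x (z n)‖ ≤ G) (n : ℕ) :
    (run P (stochGrad f) x₁ z n).err D f ≤ 9 * G ^ 2 * (run P (stochGrad f) x₁ z n).V P ^ 4 ∧
    (run P (stochGrad f) x₁ z (n + 1)).err D f
      ≤ 9 * G ^ 2 * (run P (stochGrad f) x₁ z n).V P ^ 4 := by
  have hG : 0 ≤ G := (norm_nonneg _).trans (hz 0 x₁)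
  have hd := norm_run_dir_succ_le (P := P) (x₁ := x₁) hz n
  have hV2 : 1 ≤ (run P (stochGrad f) x₁ z n).V P ^ 2 := one_le_pow₀ (one_le_run_V n)
  have e : 9 * G ^ 2 * (run P (stochGrad f) x₁ z n).V P ^ 4
      = (3 * G * (run P (stochGrad f) x₁ z n).V P ^ 2) ^ 2 := by ring
  rw [e]
  have key : ∀ s : State d, ‖s.dir‖ ≤ 2 * G * (run P (stochGrad f) x₁ z n).V P ^ 2 →
      s.err D f ≤ (3 * G * (run P (stochGrad f) x₁ z n).V P ^ 2) ^ 2 := by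
    intro s hs
    refine pow_le_pow_left₀ (norm_nonneg _) ?_ 2
    have := (norm_sub_le s.dir _).trans (add_le_add hs (h.norm_gradient_le s.x))
    nlinarith
  exact ⟨key _ hd.1, key _ hd.2⟩

/-- Each part of the potential has a task. The term -ε/(2V) pays for exchanging V_{t+1} with V_t in
V_{t+1}ε_{t+1}; 1/V³ collects the losses while `V` is small; log V pays for ‖∇f‖²/V³, with 6a₀² =
2·3a₀² because V³ is the quantity incremented. What remains is the difference of the two sides of
the conditional one-step bound. -/
theorem Assumptions.potential_succ_sub_le (h : Assumptions D f σ G β) (hP : P.Valid)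
    {x₁ : Space d} {z : ℕ → Ξ} (hz : ∀ n x, ‖stochGrad f x (z n)‖ ≤ G) (n : ℕ) :
    potential P D f G β (run P (stochGrad f) x₁ z) (n + 1)
        - potential P D f G β (run P (stochGrad f) x₁ z) n
      ≤ (run P (stochGrad f) x₁ z n).V P * (run P (stochGrad f) x₁ z (n + 1)).err D f
        - ((run P (stochGrad f) x₁ z n).V P * (run P (stochGrad f) x₁ z n).err D f
          - (run P (stochGrad f) x₁ z n).err D f / (run P (stochGrad f) x₁ z n).V P
          + 2 * β ^ 2 * P.η ^ 2 * (run P (stochGrad f) x₁ z n).stepSq P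
          + 2 * ‖stochGrad f (run P (stochGrad f) x₁ z (n + 1)).x (z (n + 1))‖ ^ 2
            / (run P (stochGrad f) x₁ z n).V P ^ 3) := by
  have ha := hP.a₀_pos
  have hsub := run_V_pow_three_sub (P := P) (g := stochGrad f) (x₁ := x₁) (z := z) n
  have hgs : ‖stochGrad f (run P (stochGrad f) x₁ z (n + 1)).x (z (n + 1))‖ ^ 2 ≤ G ^ 2 :=
    pow_le_pow_left₀ (norm_nonneg _) (hz _ _) 2
  have hV := one_le_run_V (P := P) (g := stochGrad f) (x₁ := x₁) (z := z) n
  have hVV := run_V_mono (P := P) (g := stochGrad f) (x₁ := x₁) (z := z) n.le_succ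
  simp only at hVV
  have herr := (h.err_succ_le (P := P) (x₁ := x₁) hz n).2
  have herr0 : 0 ≤ (run P (stochGrad f) x₁ z (n + 1)).err D f := sq_nonneg _
  simp only [potential, Finset.sum_range_succ, jumpConst]
  generalize (run P (stochGrad f) x₁ z (n + 1)).V P = v' at *
  generalize (run P (stochGrad f) x₁ z n).V P = v at *
  generalize (run P (stochGrad f) x₁ z (n + 1)).err D f = w' at *
  generalize (run P (stochGrad f) x₁ z n).err D f = w at *
  generalize ‖stochGrad f (run P (stochGrad f) x₁ z (n + 1)).x (z (n + 1))‖ ^ 2 = q at *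
  have hv0 : 0 < v := by linarith
  have hv0' : 0 < v' := by linarith
  have h1 := mul_le_add_of_cube_sub_le (δ := G ^ 2 / P.a₀ ^ 2) (G := G) hV hVV
    (by rw [hsub]; gcongr) herr0 herr
  have h2 := mul_sub_div_le_log_add (x := v ^ 3) (y := v' ^ 3) (k := P.a₀ ^ 2) (B := G ^ 2)
    (by positivity) (by gcongr) (by positivity) (by rw [hsub]; field_simp; exact hgs)
  rw [Real.log_pow, Real.log_pow, hsub] at h2
  have e1 : P.a₀ ^ 2 * (q / P.a₀ ^ 2) / v ^ 3 = q / v ^ 3 := by field_simp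
  rw [e1] at h2
  have e2 : w' / (2 * v') = 1 / 2 * (w' / v') := by field_simp
  rw [e2] at h1
  have e3 : 2 * q / v ^ 3 = 2 * (q / v ^ 3) := by ring
  rw [e3]
  push_cast at h2
  linarith

/-- The expected error after one step from a given state. -/
theorem Assumptions.integral_V_mul_err_next_le (h : Assumptions D f σ G β)
    {s : State d} (hg : 0 ≤ s.gradSum) :
    ∫ z, s.V P * (s.next P (stochGrad f) z).err D f ∂D
      ≤ ∫ z, (s.V P * s.err D f - s.err D f / s.V P
        + 2 * β ^ 2 * P.η ^ 2 * s.stepSq P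
        + 2 * ‖stochGrad f (s.nextX P) z‖ ^ 2 / s.V P ^ 3) ∂D := by
  have hV : 1 ≤ s.V P := State.one_le_V hg
  have hV0 : 0 < s.V P := by linarith
  have hn : ‖s.nextX P - s.x‖ ^ 2 = P.η ^ 2 * (‖s.dir‖ ^ 2 / s.b P ^ 2) := by
    rw [State.nextX, sub_sub_cancel_left, norm_neg, norm_smul, mul_pow, Real.norm_eq_abs, sq_abs]
    ring
  have h1 := h.integral_estimator_error_le s.x (s.nextX P) s.dir (a := s.a P)
  have hg2 : Integrable (fun z => ‖stochGrad f (s.nextX P) z‖ ^ 2) D :=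
    (h.memLp_stochGrad _ 2).integrable_norm_pow (by norm_num)
  -- The right side stays an integral over the new sample, so that its gradient term can be matched
  -- pathwise with the increment of log V.
  have hrhs : ∫ z, (s.V P * s.err D f - s.err D f / s.V P
        + 2 * β ^ 2 * P.η ^ 2 * s.stepSq P
        + 2 * ‖stochGrad f (s.nextX P) z‖ ^ 2 / s.V P ^ 3) ∂D
      = s.V P * s.err D f - s.err D f / s.V P
        + 2 * β ^ 2 * P.η ^ 2 * s.stepSq P
        + 2 * (∫ z, ‖stochGrad f (s.nextX P) z‖ ^ 2 ∂D) / s.V P ^ 3 := by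
    rw [integral_add (integrable_const _) ((hg2.const_mul 2).div_const _), integral_div,
      integral_const_mul]
    simp
  rw [hrhs, integral_const_mul]
  have hlhs : ∫ z, (s.next P (stochGrad f) z).err D f ∂D
      = ∫ z, ‖(stochGrad f (s.nextX P) z + (1 - s.a P) • (s.dir - stochGrad f s.x z))
        - gradient (objective D f) (s.nextX P)‖ ^ 2 ∂D := rfl
  rw [hlhs]
  refine (mul_le_mul_of_nonneg_left h1 hV0.le).trans ?_
  have hw : ‖s.dir - gradient (objective D f) s.x‖ ^ 2 = s.err D f := rfl
  have hw0 : 0 ≤ s.err D f := sq_nonneg _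
  have hI : 0 ≤ ∫ z, ‖stochGrad f (s.nextX P) z‖ ^ 2 ∂D := integral_nonneg fun _ => sq_nonneg _
  rw [hn, hw, State.a_eq hg, State.stepSq]
  generalize s.V P = v at *
  generalize s.err D f = w at *
  generalize ∫ z, ‖stochGrad f (s.nextX P) z‖ ^ 2 ∂D = I at *
  have ha1 : (v ^ 2)⁻¹ ≤ 1 := inv_le_one_of_one_le₀ (one_le_pow₀ hV)
  have ha0 : 0 ≤ (v ^ 2)⁻¹ := by positivity
  -- With a = V⁻² the contraction (1-a)² ≤ 1-a, multiplied by V, releases exactly ε/V, and Va²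
  -- becomes V⁻³.
  have hsq1 : (1 - (v ^ 2)⁻¹) ^ 2 ≤ 1 - (v ^ 2)⁻¹ := by nlinarith
  have hsq2 : (1 - (v ^ 2)⁻¹) ^ 2 ≤ 1 := by linarith
  have t1 : v * ((1 - (v ^ 2)⁻¹) ^ 2 * w) ≤ v * w - w / v := by
    have e : v * w - w / v = v * ((1 - (v ^ 2)⁻¹) * w) := by field_simp
    rw [e]; gcongr
  have t2 : v * (2 * (1 - (v ^ 2)⁻¹) ^ 2 * (β ^ 2 * (P.η ^ 2 * (‖s.dir‖ ^ 2 / s.b P ^ 2))))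
      ≤ 2 * β ^ 2 * P.η ^ 2 * (v * ‖s.dir‖ ^ 2 / s.b P ^ 2) := by
    have e : 2 * β ^ 2 * P.η ^ 2 * (v * ‖s.dir‖ ^ 2 / s.b P ^ 2)
        = v * (2 * 1 * (β ^ 2 * (P.η ^ 2 * (‖s.dir‖ ^ 2 / s.b P ^ 2)))) := by ring
    rw [e]; gcongr
  have t3 : v * (2 * (v ^ 2)⁻¹ ^ 2 * I) = 2 * I / v ^ 3 := by field_simp
  linarith

end

/-! ### Measurability and essential boundedness along the run -/

section

variable {d : ℕ} {Ξ : Type*} [MeasurableSpace Ξ] {D : Measure Ξ}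
  {f : Space d → Ξ → ℝ} {σ G β : ℝ} {P : Params}
  {Ω : Type*} [MeasurableSpace Ω] {μ : Measure Ω} {ξ : ℕ → Ω → Ξ}

/-- The run on the random samples `ξ`. -/
noncomputable abbrev traj (P : Params) (f : Space d → Ξ → ℝ) (x₁ : Space d) (ξ : ℕ → Ω → Ξ)
    (ω : Ω) : ℕ → State d :=
  run P (stochGrad f) x₁ (fun k => ξ k ω)

theorem Assumptions.ae_bounded (h : Assumptions D f σ G β) (hs : IsSampling D μ ξ) :
    ∀ᵐ ω ∂μ, ∀ n x, ‖stochGrad f x (ξ n ω)‖ ≤ G := by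
  rw [ae_all_iff]
  intro n
  have hb := h.bounded
  rw [← hs.law n] at hb
  exact ae_of_ae_map (hs.measurable n).aemeasurable hb

theorem State.measurable_V (P : Params) : Measurable (State.V P : State d → ℝ) :=
  (measurable_const.add (State.measurable_gradSum.div_const _)).pow_const _

theorem State.measurable_step (P : Params) : Measurable (State.step P : State d → ℝ) :=
  (State.measurable_dir.norm.pow_const 2).div (State.measurable_b P)

theorem State.measurable_stepSq (P : Params) : Measurable (State.stepSq P : State d → ℝ) :=
  ((State.measurable_V P).mul (State.measurable_dir.norm.pow_const 2)).div
    ((State.measurable_b P).pow_const 2)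

theorem Assumptions.essBdd_V (h : Assumptions D f σ G β) (hs : IsSampling D μ ξ)
    (P : Params) (x₁ : Space d) (n : ℕ) : EssBdd μ (fun ω => (traj P f x₁ ξ ω n).V P) := by
  refine EssBdd.of_abs_le ((State.measurable_V P).comp (hs.measurable_run P h.measurable_grad x₁ n))
    (EssBdd.const (1 + (n + 1) * G ^ 2 / P.a₀ ^ 2)) ?_
  filter_upwards [h.ae_bounded hs] with ω hω
  rw [abs_of_nonneg (zero_le_one.trans (one_le_run_V n))]
  exact run_V_le hω n

theorem Assumptions.essBdd_log_V (h : Assumptions D f σ G β) (hs : IsSampling D μ ξ)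
    (P : Params) (x₁ : Space d) (n : ℕ) :
    EssBdd μ (fun ω => Real.log ((traj P f x₁ ξ ω n).V P)) := by
  have hV := h.essBdd_V hs P x₁ n
  refine EssBdd.of_abs_le (Real.measurable_log.comp hV.1) hV (Filter.Eventually.of_forall ?_)
  intro ω
  have h1 := one_le_run_V (P := P) (g := stochGrad f) (x₁ := x₁) (z := fun k => ξ k ω) n
  rw [abs_of_nonneg (Real.log_nonneg h1)]
  linarith [Real.log_le_sub_one_of_pos (zero_lt_one.trans_le h1)]

theorem Assumptions.essBdd_dir (h : Assumptions D f σ G β) (hs : IsSampling D μ ξ)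
    (P : Params) (x₁ : Space d) (n : ℕ) :
    EssBdd μ (fun ω => ‖(traj P f x₁ ξ ω n).dir‖ ^ 2) := by
  refine EssBdd.of_abs_le
    ((State.measurable_dir.comp (hs.measurable_run P h.measurable_grad x₁ n)).norm.pow_const 2)
    ((((h.essBdd_V hs P x₁ n).pow 2).const_mul (2 * G)).pow 2) ?_
  filter_upwards [h.ae_bounded hs] with ω hω
  rw [abs_of_nonneg (sq_nonneg _)]
  exact pow_le_pow_left₀ (norm_nonneg _) (norm_run_dir_succ_le hω n).1 2

theorem Assumptions.essBdd_div_V (h : Assumptions D f σ G β) (hs : IsSampling D μ ξ)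
    (P : Params) (x₁ : Space d) (n : ℕ) {φ : Ω → ℝ} (hφ : EssBdd μ φ) (k : ℕ) :
    EssBdd μ (fun ω => φ ω / (traj P f x₁ ξ ω n).V P ^ k) := by
  obtain ⟨hm, C, hC⟩ := hφ
  refine ⟨hm.div ((h.essBdd_V hs P x₁ n).1.pow_const k), C, ?_⟩
  filter_upwards [hC] with ω hω
  have h1 : 1 ≤ (traj P f x₁ ξ ω n).V P ^ k := one_le_pow₀ (one_le_run_V n)
  rw [abs_div, abs_of_nonneg (zero_le_one.trans h1)]
  exact (div_le_self (abs_nonneg _) h1).trans hω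

theorem Assumptions.essBdd_step (h : Assumptions D f σ G β) (hP : P.Valid)
    (hs : IsSampling D μ ξ) (x₁ : Space d) (n : ℕ) :
    EssBdd μ (fun ω => (traj P f x₁ ξ ω n).step P) := by
  refine EssBdd.of_abs_le
    ((State.measurable_step P).comp (hs.measurable_run P h.measurable_grad x₁ n))
    ((h.essBdd_dir hs P x₁ n).const_mul (1 / P.b₀)) (Filter.Eventually.of_forall ?_)
  intro ω
  have hb := State.b₀_le_b hP (run_gradSum_nonneg (P := P) (g := stochGrad f) (x₁ := x₁)
    (z := fun k => ξ k ω) n) (run_dirSum_nonneg n)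
  have hb0 := hP.b₀_pos
  have hb1 := hb0.trans_le hb
  rw [State.step, abs_of_nonneg (by positivity), one_div_mul_eq_div]
  gcongr

theorem Assumptions.essBdd_stepSq (h : Assumptions D f σ G β) (hP : P.Valid)
    (hs : IsSampling D μ ξ) (x₁ : Space d) (n : ℕ) :
    EssBdd μ (fun ω => (traj P f x₁ ξ ω n).stepSq P) := by
  refine EssBdd.of_abs_le
    ((State.measurable_stepSq P).comp (hs.measurable_run P h.measurable_grad x₁ n))
    (((h.essBdd_V hs P x₁ n).mul (h.essBdd_dir hs P x₁ n)).const_mul (1 / P.b₀ ^ 2))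
    (Filter.Eventually.of_forall ?_)
  intro ω
  have hb := State.b₀_le_b hP (run_gradSum_nonneg (P := P) (g := stochGrad f) (x₁ := x₁)
    (z := fun k => ξ k ω) n) (run_dirSum_nonneg n)
  have hb0 := hP.b₀_pos
  have hV := zero_le_one.trans (one_le_run_V (P := P) (g := stochGrad f) (x₁ := x₁)
    (z := fun k => ξ k ω) n)
  rw [State.stepSq, abs_of_nonneg (by positivity), one_div_mul_eq_div]
  gcongr

theorem Assumptions.measurable_stochGrad_run (h : Assumptions D f σ G β)
    (hs : IsSampling D μ ξ) (P : Params) (x₁ : Space d) (n : ℕ) :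
    Measurable (fun ω => stochGrad f (traj P f x₁ ξ ω n).x (ξ n ω)) :=
  h.measurable_grad.comp ((State.measurable_x.comp
    (hs.measurable_run P h.measurable_grad x₁ n)).prodMk (hs.measurable n))

theorem Assumptions.essBdd_stochGrad_run (h : Assumptions D f σ G β)
    (hs : IsSampling D μ ξ) (P : Params) (x₁ : Space d) (n : ℕ) :
    EssBdd μ (fun ω => ‖stochGrad f (traj P f x₁ ξ ω n).x (ξ n ω)‖ ^ 2) := by
  refine EssBdd.of_abs_le ((h.measurable_stochGrad_run hs P x₁ n).norm.pow_const 2)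
    (EssBdd.const (G ^ 2)) ?_
  filter_upwards [h.ae_bounded hs] with ω hω
  rw [abs_of_nonneg (sq_nonneg _)]
  exact pow_le_pow_left₀ (norm_nonneg _) (hω n _) 2

variable [IsProbabilityMeasure D]

theorem Assumptions.measurable_err (h : Assumptions D f σ G β) (hβ : 0 ≤ β) :
    Measurable (State.err D f : State d → ℝ) :=
  ((State.measurable_dir.sub
    ((h.continuous_gradient hβ).measurable.comp State.measurable_x)).norm.pow_const 2)

theorem Assumptions.essBdd_err (h : Assumptions D f σ G β) (hβ : 0 ≤ β)
    (hs : IsSampling D μ ξ) (P : Params) (x₁ : Space d) (n : ℕ) :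
    EssBdd μ (fun ω => (traj P f x₁ ξ ω n).err D f) := by
  refine EssBdd.of_abs_le
    ((h.measurable_err hβ).comp (hs.measurable_run P h.measurable_grad x₁ n))
    (((h.essBdd_V hs P x₁ n).pow 4).const_mul (9 * G ^ 2)) ?_
  filter_upwards [h.ae_bounded hs] with ω hω
  rw [abs_of_nonneg (sq_nonneg _)]
  exact (h.err_succ_le hω n).1

theorem Assumptions.essBdd_err_div_V (h : Assumptions D f σ G β) (hβ : 0 ≤ β)
    (hs : IsSampling D μ ξ) (P : Params) (x₁ : Space d) (n : ℕ) :
    EssBdd μ (fun ω => (traj P f x₁ ξ ω n).err D f / (traj P f x₁ ξ ω n).V P) := by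
  simpa using h.essBdd_div_V hs P x₁ n (h.essBdd_err hβ hs P x₁ n) 1

theorem Assumptions.measurable_gradient_run (h : Assumptions D f σ G β) (hβ : 0 ≤ β)
    (hs : IsSampling D μ ξ) (P : Params) (x₁ : Space d) (n : ℕ) :
    Measurable (fun ω => gradient (objective D f) (traj P f x₁ ξ ω n).x) :=
  (h.continuous_gradient hβ).measurable.comp
    (State.measurable_x.comp (hs.measurable_run P h.measurable_grad x₁ n))

theorem Assumptions.essBdd_gradNormSq (h : Assumptions D f σ G β) (hβ : 0 ≤ β)
    (hs : IsSampling D μ ξ) (P : Params) (x₁ : Space d) (n : ℕ) :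
    EssBdd μ (fun ω => gradNormSq P D f x₁ (fun k => ξ k ω) n) := by
  refine EssBdd.of_abs_le ((h.measurable_gradient_run hβ hs P x₁ n).norm.pow_const 2)
    (EssBdd.const (G ^ 2)) (Filter.Eventually.of_forall fun ω => ?_)
  rw [gradNormSq, abs_of_nonneg (sq_nonneg _)]
  exact pow_le_pow_left₀ (norm_nonneg _) (h.norm_gradient_le _) 2

theorem Assumptions.essBdd_H (h : Assumptions D f σ G β) (hβ : 0 ≤ β)
    (hs : IsSampling D μ ξ) (P : Params) (x₁ : Space d) (T : ℕ) :
    EssBdd μ (fun ω => H P D f x₁ (fun k => ξ k ω) T) :=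
  EssBdd.sum _ fun n => h.essBdd_gradNormSq hβ hs P x₁ n

theorem Assumptions.essBdd_noise (h : Assumptions D f σ G β) (hβ : 0 ≤ β)
    (hs : IsSampling D μ ξ) (P : Params) (x₁ : Space d) (n : ℕ) :
    EssBdd μ (fun ω => ‖stochGrad f (traj P f x₁ ξ ω n).x (ξ n ω)
      - gradient (objective D f) (traj P f x₁ ξ ω n).x‖ ^ 2) := by
  refine EssBdd.of_abs_le (((h.measurable_stochGrad_run hs P x₁ n).sub
    (h.measurable_gradient_run hβ hs P x₁ n)).norm.pow_const 2)
    (EssBdd.const ((G + G) ^ 2)) ?_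
  filter_upwards [h.ae_bounded hs] with ω hω
  rw [abs_of_nonneg (sq_nonneg _)]
  exact pow_le_pow_left₀ (norm_nonneg _)
    ((norm_sub_le _ _).trans (add_le_add (hω n _) (h.norm_gradient_le _))) 2

theorem Assumptions.essBdd_potential (h : Assumptions D f σ G β) (hβ : 0 ≤ β) (hP : P.Valid)
    (hs : IsSampling D μ ξ) (x₁ : Space d) (n : ℕ) :
    EssBdd μ (fun ω => potential P D f G β (traj P f x₁ ξ ω) n) := by
  have hV := h.essBdd_V hs P x₁ n
  have hE := h.essBdd_err hβ hs P x₁ n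
  exact (((((hV.mul hE).sub ((h.essBdd_err_div_V hβ hs P x₁ n).const_mul _)).add
    ((EssBdd.sum _ fun i => h.essBdd_err_div_V hβ hs P x₁ i).const_mul _)).add
    ((h.essBdd_div_V hs P x₁ n (EssBdd.const 1) 3).const_mul _)).sub
    ((h.essBdd_log_V hs P x₁ n).const_mul _)).sub
    ((EssBdd.sum _ fun i => h.essBdd_stepSq hP hs x₁ i).const_mul _)

variable [IsProbabilityMeasure μ]

/-! ### Expectations along the run -/

/-- The pathwise increment is at most X - X', where X = V_n ε_{n+1} and 𝔼X ≤ 𝔼X' by the one-step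
bound for a fixed state. -/
theorem Assumptions.integral_potential_succ_le (h : Assumptions D f σ G β) (hβ : 0 ≤ β)
    (hP : P.Valid) (hs : IsSampling D μ ξ) (x₁ : Space d) (n : ℕ) :
    ∫ ω, potential P D f G β (traj P f x₁ ξ ω) (n + 1) ∂μ
      ≤ ∫ ω, potential P D f G β (traj P f x₁ ξ ω) n ∂μ := by
  have hg := h.measurable_grad
  have hV := h.essBdd_V hs P x₁ n
  have hφ : EssBdd μ (fun ω => (traj P f x₁ ξ ω n).V P * (traj P f x₁ ξ ω (n + 1)).err D f) :=
    hV.mul (h.essBdd_err hβ hs P x₁ (n + 1))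
  have hψ : EssBdd μ (fun ω => (traj P f x₁ ξ ω n).V P * (traj P f x₁ ξ ω n).err D f
      - (traj P f x₁ ξ ω n).err D f / (traj P f x₁ ξ ω n).V P
      + 2 * β ^ 2 * P.η ^ 2 * (traj P f x₁ ξ ω n).stepSq P
      + 2 * ‖stochGrad f (traj P f x₁ ξ ω (n + 1)).x (ξ (n + 1) ω)‖ ^ 2
        / (traj P f x₁ ξ ω n).V P ^ 3) :=
    (((hV.mul (h.essBdd_err hβ hs P x₁ n)).sub (h.essBdd_err_div_V hβ hs P x₁ n)).add
      ((h.essBdd_stepSq hP hs x₁ n).const_mul _)).add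
      (h.essBdd_div_V hs P x₁ n ((h.essBdd_stochGrad_run hs P x₁ (n + 1)).const_mul 2) 3)
  have hVm := State.measurable_V (d := d) P
  have hEm := h.measurable_err hβ
  have key := hs.integral_le_of_forall_state P hg x₁ n
    (φ := fun w => w.1.V P * (w.1.next P (stochGrad f) w.2).err D f)
    (ψ := fun w => w.1.V P * w.1.err D f - w.1.err D f / w.1.V P
        + 2 * β ^ 2 * P.η ^ 2 * w.1.stepSq P
        + 2 * ‖stochGrad f (w.1.nextX P) w.2‖ ^ 2 / w.1.V P ^ 3)
    ((hVm.comp measurable_fst).mul (hEm.comp (State.measurable_next P hg)))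
    ((((((hVm.mul hEm).sub (hEm.div hVm)).add
      ((State.measurable_stepSq P).const_mul _)).comp measurable_fst)).add
      (((hg.comp (((State.measurable_nextX P).comp measurable_fst).prodMk
        measurable_snd)).norm.pow_const 2 |>.const_mul 2).div
          ((hVm.comp measurable_fst).pow_const 3)))
    hφ.integrable hψ.integrable
    (fun ω => h.integral_V_mul_err_next_le (run_gradSum_nonneg n))
  have hp1 := (h.essBdd_potential hβ hP hs x₁ (n + 1)).integrable
  have hp0 := (h.essBdd_potential hβ hP hs x₁ n).integrable
  have hle : ∫ ω, (potential P D f G β (traj P f x₁ ξ ω) (n + 1)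
      - potential P D f G β (traj P f x₁ ξ ω) n) ∂μ
      ≤ ∫ ω, ((traj P f x₁ ξ ω n).V P * (traj P f x₁ ξ ω (n + 1)).err D f
        - ((traj P f x₁ ξ ω n).V P * (traj P f x₁ ξ ω n).err D f
      - (traj P f x₁ ξ ω n).err D f / (traj P f x₁ ξ ω n).V P
      + 2 * β ^ 2 * P.η ^ 2 * (traj P f x₁ ξ ω n).stepSq P
      + 2 * ‖stochGrad f (traj P f x₁ ξ ω (n + 1)).x (ξ (n + 1) ω)‖ ^ 2
        / (traj P f x₁ ξ ω n).V P ^ 3)) ∂μ := by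
    refine integral_mono_ae (hp1.sub hp0) (hφ.sub hψ).integrable ?_
    filter_upwards [h.ae_bounded hs] with ω hω
    exact h.potential_succ_sub_le hP hω n
  rw [integral_sub hp1 hp0, integral_sub hφ.integrable hψ.integrable] at hle
  have key' : ∫ ω, (traj P f x₁ ξ ω n).V P * (traj P f x₁ ξ ω (n + 1)).err D f ∂μ
      ≤ ∫ ω, ((traj P f x₁ ξ ω n).V P * (traj P f x₁ ξ ω n).err D f
      - (traj P f x₁ ξ ω n).err D f / (traj P f x₁ ξ ω n).V P
      + 2 * β ^ 2 * P.η ^ 2 * (traj P f x₁ ξ ω n).stepSq P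
      + 2 * ‖stochGrad f (traj P f x₁ ξ ω (n + 1)).x (ξ (n + 1) ω)‖ ^ 2
        / (traj P f x₁ ξ ω n).V P ^ 3) ∂μ := key
  linarith

/-- The constant in the bound on the errors of the estimator. -/
noncomputable def errConst (P : Params) (G : ℝ) : ℝ :=
  18 * G ^ 2 * (1 + G ^ 2 / P.a₀ ^ 2) ^ 5 + 2 * jumpConst P G

theorem errConst_nonneg (P : Params) (G : ℝ) : 0 ≤ errConst P G := by
  have := jumpConst_nonneg P G
  rw [errConst]; positivity

/-- The initial potential is bounded by a constant through V ≤ 1 + G²/a₀² and ε ≤ 9G²V⁴ at the first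
step; the final potential dominates half of `W` minus the logarithm and the second-order sum. -/
theorem Assumptions.integral_sum_err_le (h : Assumptions D f σ G β) (hβ : 0 ≤ β)
    (hP : P.Valid) (hs : IsSampling D μ ξ) (x₁ : Space d) (N : ℕ) :
    ∫ ω, ∑ n ∈ Finset.range (N + 1),
        (traj P f x₁ ξ ω n).err D f / (traj P f x₁ ξ ω n).V P ∂μ
      ≤ errConst P G + 12 * P.a₀ ^ 2 * ∫ ω, Real.log ((traj P f x₁ ξ ω N).V P) ∂μ
        + 4 * β ^ 2 * P.η ^ 2
          * ∫ ω, ∑ n ∈ Finset.range (N + 1), (traj P f x₁ ξ ω n).stepSq P ∂μ := by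
  have hmono : ∫ ω, potential P D f G β (traj P f x₁ ξ ω) N ∂μ
      ≤ ∫ ω, potential P D f G β (traj P f x₁ ξ ω) 0 ∂μ := by
    induction N with
    | zero => exact le_rfl
    | succ N ih => exact (h.integral_potential_succ_le hβ hP hs x₁ N).trans ih
  have hJ := jumpConst_nonneg P G
  have h0 : ∫ ω, potential P D f G β (traj P f x₁ ξ ω) 0 ∂μ ≤ errConst P G / 2 := by
    have : ∫ ω, potential P D f G β (traj P f x₁ ξ ω) 0 ∂μ ≤ ∫ _, errConst P G / 2 ∂μ := by
      refine integral_mono_ae (h.essBdd_potential hβ hP hs x₁ 0).integrable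
        (EssBdd.const _).integrable ?_
      filter_upwards [h.ae_bounded hs] with ω hω
      have hV := one_le_run_V (P := P) (g := stochGrad f) (x₁ := x₁) (z := fun k => ξ k ω) 0
      have hV' := run_V_le (P := P) (x₁ := x₁) hω 0
      have he := (h.err_succ_le (P := P) (x₁ := x₁) hω 0).1
      have he0 : 0 ≤ (traj P f x₁ ξ ω 0).err D f := sq_nonneg _
      simp only [potential, Finset.range_zero, Finset.sum_empty, errConst]
      change _ ≤ _ at he
      norm_num at hV'
      generalize (traj P f x₁ ξ ω 0).V P = v at *
      generalize (traj P f x₁ ξ ω 0).err D f = w at *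
      have hv0 : 0 < v := by linarith
      have t1 : 1 / v ^ 3 ≤ 1 := by
        rw [div_le_one (by positivity)]; exact one_le_pow₀ hV
      have t2 : v * w ≤ 9 * G ^ 2 * (1 + G ^ 2 / P.a₀ ^ 2) ^ 5 := by
        calc v * w ≤ v * (9 * G ^ 2 * v ^ 4) := by gcongr
          _ = 9 * G ^ 2 * v ^ 5 := by ring
          _ ≤ _ := by gcongr
      have t3 : 0 ≤ w / v := by positivity
      have t4 : 0 ≤ 6 * P.a₀ ^ 2 * Real.log v := by
        have := Real.log_nonneg hV; positivity
      nlinarith [mul_le_mul_of_nonneg_left t1 hJ]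
    simpa using this
  have hW := EssBdd.sum (Finset.range (N + 1)) fun i => h.essBdd_err_div_V hβ hs P x₁ i
  have hY := EssBdd.sum (Finset.range (N + 1)) fun i => h.essBdd_stepSq hP hs x₁ i
  have hL := h.essBdd_log_V hs P x₁ N
  have hN : ∫ ω, (1 / 2 * ∑ n ∈ Finset.range (N + 1),
        (traj P f x₁ ξ ω n).err D f / (traj P f x₁ ξ ω n).V P
      - 6 * P.a₀ ^ 2 * Real.log ((traj P f x₁ ξ ω N).V P)
      - 2 * β ^ 2 * P.η ^ 2
        * ∑ n ∈ Finset.range (N + 1), (traj P f x₁ ξ ω n).stepSq P) ∂μ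
      ≤ ∫ ω, potential P D f G β (traj P f x₁ ξ ω) N ∂μ := by
    refine integral_mono (((hW.const_mul _).sub (hL.const_mul _)).sub (hY.const_mul _)).integrable
      (h.essBdd_potential hβ hP hs x₁ N).integrable fun ω => ?_
    have hV := one_le_run_V (P := P) (g := stochGrad f) (x₁ := x₁) (z := fun k => ξ k ω) N
    have he0 : 0 ≤ (traj P f x₁ ξ ω N).err D f := sq_nonneg _
    have hS : 0 ≤ (traj P f x₁ ξ ω N).stepSq P := by
      have := zero_le_one.trans hV
      rw [State.stepSq]; positivity
    have hV0 : 0 < (traj P f x₁ ξ ω N).V P := zero_lt_one.trans_le hV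
    simp only [potential, Finset.sum_range_succ]
    -- The sums in the potential stop before index `N`. Since V ≥ 1, Vε - ε/(2V) is at least ε/(2V),
    -- which supplies the missing last summand.
    have t1 : (traj P f x₁ ξ ω N).err D f / (traj P f x₁ ξ ω N).V P
        ≤ (traj P f x₁ ξ ω N).V P * (traj P f x₁ ξ ω N).err D f := by
      refine (div_le_self he0 hV).trans (le_mul_of_one_le_left he0 hV)
    have t2 : 0 ≤ jumpConst P G * (1 / (traj P f x₁ ξ ω N).V P ^ 3) := by positivity
    have t3 : 0 ≤ 2 * β ^ 2 * P.η ^ 2 * (traj P f x₁ ξ ω N).stepSq P := by positivity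
    linarith
  rw [integral_sub ((hW.const_mul _).sub (hL.const_mul _)).integrable (hY.const_mul _).integrable,
    integral_sub (hW.const_mul _).integrable (hL.const_mul _).integrable, integral_const_mul,
    integral_const_mul, integral_const_mul] at hN
  linarith

theorem Assumptions.integral_noise_le (h : Assumptions D f σ G β) (hβ : 0 ≤ β)
    (hs : IsSampling D μ ξ) (x₁ : Space d) (n : ℕ) :
    ∫ ω, ‖stochGrad f (traj P f x₁ ξ ω n).x (ξ n ω)
      - gradient (objective D f) (traj P f x₁ ξ ω n).x‖ ^ 2 ∂μ ≤ σ ^ 2 := by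
  have hc := (h.continuous_gradient hβ).measurable
  cases n with
  | zero =>
    have hm : Measurable fun z => ‖stochGrad f x₁ z - gradient (objective D f) x₁‖ ^ 2 :=
      ((h.measurable_stochGrad x₁).sub measurable_const).norm.pow_const 2
    have := integral_map (μ := μ) (hs.measurable 0).aemeasurable hm.aestronglyMeasurable
    rw [hs.law 0] at this
    exact this.symm.trans_le (h.variance x₁)
  | succ n =>
    have key := hs.integral_le_of_forall_state P h.measurable_grad x₁ n
      (φ := fun w => ‖stochGrad f (w.1.nextX P) w.2
        - gradient (objective D f) (w.1.nextX P)‖ ^ 2) (ψ := fun _ => σ ^ 2)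
      (((h.measurable_grad.comp (((State.measurable_nextX P).comp measurable_fst).prodMk
        measurable_snd)).sub (hc.comp ((State.measurable_nextX P).comp
          measurable_fst))).norm.pow_const 2)
      measurable_const (h.essBdd_noise hβ hs P x₁ (n + 1)).integrable (integrable_const _)
      (fun ω => by simpa using h.variance _)
    simp only [integral_const, probReal_univ, one_smul] at key
    exact key

end

theorem Params.Valid.ph_pos {P : Params} (hP : P.Valid) : 0 < P.ph := by
  have := hP.p_le
  rw [Params.ph]; linarith

theorem Params.Valid.third_le_ph {P : Params} (hP : P.Valid) : 1 / 3 ≤ P.ph := by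
  have := hP.p_le
  rw [Params.ph]; linarith

theorem Params.Valid.ph_le_half {P : Params} (hP : P.Valid) : P.ph ≤ 1 / 2 := by
  have := hP.le_p
  rw [Params.ph]; linarith

theorem add_rpow_le {x y r : ℝ} (hx : 0 ≤ x) (hy : 0 ≤ y) (hr : 0 ≤ r) (hr1 : r ≤ 1) :
    (x + y) ^ r ≤ x ^ r + y ^ r := by
  lift x to NNReal using hx
  lift y to NNReal using hy
  exact_mod_cast NNReal.rpow_add_le_add_rpow x y hr hr1

/-! ### The constants -/

section

variable (P : Params) (G β Δ lam : ℝ)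

/-- `C₇ + C₈`. -/
noncomputable def C78 : ℝ := C7 P G β lam + C8 P β lam

/-- The constant term in the bound on `𝔼 [∑ ‖d_t‖² / b_t]`. -/
noncomputable def stepConst : ℝ :=
  2 * (Δ / P.η) + lam / (P.η * max β 1) * errConst P G
    + C78 P G β lam ^ (1 / P.p - 1) * (|Real.log (C78 P G β lam / P.b₀)| / P.p)

/-- The coefficient of `𝔼 [log V]` in the bound on `𝔼 [∑ ‖d_t‖² / b_t]`. -/
noncomputable def stepSlope : ℝ := 2 * C5 P β lam + C78 P G β lam ^ (1 / P.p - 1)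

/-- The constant term in the bound on the errors of the estimator. -/
noncomputable def errBoundConst : ℝ :=
  errConst P G + 4 * β ^ 2 * P.η ^ 2 * ((stepConst P G β Δ lam
    + C78 P G β lam ^ (1 / P.p - 1) * (|Real.log (C78 P G β lam / P.b₀)| / P.p))
      / C78 P G β lam)

/-- The coefficient of `𝔼 [log V]` in the bound on the errors of the estimator. -/
noncomputable def errBoundSlope : ℝ :=
  12 * P.a₀ ^ 2 + 4 * β ^ 2 * P.η ^ 2
    * ((stepSlope P G β lam + C78 P G β lam ^ (1 / P.p - 1)) / C78 P G β lam)

variable {P G β Δ lam}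

theorem C78_pos (hP : P.Valid) (hlam : 0 < lam) : 0 < C78 P G β lam := by
  have hη := hP.η_pos
  have hb : 0 < max β 1 := lt_max_of_lt_right one_pos
  rw [C78, C7, C8]
  positivity

theorem C5_eq : C5 P β lam = 6 * lam * P.a₀ ^ 2 / (P.η * max β 1) := by
  rw [C5, C2of, if_neg (lt_irrefl _)]; ring

theorem C5_pos (hP : P.Valid) (hlam : 0 < lam) : 0 < C5 P β lam := by
  have hη := hP.η_pos
  have ha := hP.a₀_pos
  have hb : 0 < max β 1 := lt_max_of_lt_right one_pos
  rw [C5_eq]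
  positivity

theorem stepConst_nonneg (hP : P.Valid) (hlam : 0 < lam) (hΔ : 0 ≤ Δ) :
    0 ≤ stepConst P G β Δ lam := by
  have hη := hP.η_pos
  have hb : 0 < max β 1 := lt_max_of_lt_right one_pos
  have h1 := C78_pos (G := G) (β := β) hP hlam
  have h2 := errConst_nonneg P G
  have h3 := hP.p_pos
  rw [stepConst]
  positivity

theorem stepSlope_pos (hP : P.Valid) (hlam : 0 < lam) : 0 < stepSlope P G β lam := by
  have h1 := C78_pos (G := G) (β := β) hP hlam
  have h2 := C5_pos (β := β) hP hlam
  rw [stepSlope]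
  positivity

theorem errBoundConst_nonneg (hP : P.Valid) (hlam : 0 < lam) (hΔ : 0 ≤ Δ) :
    0 ≤ errBoundConst P G β Δ lam := by
  have h1 := C78_pos (G := G) (β := β) hP hlam
  have h2 := errConst_nonneg P G
  have h3 := hP.p_pos
  have h4 := stepConst_nonneg (G := G) (β := β) hP hlam hΔ
  rw [errBoundConst]
  positivity

theorem errBoundSlope_nonneg (hP : P.Valid) (hlam : 0 < lam) :
    0 ≤ errBoundSlope P G β lam := by
  have h1 := C78_pos (G := G) (β := β) hP hlam
  have h4 := stepSlope_pos (G := G) (β := β) hP hlam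
  rw [errBoundSlope]
  positivity

/-- The second-order coefficient is at most half of `C₇ + C₈`. -/
theorem second_order_coeff_le (hP : P.Valid) (hlam : 0 < lam) (hβ : 0 ≤ β) :
    lam / (P.η * max β 1) / 2 * (4 * β ^ 2 * P.η ^ 2)
      + (1 / (2 * (lam / (P.η * max β 1))) + β * P.η / 2) ≤ C78 P G β lam / 2 := by
  have hη := hP.η_pos
  have hb : 0 < max β 1 := lt_max_of_lt_right one_pos
  have hle : β ≤ max β 1 := le_max_left _ _
  rw [C78, C7, C8]
  generalize max β 1 = m at *
  have e1 : lam / (P.η * m) / 2 * (4 * β ^ 2 * P.η ^ 2) = 2 * lam * P.η * (β * (β / m)) := by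
    field_simp; ring
  have e2 : 1 / (2 * (lam / (P.η * m))) = 1 / lam * (P.η * m) / 2 := by field_simp
  -- The three contributions are at most 2λ, 1/(2λ) and 1/2 times η·max β 1. Half of C₈ offers 3λ
  -- and 1/(2λ), and half of C₇ offers at least 1/2.
  have h1 : β * (β / m) ≤ m := by
    rw [mul_div_assoc', div_le_iff₀ hb]; nlinarith
  have h2 : 2 * lam * P.η * (β * (β / m)) ≤ 2 * lam * P.η * m := by gcongr
  have h3 : β * P.η / 2 ≤ m * P.η / 2 := by gcongr
  have h4 : 0 ≤ 6 * lam * G ^ 2 / P.a₀ ^ 2 * (P.η * m) := by positivity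
  have h5 : 0 ≤ lam * P.η * m := by positivity
  rw [e1, e2]
  nlinarith

end

/-! ### From the three sums to a recursive inequality for the expectation of `H` -/

section

variable {d : ℕ} {Ξ : Type*} [MeasurableSpace Ξ] {D : Measure Ξ}
  {f : Space d → Ξ → ℝ} {σ G β lam : ℝ} {P : Params}

/-- The pathwise bound behind the Hölder inequality. -/
theorem H_rpow_le (hP : P.Valid) (x₁ : Space d) (z : ℕ → Ξ) (N : ℕ) :
    H P D f x₁ z (N + 1) ^ P.ph ≤ 2 ^ P.ph *
      ((((run P (stochGrad f) x₁ z N).V P ^ (3 * P.ph)) ^ (1 / 3 : ℝ)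
        * (P.b₀ ^ (1 / P.p - 1) + ∑ n ∈ Finset.range (N + 1),
          (run P (stochGrad f) x₁ z n).step P) ^ (2 / 3 : ℝ))
      + ((run P (stochGrad f) x₁ z N).V P ^ (3 * P.ph)) ^ (1 / 3 : ℝ)
        * ((∑ n ∈ Finset.range (N + 1), (run P (stochGrad f) x₁ z n).err D f
          / (run P (stochGrad f) x₁ z n).V P) ^ (3 * P.ph / 2)) ^ (2 / 3 : ℝ)) := by
  have hph := hP.ph_pos
  have hph1 := hP.ph_le_half
  have hV := one_le_run_V (P := P) (g := stochGrad f) (x₁ := x₁) (z := z) N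
  have hV0 : 0 ≤ (run P (stochGrad f) x₁ z N).V P := by linarith
  have hds := run_dirSum_nonneg (P := P) (g := stochGrad f) (x₁ := x₁) (z := z) N
  have hb0 := hP.b₀_pos
  have hstep0 : ∀ n, 0 ≤ (run P (stochGrad f) x₁ z n).step P := fun n => by
    have := hb0.le.trans (State.b₀_le_b hP (run_gradSum_nonneg (P := P) (g := stochGrad f)
      (x₁ := x₁) (z := z) n) (run_dirSum_nonneg n))
    rw [State.step]; positivity
  have hW0 : 0 ≤ ∑ n ∈ Finset.range (N + 1), (run P (stochGrad f) x₁ z n).err D f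
      / (run P (stochGrad f) x₁ z n).V P := by
    refine Finset.sum_nonneg fun n _ => div_nonneg (sq_nonneg _) ?_
    exact zero_le_one.trans (one_le_run_V n)
  have hZ0 : 0 ≤ P.b₀ ^ (1 / P.p - 1)
      + ∑ n ∈ Finset.range (N + 1), (run P (stochGrad f) x₁ z n).step P :=
    add_nonneg (Real.rpow_nonneg hb0.le _) (Finset.sum_nonneg fun n _ => hstep0 n)
  have hH : H P D f x₁ z (N + 1) ≤ 2 * ((run P (stochGrad f) x₁ z N).dirSum
      + (run P (stochGrad f) x₁ z N).V P * ∑ n ∈ Finset.range (N + 1),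
        (run P (stochGrad f) x₁ z n).err D f / (run P (stochGrad f) x₁ z n).V P) := by
    rw [H, run_dirSum_eq, Finset.mul_sum, ← Finset.sum_add_distrib, Finset.mul_sum]
    refine Finset.sum_le_sum fun n hn => ?_
    have hnN : n ≤ N := Nat.lt_succ_iff.1 (Finset.mem_range.1 hn)
    have hmono := run_V_mono (P := P) (g := stochGrad f) (x₁ := x₁) (z := z) hnN
    simp only at hmono
    have hVn := one_le_run_V (P := P) (g := stochGrad f) (x₁ := x₁) (z := z) n
    have he0 : 0 ≤ (run P (stochGrad f) x₁ z n).err D f := sq_nonneg _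
    have h1 : (run P (stochGrad f) x₁ z n).err D f ≤ (run P (stochGrad f) x₁ z N).V P
        * ((run P (stochGrad f) x₁ z n).err D f / (run P (stochGrad f) x₁ z n).V P) := by
      rw [mul_div_assoc', le_div_iff₀ (by linarith), mul_comm]
      gcongr
    have h2 : gradNormSq P D f x₁ z n ≤ 2 * (‖(run P (stochGrad f) x₁ z n).dir‖ ^ 2
        + (run P (stochGrad f) x₁ z n).err D f) := by
      rw [gradNormSq, State.err]
      set m := gradient (objective D f) (run P (stochGrad f) x₁ z n).x
      set v := (run P (stochGrad f) x₁ z n).dir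
      have h3 : ‖m‖ ≤ ‖v‖ + ‖v - m‖ := by
        have := norm_sub_le v (v - m)
        rwa [sub_sub_cancel] at this
      have h4 := pow_le_pow_left₀ (norm_nonneg m) h3 2
      nlinarith [sq_nonneg (‖v‖ - ‖v - m‖)]
    linarith
  have hH0 : 0 ≤ H P D f x₁ z (N + 1) := Finset.sum_nonneg fun n _ => sq_nonneg _
  have hdir := Real.rpow_le_rpow (Real.rpow_nonneg hds _)
    (dirSum_rpow_le (P := P) (g := stochGrad f) (x₁ := x₁) (z := z) hP N)
    (show (0 : ℝ) ≤ 2 / 3 by norm_num)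
  rw [← Real.rpow_mul hds, Real.mul_rpow (Real.rpow_nonneg hV0 _) hZ0,
    ← Real.rpow_mul hV0] at hdir
  -- This identity fixes p̂: the power 2/3 turns the bound on (∑‖d_t‖²)^(1-p) into one on
  -- (∑‖d_t‖²)^p̂, with the factor V^p̂ = (V^(3p̂))^(1/3) required by Hölder's inequality.
  have e1 : (1 - P.p) * (2 / 3) = P.ph := by rw [Params.ph]; ring
  rw [e1] at hdir
  have e2 : 3 * P.ph * (1 / 3) = P.ph := by ring
  have e3 : 3 * P.ph / 2 * (2 / 3) = P.ph := by ring
  rw [← Real.rpow_mul hV0, ← Real.rpow_mul hW0, e2, e3]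
  refine (Real.rpow_le_rpow hH0 hH hph.le).trans ?_
  rw [Real.mul_rpow (by norm_num) (add_nonneg hds (mul_nonneg hV0 hW0))]
  gcongr
  refine (add_rpow_le hds (mul_nonneg hV0 hW0) hph.le (by linarith)).trans ?_
  rw [Real.mul_rpow hV0 hW0]
  gcongr

/-- The pathwise bound on the sum of the squared stochastic gradients. -/
theorem V_rpow_le (hP : P.Valid) (x₁ : Space d) (z : ℕ → Ξ) (N : ℕ) :
    (run P (stochGrad f) x₁ z N).V P ^ (3 * P.ph) ≤ 1 + 1 / P.a₀ ^ (2 * P.ph) *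
      ((2 * ∑ n ∈ Finset.range (N + 1), ‖stochGrad f (run P (stochGrad f) x₁ z n).x (z n)
        - gradient (objective D f) (run P (stochGrad f) x₁ z n).x‖ ^ 2) ^ P.ph
        + 2 * H P D f x₁ z (N + 1) ^ P.ph) := by
  have hph := hP.ph_pos
  have hph1 := hP.ph_le_half
  have ha := hP.a₀_pos
  have hgs := run_gradSum_nonneg (P := P) (g := stochGrad f) (x₁ := x₁) (z := z) N
  have hV := zero_le_one.trans
    (one_le_run_V (P := P) (g := stochGrad f) (x₁ := x₁) (z := z) N)
  have hH0 : 0 ≤ H P D f x₁ z (N + 1) := Finset.sum_nonneg fun n _ => sq_nonneg _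
  have e : (run P (stochGrad f) x₁ z N).V P ^ (3 * P.ph)
      = (1 + (run P (stochGrad f) x₁ z N).gradSum / P.a₀ ^ 2) ^ P.ph := by
    rw [← State.V_pow_three hgs, Real.rpow_mul hV]
    norm_cast
  set S := ∑ n ∈ Finset.range (N + 1), ‖stochGrad f (run P (stochGrad f) x₁ z n).x (z n)
        - gradient (objective D f) (run P (stochGrad f) x₁ z n).x‖ ^ 2 with hS
  have hS0 : 0 ≤ S := by positivity
  have hle : (run P (stochGrad f) x₁ z N).gradSum ≤ 2 * S + 2 * H P D f x₁ z (N + 1) := by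
    rw [run_gradSum_eq, hS, H, Finset.mul_sum, Finset.mul_sum, ← Finset.sum_add_distrib]
    refine Finset.sum_le_sum fun n _ => ?_
    rw [gradNormSq]
    set m := gradient (objective D f) (run P (stochGrad f) x₁ z n).x
    set v := stochGrad f (run P (stochGrad f) x₁ z n).x (z n)
    have h3 : ‖v‖ ≤ ‖v - m‖ + ‖m‖ := by simpa using norm_add_le (v - m) m
    have h4 := pow_le_pow_left₀ (norm_nonneg v) h3 2
    nlinarith [sq_nonneg (‖v - m‖ - ‖m‖)]
  have h2 : (2 : ℝ) ^ P.ph ≤ 2 := by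
    simpa using Real.rpow_le_rpow_of_exponent_le (x := 2) (by norm_num)
      (show P.ph ≤ 1 by linarith)
  have hg : (run P (stochGrad f) x₁ z N).gradSum ^ P.ph
      ≤ (2 * S) ^ P.ph + 2 * H P D f x₁ z (N + 1) ^ P.ph := by
    refine (Real.rpow_le_rpow hgs hle hph.le).trans ?_
    refine (add_rpow_le (by positivity) (by positivity) hph.le (by linarith)).trans ?_
    rw [Real.mul_rpow (by norm_num : (0 : ℝ) ≤ 2) hH0]
    gcongr
  rw [e]
  refine (add_rpow_le zero_le_one (by positivity) hph.le (by linarith)).trans ?_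
  rw [Real.one_rpow, Real.div_rpow hgs (by positivity), ← Real.rpow_natCast P.a₀ 2,
    ← Real.rpow_mul ha.le, one_div_mul_eq_div]
  push_cast
  gcongr

variable [IsProbabilityMeasure D]
  {Ω : Type*} [MeasurableSpace Ω] {μ : Measure Ω} [IsProbabilityMeasure μ] {ξ : ℕ → Ω → Ξ}

/-- Inserting the bound on 𝔼W into the descent inequality leaves at most (κ/2)𝔼Y, and κY is at most
Z plus a logarithm, so half of 𝔼Z is absorbed on the left. The bound on 𝔼Z then controls 𝔼Y, and
with it 𝔼W. -/
theorem Assumptions.integral_sum_le (h : Assumptions D f σ G β) (hβ : 0 ≤ β)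
    (hP : P.Valid) (hlam : 0 < lam) (hs : IsSampling D μ ξ) (x₁ : Space d) (N : ℕ) :
    ∫ ω, ∑ n ∈ Finset.range (N + 1), (traj P f x₁ ξ ω n).step P ∂μ
      ≤ stepConst P G β (gap D f x₁) lam
        + stepSlope P G β lam * ∫ ω, Real.log ((traj P f x₁ ξ ω N).V P) ∂μ ∧
    ∫ ω, ∑ n ∈ Finset.range (N + 1),
        (traj P f x₁ ξ ω n).err D f / (traj P f x₁ ξ ω n).V P ∂μ
      ≤ errBoundConst P G β (gap D f x₁) lam
        + errBoundSlope P G β lam * ∫ ω, Real.log ((traj P f x₁ ξ ω N).V P) ∂μ := by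
  have hη := hP.η_pos
  have hm : 0 < max β 1 := lt_max_of_lt_right one_pos
  have hκ := C78_pos (G := G) (β := β) hP hlam
  have hc : 0 < lam / (P.η * max β 1) := by positivity
  have hcoef := second_order_coeff_le (G := G) hP hlam hβ
  have hEW := h.integral_sum_err_le hβ hP hs x₁ N
  have hW := EssBdd.sum (Finset.range (N + 1)) fun i => h.essBdd_err_div_V hβ hs P x₁ i
  have hY := EssBdd.sum (Finset.range (N + 1)) fun i => h.essBdd_stepSq hP hs x₁ i
  have hZ := EssBdd.sum (Finset.range (N + 1)) fun i => h.essBdd_step hP hs x₁ i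
  have hL := h.essBdd_log_V hs P x₁ N
  have hY0 : 0 ≤ ∫ ω, ∑ n ∈ Finset.range (N + 1), (traj P f x₁ ξ ω n).stepSq P ∂μ := by
    refine integral_nonneg fun ω => Finset.sum_nonneg fun n _ => ?_
    have := zero_le_one.trans (one_le_run_V (P := P) (g := stochGrad f) (x₁ := x₁)
      (z := fun k => ξ k ω) n)
    rw [State.stepSq]; positivity
  have hEZ := integral_mono (μ := μ) hZ.integrable
    (((EssBdd.const (gap D f x₁ / P.η)).add (hW.const_mul _)).add (hY.const_mul _)).integrable
    (fun ω => h.sum_step_le hβ hP hc x₁ (fun k => ξ k ω) (N + 1))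
  rw [integral_add ((EssBdd.const _).add (hW.const_mul _)).integrable (hY.const_mul _).integrable,
    integral_add (EssBdd.const _).integrable (hW.const_mul _).integrable, integral_const_mul,
    integral_const_mul] at hEZ
  simp only [integral_const, probReal_univ, one_smul] at hEZ
  have hEY := integral_mono (μ := μ) (hY.const_mul (C78 P G β lam)).integrable
    (hZ.add ((hL.add (EssBdd.const
      (|Real.log (C78 P G β lam / P.b₀)| / P.p))).const_mul
        (C78 P G β lam ^ (1 / P.p - 1)))).integrable
    (fun ω => mul_sum_stepSq_le (P := P) (g := stochGrad f) (x₁ := x₁) (z := fun k => ξ k ω)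
      hP hκ N)
  rw [integral_const_mul, integral_add hZ.integrable ((hL.add (EssBdd.const _)).const_mul
    _).integrable, integral_const_mul, integral_add hL.integrable
      (EssBdd.const _).integrable] at hEY
  simp only [integral_const, probReal_univ, one_smul] at hEY
  have e1 : lam / (P.η * max β 1) / 2 * (12 * P.a₀ ^ 2) = C5 P β lam := by
    rw [C5_eq]; ring
  simp only [stepConst, stepSlope, errBoundConst, errBoundSlope]
  generalize ∫ ω, ∑ n ∈ Finset.range (N + 1), (traj P f x₁ ξ ω n).step P ∂μ = Z at *
  generalize ∫ ω, ∑ n ∈ Finset.range (N + 1), (traj P f x₁ ξ ω n).stepSq P ∂μ = Y at *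
  generalize ∫ ω, ∑ n ∈ Finset.range (N + 1),
    (traj P f x₁ ξ ω n).err D f / (traj P f x₁ ξ ω n).V P ∂μ = W at *
  generalize ∫ ω, Real.log ((traj P f x₁ ξ ω N).V P) ∂μ = L at *
  generalize |Real.log (C78 P G β lam / P.b₀)| / P.p = cl at *
  generalize C78 P G β lam ^ (1 / P.p - 1) = ks at *
  generalize C78 P G β lam = κ at *
  generalize lam / (P.η * max β 1) = c at *
  generalize C5 P β lam = c5 at *
  generalize errConst P G = w at *
  generalize gap D f x₁ / P.η = Δ at *
  have h1 : c / 2 * W ≤ c / 2 * (w + 12 * P.a₀ ^ 2 * L + 4 * β ^ 2 * P.η ^ 2 * Y) := by gcongr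
  have h2 := mul_le_mul_of_nonneg_right hcoef hY0
  have h3 : c / 2 * (w + 12 * P.a₀ ^ 2 * L + 4 * β ^ 2 * P.η ^ 2 * Y)
      = c / 2 * w + c5 * L + c / 2 * (4 * β ^ 2 * P.η ^ 2) * Y := by rw [← e1]; ring
  have hZ' : Z ≤ 2 * Δ + c * w + ks * cl + (2 * c5 + ks) * L := by linarith
  refine ⟨hZ', ?_⟩
  have hY' : Y ≤ ((2 * Δ + c * w + ks * cl + ks * cl) + (2 * c5 + ks + ks) * L) / κ := by
    rw [le_div_iff₀ hκ]; linarith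
  have h4 : 4 * β ^ 2 * P.η ^ 2 * Y ≤ 4 * β ^ 2 * P.η ^ 2
      * (((2 * Δ + c * w + ks * cl + ks * cl) + (2 * c5 + ks + ks) * L) / κ) := by gcongr
  have e2 : 4 * β ^ 2 * P.η ^ 2
      * (((2 * Δ + c * w + ks * cl + ks * cl) + (2 * c5 + ks + ks) * L) / κ)
      = 4 * β ^ 2 * P.η ^ 2 * ((2 * Δ + c * w + ks * cl + ks * cl) / κ)
        + 4 * β ^ 2 * P.η ^ 2 * ((2 * c5 + ks + ks) / κ) * L := by ring
  linarith

/-- The number `y` is 𝔼[V^(3p̂)]. Hölder's inequality separates V^p̂ from the sums, and Jensen's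
inequality for the logarithm turns 𝔼 log V into log y/(3p̂), so that `y` is the only unknown besides
`h`. -/
theorem Assumptions.integral_H_rpow_le (h : Assumptions D f σ G β) (hβ : 0 ≤ β)
    (hP : P.Valid) (hlam : 0 < lam) (hs : IsSampling D μ ξ) (x₁ : Space d) (N : ℕ) :
    ∃ y : ℝ, 1 ≤ y ∧
      y ≤ 1 + (noise P σ (N + 1)
        + 2 * ∫ ω, H P D f x₁ (fun n => ξ n ω) (N + 1) ^ P.ph ∂μ) / P.a₀ ^ (2 * P.ph) ∧
      ∫ ω, H P D f x₁ (fun n => ξ n ω) (N + 1) ^ P.ph ∂μ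
        ≤ 2 ^ P.ph * (y ^ (1 / 3 : ℝ) *
          ((P.b₀ ^ (1 / P.p - 1) + stepConst P G β (gap D f x₁) lam
              + stepSlope P G β lam * (Real.log y / (3 * P.ph))) ^ (2 / 3 : ℝ)
            + (errBoundConst P G β (gap D f x₁) lam
              + errBoundSlope P G β lam * (Real.log y / (3 * P.ph))) ^ P.ph)) := by
  have hph := hP.ph_pos
  have hph1 := hP.ph_le_half
  have hb0 := hP.b₀_pos
  have ha := hP.a₀_pos
  have hV1 : ∀ ω n, 1 ≤ (traj P f x₁ ξ ω n).V P := fun ω n => one_le_run_V n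
  have hW := EssBdd.sum (Finset.range (N + 1)) fun i => h.essBdd_err_div_V hβ hs P x₁ i
  have hZ := EssBdd.sum (Finset.range (N + 1)) fun i => h.essBdd_step hP hs x₁ i
  have hZb := (EssBdd.const (μ := μ) (P.b₀ ^ (1 / P.p - 1))).add hZ
  have hVr := (h.essBdd_V hs P x₁ N).rpow (r := 3 * P.ph) (by positivity)
  have hHr := (h.essBdd_H hβ hs P x₁ (N + 1)).rpow hph.le
  have hVr1 : ∀ ω, 1 ≤ (traj P f x₁ ξ ω N).V P ^ (3 * P.ph) := fun ω =>
    Real.one_le_rpow (hV1 ω N) (by positivity)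
  have hW0 : ∀ ω, 0 ≤ ∑ n ∈ Finset.range (N + 1),
      (traj P f x₁ ξ ω n).err D f / (traj P f x₁ ξ ω n).V P := fun ω =>
    Finset.sum_nonneg fun n _ => div_nonneg (sq_nonneg _) (zero_le_one.trans (hV1 ω n))
  have hZ0 : ∀ ω, 0 ≤ P.b₀ ^ (1 / P.p - 1)
      + ∑ n ∈ Finset.range (N + 1), (traj P f x₁ ξ ω n).step P := fun ω => by
    refine add_nonneg (Real.rpow_nonneg hb0.le _) (Finset.sum_nonneg fun n _ => ?_)
    have := hb0.le.trans (State.b₀_le_b hP (run_gradSum_nonneg (P := P) (g := stochGrad f)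
      (x₁ := x₁) (z := fun k => ξ k ω) n) (run_dirSum_nonneg n))
    rw [State.step]; positivity
  obtain ⟨hEZ, hEW⟩ := h.integral_sum_le (lam := lam) hβ hP hlam hs x₁ N
  have hy1 : 1 ≤ ∫ ω, (traj P f x₁ ξ ω N).V P ^ (3 * P.ph) ∂μ := by
    simpa using integral_mono (EssBdd.const (μ := μ) 1).integrable hVr.integrable hVr1
  have hL : ∫ ω, Real.log ((traj P f x₁ ξ ω N).V P) ∂μ
      ≤ Real.log (∫ ω, (traj P f x₁ ξ ω N).V P ^ (3 * P.ph) ∂μ) / (3 * P.ph) := by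
    have h1 := integral_log_le_log_integral hVr hVr1
    have e : ∀ ω, Real.log ((traj P f x₁ ξ ω N).V P ^ (3 * P.ph))
        = 3 * P.ph * Real.log ((traj P f x₁ ξ ω N).V P) := fun ω =>
      Real.log_rpow (zero_lt_one.trans_le (hV1 ω N)) _
    simp_rw [e] at h1
    rw [integral_const_mul] at h1
    rw [le_div_iff₀ (by positivity)]
    linarith
  refine ⟨∫ ω, (traj P f x₁ ξ ω N).V P ^ (3 * P.ph) ∂μ, hy1, ?_, ?_⟩
  · have hS := EssBdd.sum (Finset.range (N + 1)) fun i => h.essBdd_noise hβ hs P x₁ i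
    have hSr := (hS.const_mul 2).rpow hph.le
    have h1 := integral_mono (μ := μ) hVr.integrable ((EssBdd.const 1).add
      ((hSr.add (hHr.const_mul 2)).const_mul (1 / P.a₀ ^ (2 * P.ph)))).integrable
      (fun ω => V_rpow_le (D := D) (f := f) hP x₁ (fun k => ξ k ω) N)
    rw [integral_add (EssBdd.const 1).integrable ((hSr.add (hHr.const_mul 2)).const_mul
      _).integrable, integral_const_mul, integral_add hSr.integrable
        (hHr.const_mul 2).integrable, integral_const_mul] at h1
    simp only [integral_const, probReal_univ, one_smul] at h1
    have h2 : ∫ ω, (2 * ∑ n ∈ Finset.range (N + 1),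
        ‖stochGrad f (traj P f x₁ ξ ω n).x (ξ n ω)
          - gradient (objective D f) (traj P f x₁ ξ ω n).x‖ ^ 2) ^ P.ph ∂μ
        ≤ noise P σ (N + 1) := by
      have h0 : ∀ ω, 0 ≤ 2 * ∑ n ∈ Finset.range (N + 1),
        ‖stochGrad f (traj P f x₁ ξ ω n).x (ξ n ω)
          - gradient (objective D f) (traj P f x₁ ξ ω n).x‖ ^ 2 := fun ω => by positivity
      refine (integral_rpow_le_rpow_integral hph.le (by linarith) (hS.const_mul 2)
        (Filter.Eventually.of_forall h0)).trans ?_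
      rw [noise]
      refine Real.rpow_le_rpow (integral_nonneg h0) ?_ hph.le
      rw [integral_const_mul, integral_finsetSum _ fun i _ =>
        (h.essBdd_noise hβ hs P x₁ i).integrable]
      have := Finset.sum_le_card_nsmul (Finset.range (N + 1)) _ (σ ^ 2)
        fun n _ => h.integral_noise_le (P := P) hβ hs x₁ n
      rw [Finset.card_range, nsmul_eq_mul] at this
      linarith
    refine h1.trans ?_
    rw [one_div_mul_eq_div]
    gcongr
  · have h1 := integral_mul_rpow_le hVr hZb
      (Filter.Eventually.of_forall fun ω => zero_le_one.trans (hVr1 ω))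
      (Filter.Eventually.of_forall hZ0)
    have hWr := hW.rpow (r := 3 * P.ph / 2) (by positivity)
    have h2 := integral_mul_rpow_le hVr hWr
      (Filter.Eventually.of_forall fun ω => zero_le_one.trans (hVr1 ω))
      (Filter.Eventually.of_forall fun ω => Real.rpow_nonneg (hW0 ω) _)
    have hA := (hVr.rpow (r := 1 / 3) (by norm_num)).mul (hZb.rpow (r := 2 / 3) (by norm_num))
    have hB := (hVr.rpow (r := 1 / 3) (by norm_num)).mul (hWr.rpow (r := 2 / 3) (by norm_num))
    have h3 := integral_mono (μ := μ) hHr.integrable ((hA.add hB).const_mul (2 ^ P.ph)).integrable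
      (fun ω => H_rpow_le (D := D) (f := f) hP x₁ (fun k => ξ k ω) N)
    rw [integral_const_mul, integral_add hA.integrable hB.integrable] at h3
    refine h3.trans ?_
    rw [mul_add (_ ^ (1 / 3 : ℝ))]
    have hy0 := zero_le_one.trans hy1
    have hZi : 0 ≤ ∫ ω, (P.b₀ ^ (1 / P.p - 1)
      + ∑ n ∈ Finset.range (N + 1), (traj P f x₁ ξ ω n).step P) ∂μ := integral_nonneg hZ0
    have hWi : 0 ≤ ∫ ω, ∑ n ∈ Finset.range (N + 1),
        (traj P f x₁ ξ ω n).err D f / (traj P f x₁ ξ ω n).V P ∂μ := integral_nonneg hW0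
    have hss := stepSlope_pos (G := G) (β := β) hP hlam
    have hes := errBoundSlope_nonneg (G := G) (β := β) hP hlam
    gcongr
    · refine h1.trans ?_
      refine mul_le_mul_of_nonneg_left (Real.rpow_le_rpow hZi ?_ (by norm_num))
        (Real.rpow_nonneg hy0 _)
      rw [integral_add (EssBdd.const _).integrable hZ.integrable]
      simp only [integral_const, probReal_univ, one_smul]
      have := mul_le_mul_of_nonneg_left hL hss.le
      linarith
    · refine h2.trans ?_
      refine mul_le_mul_of_nonneg_left ?_ (Real.rpow_nonneg hy0 _)
      -- 3p̂/2 = 1 - p is at most 1, so Jensen's inequality reduces this moment of `W` to 𝔼W.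
      have h4 := integral_rpow_le_rpow_integral (r := 3 * P.ph / 2) (by positivity)
        (by linarith) hW (Filter.Eventually.of_forall hW0)
      refine (Real.rpow_le_rpow (integral_nonneg fun ω => Real.rpow_nonneg (hW0 ω) _) h4
        (by norm_num)).trans ?_
      rw [← Real.rpow_mul hWi]
      have e3 : 3 * P.ph / 2 * (2 / 3) = P.ph := by ring
      rw [e3]
      refine Real.rpow_le_rpow hWi ?_ hph.le
      have := mul_le_mul_of_nonneg_left hL hes
      linarith

end

/-! ### Solving the recursive inequality -/

theorem rpow_add_rpow_le_add_rpow {x y r : ℝ} (hx : 0 ≤ x) (hy : 0 ≤ y) (hr : 1 ≤ r) :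
    x ^ r + y ^ r ≤ (x + y) ^ r := by
  lift x to NNReal using hx
  lift y to NNReal using hy
  exact_mod_cast NNReal.add_rpow_le_rpow_add x y hr

/-- Since log y ≤ 2√y, the hypothesis gives h ≤ const·y^(1/3)(√y)^(2/3) = const·y^(2/3); with `y` of
order `h` this reads h³ ≤ const·h². -/
theorem exists_bound_of_self_bounding {r A₀ A₁ E₀ E₁ k : ℝ} (hr : 1 / 3 ≤ r) (hr2 : r ≤ 1 / 2)
    (hA₀ : 0 ≤ A₀) (hA₁ : 0 ≤ A₁) (hE₀ : 0 ≤ E₀) (hE₁ : 0 ≤ E₁) (hk : 0 ≤ k) :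
    ∃ M : ℝ, 0 ≤ M ∧ ∀ h y : ℝ, 1 ≤ y → y ≤ 1 + 4 * h * k →
      h ≤ 2 ^ r * (y ^ (1 / 3 : ℝ) * ((A₀ + A₁ * (Real.log y / (3 * r))) ^ (2 / 3 : ℝ)
        + (E₀ + E₁ * (Real.log y / (3 * r))) ^ r)) → h ≤ M := by
  set C := 1 + A₀ + E₀ + 2 * (A₁ + E₁) with hC
  have hC1 : 1 ≤ C := by linarith
  refine ⟨(4 * C) ^ 3 * (1 + 4 * k) ^ 2 + 1, by positivity, fun h y hy hyh hh => ?_⟩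
  -- For h ≤ 1 the summand 1 in the bound suffices; for h > 1 the constant in y ≤ 1 + 4hk is
  -- absorbed into a multiple of `h`.
  rcases le_or_gt h 1 with h1 | h1
  · have : 0 ≤ (4 * C) ^ 3 * (1 + 4 * k) ^ 2 := by positivity
    linarith
  have hy0 : 0 < y := by linarith
  have hs1 : 1 ≤ √y := Real.one_le_sqrt.2 hy
  have hlog : Real.log y / (3 * r) ≤ 2 * √y := by
    have h2 : Real.log y ≤ 2 * √y := by
      have := Real.log_le_sub_one_of_pos (Real.sqrt_pos.2 hy0)
      rw [Real.log_sqrt hy0.le] at this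
      linarith
    exact (div_le_self (Real.log_nonneg hy) (by linarith)).trans h2
  have hlog0 : 0 ≤ Real.log y / (3 * r) := div_nonneg (Real.log_nonneg hy) (by linarith)
  have hbase : 1 ≤ C * √y := by nlinarith
  have hA : A₀ + A₁ * (Real.log y / (3 * r)) ≤ C * √y := by
    have := mul_le_mul_of_nonneg_left hlog hA₁
    nlinarith
  have hE : E₀ + E₁ * (Real.log y / (3 * r)) ≤ C * √y := by
    have := mul_le_mul_of_nonneg_left hlog hE₁
    nlinarith
  have hA' : (A₀ + A₁ * (Real.log y / (3 * r))) ^ (2 / 3 : ℝ) ≤ (C * √y) ^ (2 / 3 : ℝ) :=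
    Real.rpow_le_rpow (by positivity) hA (by norm_num)
  have hE' : (E₀ + E₁ * (Real.log y / (3 * r))) ^ r ≤ (C * √y) ^ (2 / 3 : ℝ) :=
    (Real.rpow_le_rpow (by positivity) hE (by linarith)).trans
      (Real.rpow_le_rpow_of_exponent_le hbase (by linarith))
  have h2r : (2 : ℝ) ^ r ≤ 2 := by
    simpa using Real.rpow_le_rpow_of_exponent_le (x := 2) (by norm_num)
      (show r ≤ 1 by linarith)
  have hfin : h ≤ 4 * (y ^ (1 / 3 : ℝ) * (C * √y) ^ (2 / 3 : ℝ)) := by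
    refine hh.trans ?_
    have hyr : 0 ≤ y ^ (1 / 3 : ℝ) := by positivity
    calc _ ≤ 2 * (y ^ (1 / 3 : ℝ) * ((C * √y) ^ (2 / 3 : ℝ) + (C * √y) ^ (2 / 3 : ℝ))) := by
          gcongr
      _ = _ := by ring
  have hcube : h ^ 3 ≤ (4 * C) ^ 3 * y ^ 2 := by
    have h3 := pow_le_pow_left₀ (by linarith) hfin 3
    have e1 : (y ^ (1 / 3 : ℝ)) ^ 3 = y := by
      rw [← Real.rpow_natCast, ← Real.rpow_mul hy0.le]; norm_num
    have e2 : ((C * √y) ^ (2 / 3 : ℝ)) ^ 3 = C ^ 2 * y := by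
      rw [← Real.rpow_natCast, ← Real.rpow_mul (by positivity)]
      norm_num
      rw [mul_pow, Real.sq_sqrt hy0.le]
    rw [mul_pow, mul_pow, e1, e2] at h3
    have : C ^ 2 ≤ C ^ 3 := pow_le_pow_right₀ hC1 (by norm_num)
    nlinarith [mul_le_mul_of_nonneg_right this (sq_nonneg y)]
  have hyh' : y ≤ (1 + 4 * k) * h := by nlinarith
  have h4 : y ^ 2 ≤ ((1 + 4 * k) * h) ^ 2 := pow_le_pow_left₀ hy0.le hyh' 2
  have h5 : h * h ^ 2 ≤ ((4 * C) ^ 3 * (1 + 4 * k) ^ 2) * h ^ 2 := by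
    calc h * h ^ 2 = h ^ 3 := by ring
      _ ≤ (4 * C) ^ 3 * y ^ 2 := hcube
      _ ≤ (4 * C) ^ 3 * ((1 + 4 * k) * h) ^ 2 := by gcongr
      _ = _ := by ring
  have := le_of_mul_le_mul_right h5 (by positivity)
  linarith

/-- For large `L` the intercept A₀ is at most B·L, so the first base is at most 2(K₀ + BL). The
other power has exponent at most 1/2 < 2/3, and its constants are swallowed by this gap. The factor
4 suffices because √2(2^(2/3) + 1) < 4. -/
theorem exists_forall_ge_le_mul_rpow {r A₀ A₁ E₀ E₁ K₀ B : ℝ} (hr : 0 ≤ r) (hr2 : r ≤ 1 / 2)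
    (hA₀ : 0 ≤ A₀) (hA₁ : 0 ≤ A₁) (hE₀ : 0 ≤ E₀) (hE₁ : 0 ≤ E₁) (hK₀ : 0 ≤ K₀) (hB : 0 < B)
    (hAB : A₁ ≤ B) :
    ∃ L₀ : ℝ, 0 ≤ L₀ ∧ ∀ L l : ℝ, L₀ ≤ L → 0 ≤ l → l ≤ L →
      2 ^ r * ((A₀ + A₁ * l) ^ (2 / 3 : ℝ) + (E₀ + E₁ * l) ^ r)
          ≤ 4 * (K₀ + B * L) ^ (2 / 3 : ℝ) ∧ K₀ ≤ B * L := by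
  set m := E₀ + E₁ / B with hm
  have hm0 : 0 ≤ m := by positivity
  -- The summand m³ gives m ≤ t^(1/3) for t = K₀ + BL, hence mt ≤ t^(4/3), whose power r ≤ 1/2 is at
  -- most t^(2/3).
  refine ⟨(1 + A₀ + K₀ + m ^ 3) / B, by positivity, fun L l hL hl hlL => ?_⟩
  have hBL : 1 + A₀ + K₀ + m ^ 3 ≤ B * L := by
    rw [div_le_iff₀ hB] at hL; linarith
  have hm3 : 0 ≤ m ^ 3 := by positivity
  refine ⟨?_, by linarith⟩
  set t := K₀ + B * L with ht
  have ht1 : 1 ≤ t := by linarith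
  have ht0 : 0 < t := by linarith
  have hL0 : 0 ≤ L := hl.trans hlL
  have hA : A₀ + A₁ * l ≤ 2 * t := by
    have : A₁ * l ≤ B * L := mul_le_mul hAB hlL hl hB.le
    linarith
  have hA' : (A₀ + A₁ * l) ^ (2 / 3 : ℝ) ≤ 1.6 * t ^ (2 / 3 : ℝ) := by
    refine (Real.rpow_le_rpow (by positivity) hA (by norm_num)).trans ?_
    rw [Real.mul_rpow (by norm_num) ht0.le]
    have h2 : (2 : ℝ) ^ (2 / 3 : ℝ) ≤ 1.6 := by
      have h3 : ((2 : ℝ) ^ (2 / 3 : ℝ)) ^ 3 ≤ 1.6 ^ 3 := by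
        rw [← Real.rpow_natCast, ← Real.rpow_mul (by norm_num)]; norm_num
      exact le_of_pow_le_pow_left₀ (by norm_num) (by norm_num) h3
    gcongr
  have hE : E₀ + E₁ * l ≤ t ^ (4 / 3 : ℝ) := by
    have h1 : E₀ + E₁ * l ≤ m * t := by
      have h2 : E₁ * l ≤ E₁ / B * t := by
        calc E₁ * l ≤ E₁ * L := by gcongr
          _ = E₁ / B * (B * L) := by field_simp
          _ ≤ E₁ / B * t := by gcongr; linarith
      nlinarith
    have h2 : m ≤ t ^ (1 / 3 : ℝ) := by
      have h3 : (m ^ 3) ^ (1 / 3 : ℝ) ≤ t ^ (1 / 3 : ℝ) :=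
        Real.rpow_le_rpow hm3 (by linarith) (by norm_num)
      rw [← Real.rpow_natCast, ← Real.rpow_mul hm0] at h3
      norm_num at h3 ⊢
      exact h3
    calc E₀ + E₁ * l ≤ m * t := h1
      _ ≤ t ^ (1 / 3 : ℝ) * t := by gcongr
      _ = t ^ (4 / 3 : ℝ) := by
          nth_rewrite 2 [← Real.rpow_one t]
          rw [← Real.rpow_add ht0]; norm_num
  have hE' : (E₀ + E₁ * l) ^ r ≤ t ^ (2 / 3 : ℝ) := by
    refine (Real.rpow_le_rpow (by positivity) hE hr).trans ?_
    rw [← Real.rpow_mul ht0.le]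
    exact Real.rpow_le_rpow_of_exponent_le ht1 (by linarith)
  have h2r : (2 : ℝ) ^ r ≤ 1.5 := by
    refine (Real.rpow_le_rpow_of_exponent_le (by norm_num) hr2).trans ?_
    rw [← Real.sqrt_eq_rpow, Real.sqrt_le_left (by norm_num)]; norm_num
  have htr : 0 ≤ t ^ (2 / 3 : ℝ) := by positivity
  have h2r0 : 0 ≤ (2 : ℝ) ^ r := by positivity
  calc _ ≤ (1.5 : ℝ) * (1.6 * t ^ (2 / 3 : ℝ) + t ^ (2 / 3 : ℝ)) := by gcongr
    _ ≤ _ := by linarith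

/-! ### Signs and sizes of the constants -/

section

variable {P : Params} {σ G β Δ lam : ℝ}

theorem C0_pos (hP : P.Valid) (hG : 0 ≤ G) : 0 < C0 P G := by
  rw [C0]
  split_ifs with h
  · exact one_pos
  · have := lt_of_le_of_ne hG (Ne.symm h)
    have := hP.a₀_pos
    positivity

theorem C1of_nonneg (hP : P.Valid) (hG : 0 ≤ G) (l : ℝ) : 0 ≤ C1of P σ G l := by
  have := C0_pos hP hG
  rw [C1of]
  positivity

theorem C2of_nonneg (l : ℝ) : 0 ≤ C2of P l := by
  rw [C2of]
  split_ifs with h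
  · have : 0 < 4 * l - 1 := by linarith
    positivity
  · positivity

theorem C3_nonneg (hP : P.Valid) (hG : 0 ≤ G) : 0 ≤ C3 P G β := by
  have := C0_pos hP hG
  rw [C3]
  split_ifs with h
  · have : 0 < 4 * P.q - 1 := by linarith
    positivity
  · positivity

theorem noise_nonneg (T : ℕ) : 0 ≤ noise P σ T := by
  rw [noise]; positivity

theorem one_le_growth_base (hP : P.Valid) (T : ℕ) :
    1 ≤ 1 + 2 * noise P σ T / P.a₀ ^ (2 * P.ph) := by
  have := noise_nonneg (P := P) (σ := σ) T
  have := hP.a₀_pos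
  have : 0 ≤ 2 * noise P σ T / P.a₀ ^ (2 * P.ph) := by positivity
  linarith

theorem growth_nonneg (hP : P.Valid) (T : ℕ) : 0 ≤ growth P σ T :=
  Real.rpow_nonneg (zero_le_one.trans (one_le_growth_base hP T)) _

theorem caseTerm_nonneg (hP : P.Valid) (hG : 0 ≤ G) (T : ℕ) : 0 ≤ caseTerm P σ G β T := by
  have h1 : 0 ≤ C1 P σ G := C1of_nonneg hP hG _
  have h2 : 0 ≤ C2 P := C2of_nonneg _
  have h3 : 0 ≤ C3 P G β := C3_nonneg hP hG
  have h4 := growth_nonneg (σ := σ) hP T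
  have h5 := noise_nonneg (P := P) (σ := σ) T
  have h6 := hP.ph_pos
  have h7 := hP.a₀_pos
  have h8 := hP.b₀_pos
  rw [caseTerm]
  split_ifs
  · have : 0 ≤ Real.log (1 + noise P σ T
        / min (P.a₀ ^ (2 * P.ph) / 2) (4 * P.b₀ ^ (2 * P.ph))) := by
      refine Real.log_nonneg (le_add_of_nonneg_right (div_nonneg h5 ?_))
      exact le_min (by positivity) (by positivity)
    positivity
  · positivity

theorem one_le_one_div_p_sub_one (hP : P.Valid) : 1 ≤ 1 / P.p - 1 := by
  have hp := hP.p_pos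
  have : 2 ≤ 1 / P.p := by
    rw [le_div_iff₀ hp]; linarith [hP.p_le]
  linarith

/-- The part of the bracket in `gapTerm` that does not depend on `T`. -/
noncomputable def gapConst (P : Params) (σ G β Δ lam : ℝ) : ℝ :=
  C4 P σ G β Δ lam
    + C6 P G β lam * Real.log ((2 * C7 P G β lam + 2 * C8 P β lam) / P.b₀)

/-- The logarithm in `gapTerm`. -/
noncomputable def logTerm (P : Params) (σ : ℝ) (T : ℕ) : ℝ :=
  Real.log ((P.a₀ ^ (2 / 3 : ℝ) + 2 * (2 * σ ^ 2 * T) ^ (1 / 3 : ℝ)) / P.a₀ ^ (2 / 3 : ℝ))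

theorem ph_div (hP : P.Valid) : P.ph / (1 - P.p) = 2 / 3 := by
  have : 0 < 1 - P.p := by linarith [hP.p_le]
  rw [Params.ph]; field_simp

theorem gapTerm_eq (hP : P.Valid) (T : ℕ) :
    gapTerm P σ G β Δ lam T = (gapConst P σ G β Δ lam
      + (3 * C5 P β lam + C6 P G β lam) * logTerm P σ T) ^ (2 / 3 : ℝ) * growth P σ T := by
  rw [gapTerm, ph_div hP, gapConst, logTerm]
  ring_nf

theorem C6_eq : C6 P G β lam = C78 P G β lam ^ (1 / P.p - 1) / (1 - P.p) := rfl

theorem C6_pos (hP : P.Valid) (hlam : 0 < lam) : 0 < C6 P G β lam := by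
  have h1 := C78_pos (G := G) (β := β) hP hlam
  have : 0 < 1 - P.p := by linarith [hP.p_le]
  rw [C6_eq]
  positivity

/-- The logarithm of (2C₇ + 2C₈)/b₀ can be negative. With s = 1/p - 1 and ρ = b₀/(2κ), s·log ρ ≤ ρ^s
and κ^s ρ^s = b₀^s 2^(-s); since 2^(-s) ≤ 1/2 ≤ (1-p)s, the loss is at most b₀^s, a summand of C₄.
-/
theorem gapConst_nonneg (hP : P.Valid) (hlam : 0 < lam) (hG : 0 ≤ G) (hΔ : 0 ≤ Δ) :
    0 ≤ gapConst P σ G β Δ lam := by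
  have hκ := C78_pos (G := G) (β := β) hP hlam
  have hp := hP.p_pos
  have hp1 : 0 < 1 - P.p := by linarith [hP.p_le]
  have hb := hP.b₀_pos
  have hη := hP.η_pos
  have hm : 0 < max β 1 := lt_max_of_lt_right one_pos
  have hs := one_le_one_div_p_sub_one hP
  set s := 1 / P.p - 1 with hsdef
  have hs0 : 0 < s := by linarith
  have h4 : P.b₀ ^ s ≤ C4 P σ G β Δ lam := by
    have := C1of_nonneg (σ := σ) hP hG (1 / 4)
    have h1 : 0 ≤ 2 / P.η * Δ := by positivity
    have h2 : 0 ≤ lam * C1of P σ G (1 / 4) / (P.η * max β 1) := by positivity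
    rw [C4]
    linarith
  have e : (2 * C7 P G β lam + 2 * C8 P β lam) / P.b₀ = (P.b₀ / (2 * C78 P G β lam))⁻¹ := by
    rw [inv_div, C78]; ring
  rw [gapConst, e, Real.log_inv, C6_eq, ← hsdef]
  generalize C78 P G β lam = κ at *
  have hr : 0 < P.b₀ / (2 * κ) := by positivity
  have h5 : s * Real.log (P.b₀ / (2 * κ)) ≤ (P.b₀ / (2 * κ)) ^ s := by
    rw [← Real.log_rpow hr]
    have := Real.log_le_sub_one_of_pos (Real.rpow_pos_of_pos hr s)
    linarith
  have h6 : κ ^ s * (P.b₀ / (2 * κ)) ^ s = P.b₀ ^ s * (1 / 2) ^ s := by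
    rw [← Real.mul_rpow hκ.le hr.le, ← Real.mul_rpow hb.le (by norm_num)]
    congr 1; field_simp
  have h7 : (1 / 2 : ℝ) ^ s ≤ 1 / 2 := by
    simpa using Real.rpow_le_rpow_of_exponent_ge (x := 1 / 2) (by norm_num) (by norm_num) hs
  have h8 : 1 / 2 ≤ (1 - P.p) * s := by
    have : (1 - P.p) * s = (1 - P.p) ^ 2 / P.p := by rw [hsdef]; field_simp
    rw [this, le_div_iff₀ hp]
    nlinarith [hP.p_le]
  have hbs : 0 < P.b₀ ^ s := Real.rpow_pos_of_pos hb s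
  have hκs : 0 < κ ^ s := Real.rpow_pos_of_pos hκ s
  have h9 : κ ^ s / (1 - P.p) * Real.log (P.b₀ / (2 * κ)) ≤ P.b₀ ^ s := by
    have h10 : κ ^ s * (s * Real.log (P.b₀ / (2 * κ))) ≤ P.b₀ ^ s * (1 / 2) := by
      calc _ ≤ κ ^ s * (P.b₀ / (2 * κ)) ^ s := by gcongr
        _ = P.b₀ ^ s * (1 / 2) ^ s := h6
        _ ≤ _ := by gcongr
    have h11 : κ ^ s * (s * Real.log (P.b₀ / (2 * κ))) ≤ P.b₀ ^ s * ((1 - P.p) * s) :=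
      h10.trans (by gcongr)
    rw [div_mul_eq_mul_div, div_le_iff₀ hp1]
    nlinarith
  linarith

theorem logTerm_eq (hP : P.Valid) (T : ℕ) :
    logTerm P σ T
      = Real.log (1 + 2 * (2 * σ ^ 2 * T) ^ (1 / 3 : ℝ) / P.a₀ ^ (2 / 3 : ℝ)) := by
  have := Real.rpow_pos_of_pos hP.a₀_pos (2 / 3)
  rw [logTerm]
  congr 1
  field_simp

theorem logTerm_nonneg (hP : P.Valid) (T : ℕ) : 0 ≤ logTerm P σ T := by
  have := hP.a₀_pos
  rw [logTerm_eq hP]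
  refine Real.log_nonneg (le_add_of_nonneg_right ?_)
  positivity

theorem gapTerm_nonneg (hP : P.Valid) (hlam : 0 < lam) (hG : 0 ≤ G) (hΔ : 0 ≤ Δ) (T : ℕ) :
    0 ≤ gapTerm P σ G β Δ lam T := by
  have h1 := gapConst_nonneg (σ := σ) (β := β) hP hlam hG hΔ
  have h2 := logTerm_nonneg (σ := σ) hP T
  have h3 := C5_pos (β := β) hP hlam
  have h4 := C6_pos (G := G) (β := β) hP hlam
  have h5 := growth_nonneg (σ := σ) hP T
  rw [gapTerm_eq hP]
  positivity

/-- Since 3p̂ ≥ 1, superadditivity of the power gives 1 + 2x^(3p̂) ≤ (1 + 2x)^(3p̂), with x =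
(2σ²T)^(1/3)/a₀^(2/3). -/
theorem log_growth_base_le (hP : P.Valid) (T : ℕ) :
    Real.log (1 + 2 * noise P σ T / P.a₀ ^ (2 * P.ph)) / (3 * P.ph) ≤ logTerm P σ T := by
  have ha := hP.a₀_pos
  have hph := hP.third_le_ph
  have hph0 := hP.ph_pos
  have hv : 0 ≤ 2 * σ ^ 2 * (T : ℝ) := by positivity
  rw [logTerm_eq hP, noise, div_le_iff₀ (by positivity),
    mul_comm (Real.log _) (3 * P.ph), ← Real.log_rpow (by positivity)]
  refine Real.log_le_log (by positivity) ?_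
  generalize 2 * σ ^ 2 * (T : ℝ) = v at *
  set x := v ^ (1 / 3 : ℝ) / P.a₀ ^ (2 / 3 : ℝ) with hx
  have hx0 : 0 ≤ x := by positivity
  have e1 : x ^ (3 * P.ph) = v ^ P.ph / P.a₀ ^ (2 * P.ph) := by
    rw [hx, Real.div_rpow (by positivity) (by positivity), ← Real.rpow_mul hv,
      ← Real.rpow_mul ha.le]
    ring_nf
  rw [mul_div_assoc, mul_div_assoc, ← hx, ← e1]
  have h1 := rpow_add_rpow_le_add_rpow zero_le_one
    (show 0 ≤ 2 * x by positivity) (show 1 ≤ 3 * P.ph by linarith)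
  rw [Real.one_rpow, Real.mul_rpow (by norm_num) hx0] at h1
  refine le_trans ?_ h1
  have h2 : (2 : ℝ) ≤ 2 ^ (3 * P.ph) := by
    simpa using Real.rpow_le_rpow_of_exponent_le (x := 2) (by norm_num)
      (show 1 ≤ 3 * P.ph by linarith)
  gcongr

end

/-! ### Thresholds in the noise level -/

section

variable {P : Params} {σ G lam : ℝ}

/-- The recursive inequality for `h = 𝔼 [H_T^p̂]` is solved by a constant if the noise is small
compared to `h`, and by `gapTerm` if the noise is large. -/
theorem exists_thresholds (hP : P.Valid) (hG : 0 ≤ G) (hlam : 0 < lam) (σ β Δ : ℝ) :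
    ∃ M S₀ : ℝ, 0 ≤ M ∧ 0 ≤ S₀ ∧ (0 ≤ Δ → ∀ (T : ℕ) (h y : ℝ), 1 ≤ y →
      y ≤ 1 + (noise P σ T + 2 * h) / P.a₀ ^ (2 * P.ph) →
      h ≤ 2 ^ P.ph * (y ^ (1 / 3 : ℝ) *
          ((P.b₀ ^ (1 / P.p - 1) + stepConst P G β Δ lam
              + stepSlope P G β lam * (Real.log y / (3 * P.ph))) ^ (2 / 3 : ℝ)
            + (errBoundConst P G β Δ lam
              + errBoundSlope P G β lam * (Real.log y / (3 * P.ph))) ^ P.ph)) →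
      (noise P σ T < 2 * h → h ≤ M) ∧
      (2 * h ≤ noise P σ T → S₀ < noise P σ T → h ≤ 4 * gapTerm P σ G β Δ lam T) ∧
      (S₀ < noise P σ T → 1 ≤ σ ^ 2 * T ∧
        gapConst P σ G β Δ lam ≤ (3 * C5 P β lam + C6 P G β lam) * logTerm P σ T)) := by
  rcases lt_or_ge Δ 0 with hΔ | hΔ
  · exact ⟨0, 0, le_rfl, le_rfl, fun h => absurd h (not_le.2 hΔ)⟩
  have ha := hP.a₀_pos
  have hb := hP.b₀_pos
  have hph := hP.ph_pos
  have hA₀ : 0 ≤ P.b₀ ^ (1 / P.p - 1) + stepConst P G β Δ lam :=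
    add_nonneg (by positivity) (stepConst_nonneg hP hlam hΔ)
  have hA₁ := (stepSlope_pos (G := G) (β := β) hP hlam).le
  have hE₀ := errBoundConst_nonneg (G := G) (β := β) hP hlam hΔ
  have hE₁ := errBoundSlope_nonneg (G := G) (β := β) hP hlam
  have hC5 := C5_pos (β := β) hP hlam
  have hC6 := C6_pos (G := G) (β := β) hP hlam
  have hK₀ := gapConst_nonneg (σ := σ) (β := β) hP hlam hG hΔ
  have hκ := C78_pos (G := G) (β := β) hP hlam
  -- The slope 2C₅ + κ^(1/p-1) fits below 3C₅ + C₆ because C₆ divides the same power of κ by 1 - p <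
  -- 1. All other constants are left to the threshold.
  have hslope : stepSlope P G β lam ≤ 3 * C5 P β lam + C6 P G β lam := by
    have h1 : C78 P G β lam ^ (1 / P.p - 1) ≤ C6 P G β lam := by
      rw [C6_eq, le_div_iff₀ (by linarith [hP.p_le])]
      have := Real.rpow_pos_of_pos hκ (1 / P.p - 1)
      nlinarith [hP.p_pos]
    rw [stepSlope]
    linarith
  obtain ⟨M, hM0, hM⟩ := exists_bound_of_self_bounding hP.third_le_ph hP.ph_le_half hA₀ hA₁ hE₀ hE₁
    (show 0 ≤ 1 / P.a₀ ^ (2 * P.ph) by positivity)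
  obtain ⟨L₀, hL₀, hL⟩ := exists_forall_ge_le_mul_rpow hP.ph_pos.le hP.ph_le_half hA₀ hA₁ hE₀ hE₁
    hK₀ (show 0 < 3 * C5 P β lam + C6 P G β lam by positivity) hslope
  -- Above this threshold 2σ²T exceeds both entries of the maximum: 2 gives σ²T ≥ 1, and the cube
  -- makes the logarithm in the gap term at least L₀.
  refine ⟨M, (max 2 ((Real.exp L₀ * P.a₀ ^ (2 / 3 : ℝ)) ^ 3)) ^ P.ph, hM0, by positivity,
    fun _ T h y hy1 hyh hh => ?_⟩
  have hv : 0 ≤ 2 * σ ^ 2 * (T : ℝ) := by positivity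
  have hlarge : (max 2 ((Real.exp L₀ * P.a₀ ^ (2 / 3 : ℝ)) ^ 3)) ^ P.ph < noise P σ T →
      1 ≤ σ ^ 2 * T ∧ L₀ ≤ logTerm P σ T := by
    intro hS
    have hS' := (Real.rpow_lt_rpow_iff (by positivity) hv hph).1 hS
    have h2 := (le_max_left _ _).trans_lt hS'
    have h3 := (le_max_right _ _).trans_lt hS'
    refine ⟨by linarith, ?_⟩
    have hx : 0 < Real.exp L₀ * P.a₀ ^ (2 / 3 : ℝ) := by positivity
    have h4 := Real.rpow_le_rpow (by positivity) h3.le (show (0 : ℝ) ≤ 1 / 3 by norm_num)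
    rw [← Real.rpow_natCast, ← Real.rpow_mul hx.le] at h4
    norm_num at h4
    have hap : 0 < P.a₀ ^ (2 / 3 : ℝ) := by positivity
    rw [logTerm_eq hP, Real.le_log_iff_exp_le (by positivity)]
    have h5 : Real.exp L₀ ≤ (2 * σ ^ 2 * (T : ℝ)) ^ (1 / 3 : ℝ) / P.a₀ ^ (2 / 3 : ℝ) := by
      rw [le_div_iff₀ hap]
      norm_num
      exact h4
    rw [mul_div_assoc]
    linarith [Real.exp_pos L₀]
  have hly0 : 0 ≤ Real.log y / (3 * P.ph) := div_nonneg (Real.log_nonneg hy1) (by positivity)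
  refine ⟨fun hS => ?_, fun hS hS₀ => ?_, fun hS₀ => ?_⟩
  · refine hM h y hy1 (hyh.trans ?_) hh
    rw [div_eq_mul_one_div]
    gcongr
    linarith
  · obtain ⟨-, hL1⟩ := hlarge hS₀
    have hy2 : y ≤ 1 + 2 * noise P σ T / P.a₀ ^ (2 * P.ph) := by
      refine hyh.trans ?_
      gcongr
      linarith
    have hl : Real.log y / (3 * P.ph) ≤ logTerm P σ T := by
      refine le_trans ?_ (log_growth_base_le hP T)
      have : 0 < y := by linarith
      gcongr
    have h1 := (hL _ _ hL1 hly0 hl).1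
    have h2 : y ^ (1 / 3 : ℝ) ≤ growth P σ T :=
      Real.rpow_le_rpow (by linarith) hy2 (by norm_num)
    have h3 := growth_nonneg (σ := σ) hP T
    rw [gapTerm_eq hP]
    refine hh.trans ?_
    rw [mul_left_comm]
    calc _ ≤ growth P σ T * (4 * (gapConst P σ G β Δ lam
          + (3 * C5 P β lam + C6 P G β lam) * logTerm P σ T) ^ (2 / 3 : ℝ)) := by
          refine mul_le_mul h2 h1 ?_ h3
          positivity
      _ = _ := by ring
  · obtain ⟨h1, h2⟩ := hlarge hS₀
    exact ⟨h1, (hL _ 0 h2 le_rfl (hL₀.trans h2)).2⟩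

/-- The size of `gapTerm` if the noise is large. -/
theorem exists_gapTerm_le (hP : P.Valid) (hlam : 0 < lam) (σ : ℝ) :
    ∃ K : ℝ, 0 ≤ K ∧ ∀ (β Δ : ℝ) (T : ℕ), 1 ≤ β → 0 ≤ gapConst P σ G β Δ lam → 1 ≤ σ ^ 2 * T →
      gapConst P σ G β Δ lam ≤ (3 * C5 P β lam + C6 P G β lam) * logTerm P σ T →
      4 * gapTerm P σ G β Δ lam T ≤ K * (β ^ (P.ph / P.p)
        * Real.log (1 + σ ^ 2 * T) ^ (P.ph / (1 - P.p)) * (1 + σ ^ 2 * T) ^ (P.ph / 3)) := by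
  have ha := hP.a₀_pos
  have hη := hP.η_pos
  have hph := hP.ph_pos
  have hp := hP.p_pos
  have hp1 : 0 < 1 - P.p := by linarith [hP.p_le]
  have hs := one_le_one_div_p_sub_one hP
  set s := 1 / P.p - 1 with hsdef
  set κ₁ := (1 + 6 * lam * G ^ 2 / P.a₀ ^ 2 + (1 / lam + 6 * lam)) * P.η with hκ₁
  have hκ₁0 : 0 < κ₁ := by positivity
  set K₄ := 18 * lam * P.a₀ ^ 2 / P.η + κ₁ ^ s / (1 - P.p) with hK₄
  -- Dividing by log 2 turns the additive constant into a multiple of log(1 + σ²T), which is at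
  -- least log 2 here.
  set K₃ := Real.log (1 + 4 / P.a₀ ^ (2 / 3 : ℝ)) / Real.log 2 + 1 with hK₃
  have hK₄0 : 0 ≤ K₄ := by positivity
  have hlog2 : 0 < Real.log 2 := Real.log_pos one_lt_two
  have hlg0 : 0 ≤ Real.log (1 + 4 / P.a₀ ^ (2 / 3 : ℝ)) :=
    Real.log_nonneg (le_add_of_nonneg_right (by positivity))
  have hK₃0 : 0 ≤ K₃ := by positivity
  refine ⟨4 * ((2 * K₄ * K₃) ^ (2 / 3 : ℝ) * (1 + 4 / P.a₀ ^ (2 * P.ph)) ^ (1 / 3 : ℝ)),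
    by positivity, fun β Δ T hβ hgap hT hle => ?_⟩
  have hβ0 : 0 < β := by linarith
  have hm : max β 1 = β := max_eq_left hβ
  have hv0 : 0 ≤ σ ^ 2 * (T : ℝ) := by positivity
  -- For β ≥ 1, C₇ + C₈ is linear in β and C₅ decreases in β, so the slope is of order β^(1/p-1);
  -- its power 2/3 is β^(p̂/p).
  have hB : 3 * C5 P β lam + C6 P G β lam ≤ K₄ * β ^ s := by
    have e : C78 P G β lam = κ₁ * β := by rw [C78, C7, C8, hm, hκ₁]; ring
    have hβs : 1 ≤ β ^ s := Real.one_le_rpow hβ (by linarith)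
    have h5 : 3 * C5 P β lam ≤ 18 * lam * P.a₀ ^ 2 / P.η * β ^ s := by
      rw [C5_eq, hm]
      calc 3 * (6 * lam * P.a₀ ^ 2 / (P.η * β)) ≤ 3 * (6 * lam * P.a₀ ^ 2 / (P.η * 1)) := by
            gcongr
        _ = 18 * lam * P.a₀ ^ 2 / P.η * 1 := by ring
        _ ≤ _ := by gcongr
    rw [C6_eq, e, Real.mul_rpow hκ₁0.le hβ0.le, hK₄, add_mul, div_mul_eq_mul_div (κ₁ ^ s)]
    linarith
  have hlogv : Real.log 2 ≤ Real.log (1 + σ ^ 2 * T) :=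
    Real.log_le_log (by norm_num) (by linarith)
  have hL : logTerm P σ T ≤ K₃ * Real.log (1 + σ ^ 2 * T) := by
    rw [logTerm_eq hP]
    have h1 : (2 * σ ^ 2 * (T : ℝ)) ^ (1 / 3 : ℝ) ≤ 2 * (σ ^ 2 * T) := by
      have := Real.rpow_le_rpow_of_exponent_le (x := 2 * σ ^ 2 * (T : ℝ)) (by linarith)
        (show (1 / 3 : ℝ) ≤ 1 by norm_num)
      rw [Real.rpow_one] at this
      linarith
    have h2 : 1 + 2 * (2 * σ ^ 2 * (T : ℝ)) ^ (1 / 3 : ℝ) / P.a₀ ^ (2 / 3 : ℝ)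
        ≤ (1 + 4 / P.a₀ ^ (2 / 3 : ℝ)) * (1 + σ ^ 2 * T) := by
      have h3 : 2 * (2 * σ ^ 2 * (T : ℝ)) ^ (1 / 3 : ℝ) / P.a₀ ^ (2 / 3 : ℝ)
          ≤ 2 * (2 * (σ ^ 2 * T)) / P.a₀ ^ (2 / 3 : ℝ) := by gcongr
      have e : 2 * (2 * (σ ^ 2 * (T : ℝ))) / P.a₀ ^ (2 / 3 : ℝ)
          = 4 / P.a₀ ^ (2 / 3 : ℝ) * (σ ^ 2 * T) := by ring
      have h4 : 0 ≤ 4 / P.a₀ ^ (2 / 3 : ℝ) := by positivity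
      nlinarith
    refine (Real.log_le_log (by positivity) h2).trans ?_
    rw [Real.log_mul (by positivity) (by positivity), hK₃, add_mul, one_mul]
    gcongr
    rw [div_mul_eq_mul_div, le_div_iff₀ hlog2]
    gcongr
  have hlog0 : 0 ≤ Real.log (1 + σ ^ 2 * T) := by linarith
  have hbr : gapConst P σ G β Δ lam + (3 * C5 P β lam + C6 P G β lam) * logTerm P σ T
      ≤ 2 * K₄ * K₃ * (β ^ s * Real.log (1 + σ ^ 2 * T)) := by
    have h1 : (3 * C5 P β lam + C6 P G β lam) * logTerm P σ T
        ≤ (K₄ * β ^ s) * (K₃ * Real.log (1 + σ ^ 2 * T)) :=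
      mul_le_mul hB hL (logTerm_nonneg hP T) (by positivity)
    nlinarith
  have hL0 : 0 ≤ (3 * C5 P β lam + C6 P G β lam) * logTerm P σ T := hgap.trans hle
  have hbr' := Real.rpow_le_rpow (add_nonneg hgap hL0) hbr (show (0 : ℝ) ≤ 2 / 3 by norm_num)
  have e1 : s * (2 / 3) = P.ph / P.p := by
    rw [hsdef, Params.ph]; field_simp
  rw [Real.mul_rpow (by positivity) (by positivity), Real.mul_rpow (by positivity) hlog0,
    ← Real.rpow_mul hβ0.le, e1] at hbr'
  have hgr : growth P σ T
      ≤ (1 + 4 / P.a₀ ^ (2 * P.ph)) ^ (1 / 3 : ℝ) * (1 + σ ^ 2 * T) ^ (P.ph / 3) := by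
    have e2 : (1 + σ ^ 2 * (T : ℝ)) ^ (P.ph / 3) = ((1 + σ ^ 2 * T) ^ P.ph) ^ (1 / 3 : ℝ) := by
      rw [← Real.rpow_mul (by positivity)]; ring_nf
    rw [e2, ← Real.mul_rpow (by positivity) (by positivity), growth]
    refine Real.rpow_le_rpow (zero_le_one.trans (one_le_growth_base hP T)) ?_ (by norm_num)
    have h1 : 1 ≤ (1 + σ ^ 2 * (T : ℝ)) ^ P.ph := Real.one_le_rpow (by linarith) hph.le
    have h2 : noise P σ T ≤ 2 * (1 + σ ^ 2 * T) ^ P.ph := by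
      have h3 : (2 : ℝ) ^ P.ph ≤ 2 := by
        simpa using Real.rpow_le_rpow_of_exponent_le (x := 2) (by norm_num)
          (show P.ph ≤ 1 by linarith [hP.ph_le_half])
      rw [noise, mul_assoc, Real.mul_rpow (by norm_num) hv0]
      gcongr
      linarith
    have h4 : 2 * noise P σ T / P.a₀ ^ (2 * P.ph)
        ≤ 2 * (2 * (1 + σ ^ 2 * T) ^ P.ph) / P.a₀ ^ (2 * P.ph) := by gcongr
    have e3 : 2 * (2 * (1 + σ ^ 2 * (T : ℝ)) ^ P.ph) / P.a₀ ^ (2 * P.ph)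
        = 4 / P.a₀ ^ (2 * P.ph) * (1 + σ ^ 2 * T) ^ P.ph := by ring
    linarith
  rw [gapTerm_eq hP, ph_div hP]
  have := mul_le_mul hbr' hgr (growth_nonneg hP T) (by positivity)
  calc _ ≤ 4 * _ := mul_le_mul_of_nonneg_left this (by norm_num)
    _ = _ := by ring

end

/-! ### The output -/

theorem sum_rpow_le_rpow_sum {T : ℕ} (hT : 1 ≤ T) {r : ℝ} (hr : 0 ≤ r) (hr1 : r ≤ 1)
    {φ : ℕ → ℝ} (hφ : ∀ n, 0 ≤ φ n) :
    (T : ℝ)⁻¹ * ∑ n ∈ Finset.range T, φ n ^ r ≤ (T : ℝ)⁻¹ ^ r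
      * (∑ n ∈ Finset.range T, φ n) ^ r := by
  have hT0 : (0 : ℝ) < T := by exact_mod_cast hT
  have h := (Real.concaveOn_rpow hr hr1).le_map_sum (t := Finset.range T)
    (w := fun _ => (T : ℝ)⁻¹) (p := φ) (fun _ _ => by positivity)
    (by rw [Finset.sum_const, Finset.card_range, nsmul_eq_mul, mul_inv_cancel₀ hT0.ne'])
    (fun n _ => hφ n)
  simp only [smul_eq_mul, ← Finset.mul_sum] at h
  rwa [Real.mul_rpow (by positivity) (Finset.sum_nonneg fun n _ => hφ n)] at h

/-- The expectation at an independent uniform index is the average of the expectations. -/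
theorem IsOutputIndex.integral_eq {Ξ Ω : Type*} [MeasurableSpace Ξ] [MeasurableSpace Ω]
    {μ : Measure Ω} [IsProbabilityMeasure μ] {ξ : ℕ → Ω → Ξ} {T : ℕ} {ι : Ω → ℕ} (hT : 1 ≤ T)
    (h : IsOutputIndex μ ξ T ι) (hξ : ∀ n, Measurable (ξ n)) {φ : ℕ → (ℕ → Ξ) → ℝ}
    (hφ : ∀ n, Measurable (φ n)) {C : ℝ} (hC : ∀ n z, |φ n z| ≤ C) :
    Integrable (fun ω => φ (ι ω) fun k => ξ k ω) μ ∧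
      ∫ ω, φ (ι ω) (fun k => ξ k ω) ∂μ
        = (T : ℝ)⁻¹ * ∑ n ∈ Finset.range T, ∫ ω, φ n (fun k => ξ k ω) ∂μ := by
  have hT0 : (T : ENNReal) ≠ 0 := by exact_mod_cast (by omega : T ≠ 0)
  have hZ : Measurable fun ω k => ξ k ω := measurable_pi_lambda _ hξ
  have hm : Measurable fun w : ℕ × (ℕ → Ξ) => φ w.1 w.2 :=
    measurable_from_prod_countable_right fun n => hφ n
  have hint : Integrable (fun ω => φ (ι ω) fun k => ξ k ω) μ :=
    Integrable.of_bound (hm.comp (h.measurable.prodMk hZ)).aestronglyMeasurable C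
      (Filter.Eventually.of_forall fun ω => hC _ _)
  refine ⟨hint, ?_⟩
  have hset : ∀ n, MeasurableSet (ι ⁻¹' {n}) := fun n => h.measurable (measurableSet_singleton n)
  have hrange : ∀ᵐ ω ∂μ, ι ω < T := by
    have hu : μ (⋃ n ∈ Finset.range T, ι ⁻¹' {n}) = 1 := by
      rw [measure_biUnion_finset (fun i _ j _ hij => ?_) fun n _ => hset n,
        Finset.sum_congr rfl fun n hn => h.uniform n (Finset.mem_range.1 hn), Finset.sum_const,
        Finset.card_range, nsmul_eq_mul, ENNReal.mul_inv_cancel hT0 (ENNReal.natCast_ne_top T)]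
      exact Disjoint.preimage ι (Set.disjoint_singleton.2 hij)
    have hae := (prob_compl_eq_zero_iff (Finset.measurableSet_biUnion _ fun n _ => hset n)).2 hu
    filter_upwards [measure_eq_zero_iff_ae_notMem.1 hae] with ω hω
    simpa using hω
  -- Splitting by the value of the index makes each term a product of a function of the index and a
  -- function of the samples, so independence applies.
  have hsum : (fun ω => φ (ι ω) fun k => ξ k ω) =ᵐ[μ] fun ω =>
      ∑ n ∈ Finset.range T, ({n} : Set ℕ).indicator 1 (ι ω) * φ n fun k => ξ k ω := by
    filter_upwards [hrange] with ω hω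
    rw [Finset.sum_eq_single_of_mem (ι ω) (Finset.mem_range.2 hω)]
    · simp
    · intro n _ hn
      simp [Ne.symm hn]
  have hind : ∀ n, Measurable (({n} : Set ℕ).indicator (1 : ℕ → ℝ)) := fun n =>
    measurable_one.indicator (measurableSet_singleton n)
  have hterm : ∀ n ∈ Finset.range T,
      ∫ ω, ({n} : Set ℕ).indicator 1 (ι ω) * φ n (fun k => ξ k ω) ∂μ
        = (T : ℝ)⁻¹ * ∫ ω, φ n (fun k => ξ k ω) ∂μ := by
    intro n hn
    rw [h.indep.integral_fun_comp_mul_comp h.measurable.aemeasurable hZ.aemeasurable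
      (hind n).aestronglyMeasurable (hφ n).aestronglyMeasurable]
    congr 1
    have e : (fun ω => ({n} : Set ℕ).indicator (1 : ℕ → ℝ) (ι ω))
        = (ι ⁻¹' {n}).indicator 1 := by
      funext ω; simp [Set.indicator]
    rw [e, integral_indicator_one (hset n), measureReal_def,
      h.uniform n (Finset.mem_range.1 hn)]
    simp
  rw [integral_congr_ae hsum, integral_finsetSum _ fun n _ => ?_, Finset.sum_congr rfl hterm,
    Finset.mul_sum]
  refine Integrable.of_bound (((hind n).comp h.measurable).mul
    ((hφ n).comp hZ)).aestronglyMeasurable C (Filter.Eventually.of_forall fun ω => ?_)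
  have hC0 := (abs_nonneg _).trans (hC n fun k => ξ k ω)
  rw [Real.norm_eq_abs, abs_mul]
  refine (mul_le_mul ?_ (hC n _) (abs_nonneg _) zero_le_one).trans (one_mul C).le
  by_cases hn : ι ω = n <;> simp [hn]

/-- The uniform index turns the expectation into an average over the steps, and concavity of the
power p̂ ≤ 1 bounds the average of ‖∇F(x_t)‖^(2p̂) by (H_T/T)^p̂. -/
theorem Assumptions.integral_output_le {d : ℕ} {Ξ Ω : Type*} [MeasurableSpace Ξ]
    [MeasurableSpace Ω] {D : Measure Ξ} [IsProbabilityMeasure D] {f : Space d → Ξ → ℝ}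
    {σ G β : ℝ} {P : Params} {μ : Measure Ω} [IsProbabilityMeasure μ] {ξ : ℕ → Ω → Ξ}
    (h : Assumptions D f σ G β) (hβ : 0 ≤ β) (hP : P.Valid) (hs : IsSampling D μ ξ)
    (x₁ : Space d) {T : ℕ} (hT : 1 ≤ T) {ι : Ω → ℕ} (hι : IsOutputIndex μ ξ T ι) :
    Integrable (fun ω => ‖gradient (objective D f)
        (run P (stochGrad f) x₁ (fun n => ξ n ω) (ι ω)).x‖ ^ (2 * P.ph)) μ ∧
      ∫ ω, ‖gradient (objective D f)
          (run P (stochGrad f) x₁ (fun n => ξ n ω) (ι ω)).x‖ ^ (2 * P.ph) ∂μ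
        ≤ (T : ℝ)⁻¹ ^ P.ph * ∫ ω, H P D f x₁ (fun n => ξ n ω) T ^ P.ph ∂μ := by
  have hph := hP.ph_pos
  obtain ⟨hi, he⟩ := hι.integral_eq hT hs.measurable
    (φ := fun n z => ‖gradient (objective D f) (run P (stochGrad f) x₁ z n).x‖ ^ (2 * P.ph))
    (fun n => (((h.continuous_gradient hβ).measurable.comp (State.measurable_x.comp
      (measurable_run P h.measurable_grad x₁ n))).norm.pow_const _))
    (C := G ^ (2 * P.ph)) (fun n z => by
      rw [abs_of_nonneg (by positivity)]
      exact Real.rpow_le_rpow (norm_nonneg _) (h.norm_gradient_le _) (by positivity))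
  refine ⟨hi, ?_⟩
  have e : ∀ n ω, ‖gradient (objective D f) (run P (stochGrad f) x₁ (fun k => ξ k ω) n).x‖
      ^ (2 * P.ph) = gradNormSq P D f x₁ (fun k => ξ k ω) n ^ P.ph := fun n ω => by
    rw [gradNormSq, Real.rpow_mul (norm_nonneg _)]
    norm_cast
  rw [he]
  simp_rw [e]
  have hg := fun n => (h.essBdd_gradNormSq hβ hs P x₁ n).rpow hph.le
  rw [← integral_finsetSum _ fun n _ => (hg n).integrable, ← integral_const_mul,
    ← integral_const_mul]
  exact integral_mono ((EssBdd.sum _ hg).const_mul _).integrable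
    (((h.essBdd_H hβ hs P x₁ T).rpow hph.le).const_mul _).integrable
    fun ω => sum_rpow_le_rpow_sum hT hph.le (by linarith [hP.ph_le_half]) fun n => sq_nonneg _

/-- The rate for the output, from the rate for `H_T`. -/
theorem inv_rpow_mul_rpow_le {σ r : ℝ} {T : ℕ} (hσ : 0 ≤ σ) (hT : 1 ≤ T) (hr : 0 ≤ r)
    (hr1 : r ≤ 1) :
    (T : ℝ)⁻¹ ^ r * (1 + σ ^ 2 * T) ^ (r / 3)
      ≤ 1 / (T : ℝ) ^ r + σ ^ (2 * r / 3) / (T : ℝ) ^ (2 * r / 3) := by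
  have hT0 : (0 : ℝ) < T := by exact_mod_cast hT
  have h1 : (1 + σ ^ 2 * (T : ℝ)) ^ (r / 3) ≤ 1 + σ ^ (2 * r / 3) * (T : ℝ) ^ (r / 3) := by
    refine (add_rpow_le zero_le_one (by positivity) (by positivity) (by linarith)).trans ?_
    rw [Real.one_rpow, Real.mul_rpow (by positivity) hT0.le, ← Real.rpow_natCast,
      ← Real.rpow_mul hσ]
    apply le_of_eq
    push_cast
    ring_nf
  have e : (T : ℝ) ^ r = (T : ℝ) ^ (r / 3) * (T : ℝ) ^ (2 * r / 3) := by
    rw [← Real.rpow_add hT0]; ring_nf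
  have hTr : 0 < (T : ℝ) ^ (r / 3) := by positivity
  rw [Real.inv_rpow hT0.le]
  calc _ ≤ ((T : ℝ) ^ r)⁻¹ * (1 + σ ^ (2 * r / 3) * (T : ℝ) ^ (r / 3)) := by gcongr
    _ = 1 / (T : ℝ) ^ r + σ ^ (2 * r / 3) * (T : ℝ) ^ (r / 3) / (T : ℝ) ^ r := by ring
    _ = _ := by rw [e]; field_simp

end MetaStormSG

/-! ### Assembly of the explicit bound and the rates -/

theorem mainTheorem6 (P : MetaStormSG.Params) (hP : P.Valid) (σ G lam : ℝ)
    (hσ : 0 ≤ σ) (hG : 0 ≤ G) (hlam : 0 < lam) :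
    ∃ (C9 C10 : ℝ → ℝ → ℝ) (K : ℝ),
      ∀ (β : ℝ), 0 < β →
      ∀ (d : ℕ) (Ξ : Type*) [MeasurableSpace Ξ] (D : Measure Ξ) [IsProbabilityMeasure D]
        (f : MetaStormSG.Space d → Ξ → ℝ) (x₁ : MetaStormSG.Space d),
      MetaStormSG.Assumptions D f σ G β →
      ∀ (Ω : Type*) [MeasurableSpace Ω] (μ : Measure Ω) [IsProbabilityMeasure μ]
        (ξ : ℕ → Ω → Ξ),
      MetaStormSG.IsSampling D μ ξ →
      ∀ (Δ : ℝ), Δ = MetaStormSG.gap D f x₁ →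
      ∀ (T : ℕ), 1 ≤ T →
        -- the explicit bound
        (Integrable (fun ω => MetaStormSG.H P D f x₁ (fun n => ξ n ω) T ^ P.ph) μ ∧
          ∫ ω, MetaStormSG.H P D f x₁ (fun n => ξ n ω) T ^ P.ph ∂μ
            ≤ MetaStormSG.explicitBound P σ G β Δ lam (C9 β Δ) (C10 β Δ) T) ∧
        -- the two rates, for positive `σ` and `T` large enough to eliminate `C9` and `C10`
        (0 < σ → 1 ≤ β →
          4 * C9 β Δ < MetaStormSG.noise P σ T → 4 * C10 β Δ < MetaStormSG.noise P σ T →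
          (∫ ω, MetaStormSG.H P D f x₁ (fun n => ξ n ω) T ^ P.ph ∂μ
            ≤ K * (MetaStormSG.rateFactor P σ β Δ T * (1 + σ ^ 2 * T) ^ (P.ph / 3))) ∧
          ∀ (ι : Ω → ℕ), MetaStormSG.IsOutputIndex μ ξ T ι →
            Integrable
              (fun ω => ‖gradient (MetaStormSG.objective D f)
                (MetaStormSG.run P (MetaStormSG.stochGrad f) x₁ (fun n => ξ n ω) (ι ω)).x‖
                  ^ (2 * P.ph)) μ ∧
            ∫ ω, ‖gradient (MetaStormSG.objective D f)
                (MetaStormSG.run P (MetaStormSG.stochGrad f) x₁ (fun n => ξ n ω) (ι ω)).x‖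
                  ^ (2 * P.ph) ∂μ
              ≤ K * (MetaStormSG.rateFactor P σ β Δ T
                  * (1 / (T : ℝ) ^ P.ph + σ ^ (2 * P.ph / 3) / (T : ℝ) ^ (2 * P.ph / 3)))) := by
  have hph := hP.ph_pos
  choose M S₀ hM hS₀ hmain using MetaStormSG.exists_thresholds (lam := lam) hP hG hlam σ
  obtain ⟨K, hK0, hK⟩ := MetaStormSG.exists_gapTerm_le (G := G) hP hlam σ
  -- C₉ is the bound for the regime S_T < 2h and C₁₀ the threshold of the opposite regime; both
  -- depend on β and Δ, while K was obtained before these were introduced.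
  refine ⟨M, S₀, K, ?_⟩
  intro β hβ d Ξ _ D _ f x₁ hA Ω _ μ _ ξ hξ Δ hΔ T hT
  have hΔ0 : 0 ≤ Δ := hΔ ▸ hA.gap_nonneg x₁
  have hint := ((hA.essBdd_H hβ.le hξ P x₁ T).rpow hph.le).integrable
  obtain ⟨N, rfl⟩ := Nat.exists_eq_succ_of_ne_zero (Nat.one_le_iff_ne_zero.1 hT)
  obtain ⟨y, hy1, hyh, hh⟩ := hA.integral_H_rpow_le (lam := lam) hβ.le hP hlam hξ x₁ N
  rw [← hΔ] at hh
  obtain ⟨hself, hgap, hlarge⟩ := hmain β Δ hΔ0 (N + 1) _ y hy1 hyh hh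
  have hM0 := hM β Δ
  have hS0 := hS₀ β Δ
  have hc := MetaStormSG.caseTerm_nonneg (σ := σ) (β := β) hP hG (N + 1)
  have hg := MetaStormSG.gapTerm_nonneg (σ := σ) (β := β) hP hlam hG hΔ0 (N + 1)
  set h := ∫ ω, MetaStormSG.H P D f x₁ (fun n => ξ n ω) (N + 1) ^ P.ph ∂μ with hdef
  refine ⟨⟨hint, ?_⟩, fun hσ0 hβ1 hC9 hC10 => ?_⟩
  · rw [MetaStormSG.explicitBound]
    have i1 : 0 ≤ if MetaStormSG.noise P σ (N + 1) ≤ 4 * M β Δ then 4 * M β Δ else 0 := by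
      split_ifs <;> positivity
    have i2 : 0 ≤ if MetaStormSG.noise P σ (N + 1) ≤ 4 * S₀ β Δ then 4 * S₀ β Δ else 0 := by
      split_ifs <;> positivity
    rcases lt_or_ge (MetaStormSG.noise P σ (N + 1)) (2 * h) with hS | hS
    · have h1 := hself hS
      -- Here S_T < 2h ≤ 2C₉, so the first indicator equals 1.
      rw [if_pos (show MetaStormSG.noise P σ (N + 1) ≤ 4 * M β Δ by linarith)]
      linarith
    · rcases le_or_gt (MetaStormSG.noise P σ (N + 1)) (4 * S₀ β Δ) with hS' | hS'
      · rw [if_pos hS']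
        linarith
      · have h1 := hgap hS (by linarith)
        linarith
  -- The regime S_T < 2h would give S_T < 2C₉, against S_T > 4C₉.
  · have hS : 2 * h ≤ MetaStormSG.noise P σ (N + 1) := by
      by_contra hcon
      push Not at hcon
      have := hself hcon
      linarith
    have hS' : S₀ β Δ < MetaStormSG.noise P σ (N + 1) := by linarith
    obtain ⟨hT1, hle⟩ := hlarge hS'
    have h1 := (hgap hS hS').trans
      (hK β Δ (N + 1) hβ1 (MetaStormSG.gapConst_nonneg hP hlam hG hΔ0) hT1 hle)
    have hlogβ : 0 ≤ Real.log β := Real.log_nonneg hβ1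
    have hrate : h ≤ K * (MetaStormSG.rateFactor P σ β Δ (N + 1)
        * (1 + σ ^ 2 * (N + 1 : ℕ)) ^ (P.ph / 3)) := by
      refine h1.trans ?_
      rw [MetaStormSG.rateFactor]
      gcongr
      -- The summand with log(1 + σ²T) alone already suffices; the summands with Δ and log β are
      -- only nonnegative extras.
      exact le_add_of_nonneg_left (by positivity)
    refine ⟨hrate, fun ι hι => ?_⟩
    obtain ⟨h2, h3⟩ := hA.integral_output_le hβ.le hP hξ x₁ hT hι
    refine ⟨h2, h3.trans ?_⟩
    have hQ : 0 ≤ MetaStormSG.rateFactor P σ β Δ (N + 1) := by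
      have : 0 ≤ Real.log (1 + σ ^ 2 * (N + 1 : ℕ)) :=
        Real.log_nonneg (le_add_of_nonneg_right (by positivity))
      rw [MetaStormSG.rateFactor]
      positivity
    have h4 := MetaStormSG.inv_rpow_mul_rpow_le hσ hT hph.le (by linarith [hP.ph_le_half])
    calc _ ≤ ((N + 1 : ℕ) : ℝ)⁻¹ ^ P.ph * (K * (MetaStormSG.rateFactor P σ β Δ (N + 1)
            * (1 + σ ^ 2 * (N + 1 : ℕ)) ^ (P.ph / 3))) :=
          mul_le_mul_of_nonneg_left hrate (by positivity)
      _ = K * (MetaStormSG.rateFactor P σ β Δ (N + 1) * (((N + 1 : ℕ) : ℝ)⁻¹ ^ P.ph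
            * (1 + σ ^ 2 * (N + 1 : ℕ)) ^ (P.ph / 3))) := by ring
      _ ≤ _ := by gcongr
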